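/- **Utilities.** There are $D$ divisible resources, partitioned into groups $D_1,\dots,D_k$. A *speed-up utility* is a function $u(x)=\sum_{i=1}^k g_i\big(\sum_{d\in D_i}a_dx_d\big)$ on $[0,1]^D$ with $a_d\ge 0$ and each $g_i:[0,\infty)\to\mathbb R$ concave, nondecreasing and continuous (for $k=1$ this is $u(x)=g(\sum_d a_dx_d)$). For prices $q\in\mathbb R^D_{\ge0}$ let $\mathcal D(u,q)=\arg\max_{x\in[0,1]^D}\,(u(x)-q\cdot x)$. 1. *Greedy.* Order the resources by decreasing $a_d/q_d$ (with $a/0=\infty$ for $a>0$ and $0/0=0$), ties broken arbitrarily. Within each group, take the resources fractionally in this order, each one until it is exhausted ($x_d=1$) or taking more of it brings no gain in $u(x)-q\cdot x$, and stop at the first resource that is not exhausted. The resulting vector lies in $\mathcal D(u,q)$. 2. *Linear substitutes.* If $0\le q\le q'$ and $x\in\mathcal D(u,q)$, there is $y\in\mathcal D(u,q')$ with $y_d\ge x_d$ for all $d$ with $q_d=q'_d$. 3. If $q\ge 0$, $y\in\mathcal D(u,q)$ and $\lambda\ge1$, there is $y'\in\mathcal D(u,\lambda q)$ with $y'\le y$.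 4. If $0\le q\le q'$ and $y\in\mathcal D(u,q)$, there is $y'\in\mathcal D(u,q')$ with $u(y')\le u(y)$. **Scheduling.** Job $j\in\{1,\dots,n\}$ has arrival time $r_j\ge0$, size $p_j>0$, weight $w_j>0$ and a speed-up utility $u_j$ (with its own groups, coefficients and curves) such that $u_j(0,\dots,0)\ge0$ and $u_j(1,\dots,1)>0$. Let $\mathcal P$ be the set of rate vectors $z$ for which there are $x_j\in\mathbb R^D_{\ge0}$ with $\sum_jx_{jd}\le1$ for all $d$ and $0\le z_j\le u_j(x_j)$ for all $j$. A *schedule of speed $s$* processes the jobs at measurable rates $z(t)\in s\mathcal P$, no job before its arrival or beyond its size; $p_j(t)$ is the remaining size of $j$. The *residual optimum* is $$f(x)=\inf\Big\{\sum_j\frac{w_j}{p_j}\int_0^\infty t\,z_j(t)\,dt:\ z(t)\in\mathcal P\ \text{for all } t,\ \int_0^\infty z_j(t)\,dt=x_j\ \text{for all } j\Big\}.$$ *Gradient descent* (GD) with speed $s$ processes, at almost every time $t\ge0$, at rates $s\,y$, where $y$ minimizes the one-sided directional derivative $\lim_{\delta\downarrow0}\frac1\delta\big(f(x-\delta y)-f(x)\big)$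 over all $y\in\mathcal P$ with $y_j=0$ whenever $x_j=0$; here $x$ is the vector of current remaining sizes, with $x_j=0$ for jobs that have not arrived. 5. This rule is online: the set of GD directions depends only on the sizes, weights, utilities and remaining sizes of the arrived unfinished jobs. For every instance and every $s>0$ a GD schedule of speed $s$ exists. 6. GD is scalable. For every $\varepsilon>0$ there is a constant $C$ depending only on $\varepsilon$ such that for every instance: (a) every GD schedule of speed $1+\varepsilon$ has total fractional weighted flow time $\sum_j\int_{r_j}^\infty \frac{w_j}{p_j}p_j(t)\,dt$ at most $C$ times that of any schedule of speed $1$; (b) for every GD schedule $z$ of speed $\sqrt{1+\varepsilon}$, the schedule that simulates $z$ and processes every job that it has not finished yet $\sqrt{1+\varepsilon}$ times as fast as $z$ does is a schedule of speed $1+\varepsilon$, and its total weighted flow time $\sum_jw_j(C_j-r_j)$, where $C_j$ is the completion time of $j$, is at most $C$ times that of any schedule of speed $1$. -/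

import Mathlib

open MeasureTheory Set

/-! ## Demand, linear substitutes -/

/-- `demand u q`: the bundles `x ∈ [0,1]^D` that maximize the quasi-linear utility `u x - q · x`. -/
def demand {D : ℕ} (u : (Fin D → ℝ) → ℝ) (q : Fin D → ℝ) : Set (Fin D → ℝ) :=
  {x | x ∈ Icc (0 : Fin D → ℝ) 1 ∧
    ∀ y ∈ Icc (0 : Fin D → ℝ) 1, u y - ∑ d, q d * y d ≤ u x - ∑ d, q d * x d}

/-- Linear substitutes: when some prices go up, the demand for the resources whose price did not
change does not go down. -/
def LinearSubstitute {D : ℕ} (u : (Fin D → ℝ) → ℝ) : Prop :=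
  ∀ q q' : Fin D → ℝ, 0 ≤ q → q ≤ q' → ∀ x ∈ demand u q,
    ∃ y ∈ demand u q', ∀ d, q d = q' d → x d ≤ y d

/-- Scaling all prices up by a common factor can only shrink the demanded bundle. -/
def ScalingShrinksDemand {D : ℕ} (u : (Fin D → ℝ) → ℝ) : Prop :=
  ∀ q : Fin D → ℝ, 0 ≤ q → ∀ l : ℝ, 1 ≤ l → ∀ y ∈ demand u q,
    ∃ y' ∈ demand u (l • q), y' ≤ y

/-- Raising prices can only lower the utility of the demanded bundle. -/
def RaisingLowersUtility {D : ℕ} (u : (Fin D → ℝ) → ℝ) : Prop :=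
  ∀ q q' : Fin D → ℝ, 0 ≤ q → q ≤ q' → ∀ y ∈ demand u q,
    ∃ y' ∈ demand u q', u y' ≤ u y

/-! ## Speed-up curves on partitioned resources -/

/-- The `D` resources are partitioned into `k` groups (`group d` is the group of `d`), and each
group has a concave, monotone, continuous speed-up curve on `[0, ∞)`. The case of a single
univariate function is `k = 1`. -/
structure SpeedUpUtility (D : ℕ) where
  k : ℕ
  group : Fin D → Fin k
  a : Fin D → ℝ
  g : Fin k → ℝ → ℝ
  a_nonneg : ∀ d, 0 ≤ a d
  g_mono : ∀ i, MonotoneOn (g i) (Ici 0)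
  g_concave : ∀ i, ConcaveOn ℝ (Ici 0) (g i)
  g_cont : ∀ i, ContinuousOn (g i) (Ici 0)

/-- `u(x) = ∑_i g_i (∑_{d in group i} a_d x_d)`. -/
def SpeedUpUtility.eval {D : ℕ} (u : SpeedUpUtility D) (x : Fin D → ℝ) : ℝ :=
  ∑ i, u.g i (∑ d with u.group d = i, u.a d * x d)

/-! ## The greedy procedure -/

/-- The amount of a resource with coefficient `a` and price `q` that the greedy procedure takes when
it has already reached the level `z`: it takes more and more of it until the resource is exhausted
or taking any further amount brings no gain. -/
noncomputable def greedyAmount (g : ℝ → ℝ) (a q z : ℝ) : ℝ :=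
  sInf {t | t ∈ Icc (0 : ℝ) 1 ∧
    (t = 1 ∨ ∀ e > 0, g (z + (t + e) * a) - g (z + t * a) - e * q ≤ 0)}

/-- Go through the resources in the order of the list, starting at level `z`, and stop at the first
resource which is not taken completely. -/
noncomputable def greedyFill {D : ℕ} (g : ℝ → ℝ) (a q : Fin D → ℝ) :
    List (Fin D) → ℝ → Fin D → ℝ
  | [], _ => 0
  | d :: L, z =>
      if greedyAmount g (a d) (q d) z < 1 then Pi.single d (greedyAmount g (a d) (q d) z)
      else Function.update (greedyFill g a q L (z + a d)) d 1

/-- The greedy procedure, run on each group of resources in the order of the list `L`. -/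
noncomputable def SpeedUpUtility.greedy {D : ℕ} (u : SpeedUpUtility D) (q : Fin D → ℝ)
    (L : List (Fin D)) : Fin D → ℝ := fun d =>
  greedyFill (u.g (u.group d)) u.a q (L.filter (fun e => u.group e = u.group d)) 0 d

/-- `L` lists every resource once, in decreasing order of `a_d / q_d`, with the `ℝ≥0∞` conventions
`a / 0 = ∞` for `a > 0` and `0 / 0 = 0`. -/
def IsGreedyOrder {D : ℕ} (a q : Fin D → ℝ) (L : List (Fin D)) : Prop :=
  L.Nodup ∧ (∀ d, d ∈ L) ∧
    L.Pairwise (fun d e =>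
      ENNReal.ofReal (a e) / ENNReal.ofReal (q e) ≤ ENNReal.ofReal (a d) / ENNReal.ofReal (q d))

/-! ## The scheduling problem -/

/-- An instance: `n` jobs, with arrival times, sizes, weights and utilities (processing rates as a
function of the resources received), sharing `D` divisible resources, one unit of each. -/
structure SchedInstance (n D : ℕ) where
  arrival : Fin n → ℝ
  size : Fin n → ℝ
  weight : Fin n → ℝ
  util : Fin n → SpeedUpUtility D
  arrival_nonneg : ∀ j, 0 ≤ arrival j
  size_pos : ∀ j, 0 < size j
  weight_pos : ∀ j, 0 < weight j
  /-- processing rates are nonnegative -/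
  util_zero : ∀ j, 0 ≤ (util j).eval 0
  /-- every job can be processed -/
  util_one : ∀ j, 0 < (util j).eval 1

namespace SchedInstance

variable {n D : ℕ}

/-- The vectors of processing rates of the jobs that the resources allow at one moment. -/
def rates (I : SchedInstance n D) : Set (Fin n → ℝ) :=
  {z | ∃ x : Fin n → Fin D → ℝ, (∀ j d, 0 ≤ x j d) ∧ (∀ d, ∑ j, x j d ≤ 1) ∧
    ∀ j, 0 ≤ z j ∧ z j ≤ (I.util j).eval (x j)}

/-- Costs of the (unit speed) schedules `z`, starting at time `0`, of jobs with remaining sizes `x`: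
the total weighted fractional completion time. -/
def residualCosts (I : SchedInstance n D) (x : Fin n → ℝ) : Set ℝ :=
  {c | ∃ z : ℝ → Fin n → ℝ, (∀ j, Measurable fun t => z t j) ∧ (∀ t, z t ∈ I.rates) ∧
    (∀ j, IntegrableOn (fun t => z t j) (Ioi 0)) ∧
    (∀ j, IntegrableOn (fun t => t * z t j) (Ioi 0)) ∧
    (∀ j, ∫ t in Ioi (0 : ℝ), z t j = x j) ∧
    c = ∑ j, I.weight j / I.size j * ∫ t in Ioi (0 : ℝ), t * z t j}

/-- The residual optimum `f(x)`. -/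
noncomputable def residualOpt (I : SchedInstance n D) (x : Fin n → ℝ) : ℝ :=
  sInf (I.residualCosts x)

/-- Rate vectors that only process jobs with positive remaining size. -/
def admissible (I : SchedInstance n D) (x : Fin n → ℝ) : Set (Fin n → ℝ) :=
  {z | z ∈ I.rates ∧ ∀ j, x j = 0 → z j = 0}

/-- `r` is the rate of change of the residual optimum when jobs with remaining sizes `x` are
processed at rates `z`. -/
def HasResidualRate (I : SchedInstance n D) (x z : Fin n → ℝ) (r : ℝ) : Prop :=
  HasDerivWithinAt (fun δ : ℝ => I.residualOpt (x - δ • z)) r (Ici 0) 0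

/-- The gradient descent rule: among all admissible rate vectors, `z` decreases the residual optimum
the fastest. -/
def IsGDDirection (I : SchedInstance n D) (x z : Fin n → ℝ) : Prop :=
  z ∈ I.admissible x ∧ ∃ r, I.HasResidualRate x z r ∧
    ∀ z' ∈ I.admissible x, ∃ r', I.HasResidualRate x z' r' ∧ r ≤ r'

/-- Remaining size of job `j` at time `t` under the schedule `z`. -/
noncomputable def remaining (I : SchedInstance n D) (z : ℝ → Fin n → ℝ) (j : Fin n) (t : ℝ) : ℝ :=
  I.size j - ∫ τ in (0 : ℝ)..t, z τ j

/-- `z t j` is the rate at which job `j` is processed at time `t` by a feasible schedule with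
speed `s`. -/
def IsSchedule (I : SchedInstance n D) (s : ℝ) (z : ℝ → Fin n → ℝ) : Prop :=
  (∀ j, Measurable fun t => z t j) ∧ (∀ t, ∃ y ∈ I.rates, z t = s • y) ∧
    (∀ j t, t < I.arrival j → z t j = 0) ∧ ∀ j t, 0 ≤ I.remaining z j t

/-- The remaining sizes at time `t` of the jobs that have arrived (`0` for the others). -/
noncomputable def state (I : SchedInstance n D) (z : ℝ → Fin n → ℝ) (t : ℝ) : Fin n → ℝ :=
  fun j => if I.arrival j ≤ t then I.remaining z j t else 0

/-- `z` is a schedule produced by gradient descent with speed `s`. -/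
def IsGDSchedule (I : SchedInstance n D) (s : ℝ) (z : ℝ → Fin n → ℝ) : Prop :=
  I.IsSchedule s z ∧
    ∀ᵐ t ∂(volume.restrict (Ici (0 : ℝ))), ∃ y, z t = s • y ∧ I.IsGDDirection (I.state z t) y

/-- Total fractional weighted flow time: `∑_j ∫_{t ≥ r_j} w_j (remaining size) / p_j dt`. -/
noncomputable def fracFlow (I : SchedInstance n D) (z : ℝ → Fin n → ℝ) : ENNReal :=
  ∑ j, ∫⁻ t in Ici (I.arrival j), ENNReal.ofReal (I.weight j / I.size j * I.remaining z j t)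

/-- Completion time of job `j` (`∞` if it is never completed). -/
noncomputable def completion (I : SchedInstance n D) (z : ℝ → Fin n → ℝ) (j : Fin n) : ENNReal :=
  ⨅ (t : ℝ) (_ : I.arrival j ≤ t ∧ I.remaining z j t ≤ 0), ENNReal.ofReal t

/-- Total weighted flow time `∑_j w_j (C_j - r_j)`. -/
noncomputable def flow (I : SchedInstance n D) (z : ℝ → Fin n → ℝ) : ENNReal :=
  ∑ j, ENNReal.ofReal (I.weight j) * (I.completion z j - ENNReal.ofReal (I.arrival j))

/-- Simulate the schedule `z` and process every unfinished job `c` times as fast as `z` does (the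
standard conversion from the fractional to the integral objective). -/
noncomputable def speedUp (I : SchedInstance n D) (c : ℝ) (z : ℝ → Fin n → ℝ) : ℝ → Fin n → ℝ :=
  fun t j => if c * (∫ τ in (0 : ℝ)..t, z τ j) < I.size j then c * z t j else 0

end SchedInstance

/-! ## Concave functions: rearranging two arguments -/

/-! Demand. A speed-up utility sees a bundle only through one level per group, on which a concave
curve acts. If x holds more of resource d than y, then either d does not matter or x has the higher
level in the group of d, and some of d can pass from x to y without loss of total utility
(`exists_transfer`); or d can be traded against another resource of the group with both levels
unchanged (`exists_swap`). A demanded bundle that is extremal for a suitable functional admits no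
further exchange, and this gives the three statements about price changes. Greedy is optimal because
no later resource supplies level at a lower price (`greedyFill_optimal`).

Residual optimum. Let f be the residual optimum and W(x) the sum of w_j x_j / p_j. A schedule pays W
per unit of time, so by dynamic programming no direction lowers f faster than at rate W(x), and the
initial direction of an optimal schedule attains this rate. Gradient descent directions are
therefore exactly those of rate W(x) (`isGDDirection_iff`), and an optimal schedule of the current
residual instance, run at speed s until the next arrival, is gradient descent. This yields
existence.

Supermodularity. By duality f(x) is the maximum over a of the sum of a_j x_j minus the integral of
h((a - ct)^+), where c_j = w_j / p_j and h is the support function of the rate region. The function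
h is submodular on the nonnegative orthant: welfare maximization has market clearing prices
(`exists_prices`), and the indirect utility of one job is submodular in its weight and the prices
(`exists_submodular_exchange`). Combining dual solutions by max and min shows that f is supermodular
(`optCost_supermodular`).

Competitiveness. Let F(v,w) be the residual optimum of the instance in which every job exists twice,
with remaining sizes v under gradient descent and w under the other schedule. The potential is f(v)
- F(v,w)/2. Arrivals do not increase it, by supermodularity. Between arrivals f(v) falls at rate s
W(v), while both schedules together are a schedule of speed s+1 of the doubled instance, so F falls
at rate at most (s+1)(W(v)+W(w)). The potential thus has derivative at most -(s-1)/2 W(v) + (s+1)/2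
W(w). Time sharing gives F(v,w) ≤ 2f(v)+2f(w), so the potential is at least -f(w), and f(w) is at
most the future cost of the other schedule. Integration gives the ratio (s+1)/(s-1). For integral
flow time, a job unfinished in the c-fold simulation still has a fraction above 1 - 1/c of its size
left in the simulated schedule. -/

lemma ConcaveOn.add_le_add_of_between {s : Set ℝ} {g : ℝ → ℝ} (hg : ConcaveOn ℝ s g)
    {a b c d : ℝ} (ha : a ∈ s) (hb : b ∈ s) (hac : a ≤ c) (hcb : c ≤ b) (h : a + b = c + d) :
    g a + g b ≤ g c + g d := by
  rcases eq_or_lt_of_le (hac.trans hcb) with hab | hab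
  · have h1 : c = a := le_antisymm (hab ▸ hcb) hac
    have h2 : d = b := by linarith
    rw [h1, h2]
  · have hpos : 0 < b - a := sub_pos.2 hab
    have hne : b - a ≠ 0 := hpos.ne'
    -- c and d are the convex combinations of a and b with mirrored weights; the two concavity
    -- inequalities add up to the claim.
    have e1 := hg.2 ha hb (div_nonneg (sub_nonneg.2 hcb) hpos.le)
      (div_nonneg (sub_nonneg.2 hac) hpos.le) (by field_simp; ring)
    have e2 := hg.2 ha hb (div_nonneg (sub_nonneg.2 hac) hpos.le)
      (div_nonneg (sub_nonneg.2 hcb) hpos.le) (by field_simp; ring)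
    simp only [smul_eq_mul] at e1 e2
    have c1 : (b - c) / (b - a) * a + (c - a) / (b - a) * b = c := by field_simp; ring
    have c2 : (c - a) / (b - a) * a + (b - c) / (b - a) * b = d := by
      field_simp; linear_combination (b - a) * h
    rw [c1] at e1
    rw [c2] at e2
    have e3 : (b - c) / (b - a) * g a + (c - a) / (b - a) * g b +
        ((c - a) / (b - a) * g a + (b - c) / (b - a) * g b) = g a + g b := by
      field_simp; ring
    linarith

namespace SpeedUpUtility

variable {D : ℕ}

/-- The amount `∑_{d in group i} a_d x_d` on which the curve of group `i` is evaluated. -/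
def level (u : SpeedUpUtility D) (i : Fin u.k) : (Fin D → ℝ) →ₗ[ℝ] ℝ where
  toFun x := ∑ d with u.group d = i, u.a d * x d
  map_add' x y := by simp [mul_add, Finset.sum_add_distrib]
  map_smul' c x := by simp [Finset.mul_sum, mul_left_comm]

variable (u : SpeedUpUtility D)

lemma level_apply (i : Fin u.k) (x : Fin D → ℝ) :
    u.level i x = ∑ d with u.group d = i, u.a d * x d := rfl

lemma eval_eq (x : Fin D → ℝ) : u.eval x = ∑ i, u.g i (u.level i x) := rfl

lemma level_nonneg (i : Fin u.k) {x : Fin D → ℝ} (hx : 0 ≤ x) : 0 ≤ u.level i x :=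
  u.level_apply i x ▸ Finset.sum_nonneg fun d _ => mul_nonneg (u.a_nonneg d) (hx d)

lemma level_mono (i : Fin u.k) {x y : Fin D → ℝ} (h : x ≤ y) : u.level i x ≤ u.level i y := by
  simp only [level_apply]
  exact Finset.sum_le_sum fun d _ => mul_le_mul_of_nonneg_left (h d) (u.a_nonneg d)

lemma level_single (i : Fin u.k) (d : Fin D) (t : ℝ) :
    u.level i (Pi.single d t) = if u.group d = i then u.a d * t else 0 := by
  rw [level_apply, Finset.sum_filter, Finset.sum_eq_single d]
  · simp
  · intro e _ he; simp [Pi.single_eq_of_ne he]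
  · simp

lemma eval_mono {x y : Fin D → ℝ} (hx : 0 ≤ x) (h : x ≤ y) : u.eval x ≤ u.eval y :=
  Finset.sum_le_sum fun i _ => u.g_mono i (u.level_nonneg i hx) (u.level_nonneg i (hx.trans h))
    (u.level_mono i h)

lemma eval_concaveOn : ConcaveOn ℝ (Ici 0) u.eval := by
  refine ⟨convex_Ici 0, fun x hx y hy s t hs ht hst => ?_⟩
  simp only [eval_eq, smul_eq_mul, Finset.mul_sum, ← Finset.sum_add_distrib]
  refine Finset.sum_le_sum fun i _ => ?_
  have := (u.g_concave i).2 (u.level_nonneg i hx) (u.level_nonneg i hy) hs ht hst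
  simpa using this

lemma level_continuous (i : Fin u.k) : Continuous (u.level i) :=
  LinearMap.continuous_of_finiteDimensional _

lemma eval_continuousOn : ContinuousOn u.eval (Ici 0) := by
  refine continuousOn_finsetSum _ fun i _ => ?_
  exact (u.g_cont i).comp (u.level_continuous i).continuousOn fun x hx => u.level_nonneg i hx

lemma eval_add_le_eval_add {x y x' y' : Fin D → ℝ}
    (h : ∀ i, u.g i (u.level i x) + u.g i (u.level i y) ≤
      u.g i (u.level i x') + u.g i (u.level i y')) :
    u.eval x + u.eval y ≤ u.eval x' + u.eval y' := by
  simp only [eval_eq, ← Finset.sum_add_distrib]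
  exact Finset.sum_le_sum fun i _ => h i

end SpeedUpUtility

/-! ## Exchange arguments -/

namespace SpeedUpUtility

variable {D : ℕ} (u : SpeedUpUtility D)

lemma mem_Icc_add_single {x : Fin D → ℝ} (hx : x ∈ Icc (0 : Fin D → ℝ) 1) {d : Fin D} {t : ℝ}
    (h0 : 0 ≤ x d + t) (h1 : x d + t ≤ 1) : x + Pi.single d t ∈ Icc (0 : Fin D → ℝ) 1 := by
  constructor <;> intro e <;> by_cases he : e = d
  · subst he; simpa using h0
  · simpa [Pi.single_eq_of_ne he] using hx.1 e
  · subst he; simpa using h1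
  · simpa [Pi.single_eq_of_ne he] using hx.2 e

lemma dot_add_single (q x : Fin D → ℝ) (d : Fin D) (t : ℝ) :
    ∑ e, q e * (x + Pi.single d t : Fin D → ℝ) e = ∑ e, q e * x e + q d * t := by
  simp only [Pi.add_apply, mul_add, Finset.sum_add_distrib]
  congr 1
  rw [Finset.sum_eq_single d (fun e _ he => by simp [Pi.single_eq_of_ne he]) (by simp),
    Pi.single_eq_same]

/-- Moving some of a resource from the bundle with the higher level to the other one. -/
lemma exists_transfer {x y : Fin D → ℝ} (hx : x ∈ Icc (0 : Fin D → ℝ) 1)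
    (hy : y ∈ Icc (0 : Fin D → ℝ) 1) {d : Fin D} (hd : y d < x d)
    (hl : u.a d = 0 ∨ u.level (u.group d) y < u.level (u.group d) x) :
    ∃ t, 0 < t ∧ t ≤ x d - y d ∧ x + Pi.single d (-t) ∈ Icc (0 : Fin D → ℝ) 1 ∧
      y + Pi.single d t ∈ Icc (0 : Fin D → ℝ) 1 ∧
      u.eval x + u.eval y ≤ u.eval (x + Pi.single d (-t)) + u.eval (y + Pi.single d t) := by
  -- The amount moved changes a level by at most the gap between the two levels. The new levels then
  -- lie between the old ones and have the same sum, so concavity applies.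
  obtain ⟨t, ht, ht1, ht2⟩ : ∃ t, 0 < t ∧ t ≤ x d - y d ∧
      (u.a d = 0 ∨ u.a d * t ≤ u.level (u.group d) x - u.level (u.group d) y) := by
    rcases eq_or_lt_of_le (u.a_nonneg d) with h0 | h0
    · exact ⟨x d - y d, by linarith, le_rfl, Or.inl h0.symm⟩
    · have hl := hl.resolve_left h0.ne'
      refine ⟨min (x d - y d) ((u.level (u.group d) x - u.level (u.group d) y) / u.a d),
        lt_min (by linarith) (div_pos (by linarith) h0), min_le_left _ _, Or.inr ?_⟩
      rw [mul_comm, ← le_div_iff₀ h0]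
      exact min_le_right _ _
  have hx0 := hx.1 d; have hx1 := hx.2 d; have hy0 := hy.1 d; have hy1 := hy.2 d
  simp only [Pi.zero_apply, Pi.one_apply] at hx0 hx1 hy0 hy1
  refine ⟨t, ht, ht1, mem_Icc_add_single hx (by linarith) (by linarith),
    mem_Icc_add_single hy (by linarith) (by linarith), u.eval_add_le_eval_add fun i => ?_⟩
  simp only [map_add, u.level_single]
  split_ifs with hi
  · subst hi
    rcases ht2 with h0 | h0
    · simp [h0]
    · have hat : 0 ≤ u.a d * t := mul_nonneg (u.a_nonneg d) ht.le
      have := (u.g_concave (u.group d)).add_le_add_of_between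
        (u.level_nonneg _ hy.1) (u.level_nonneg _ hx.1)
        (c := u.level (u.group d) x + u.a d * -t) (d := u.level (u.group d) y + u.a d * t)
        (by linarith) (by linarith) (by ring)
      linarith
  · simp

/-- Replacing some of a resource by another one of the same group without changing the utility. -/
lemma exists_swap {x y : Fin D → ℝ} (hx : x ∈ Icc (0 : Fin D → ℝ) 1)
    (hy : y ∈ Icc (0 : Fin D → ℝ) 1) {d : Fin D} (hd : y d < x d) (ha : 0 < u.a d)
    (hl : u.level (u.group d) x ≤ u.level (u.group d) y) :
    ∃ e t r, e ≠ d ∧ 0 < t ∧ t ≤ x d - y d ∧ 0 < r ∧ r ≤ y e - x e ∧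
      x + Pi.single d (-t) + Pi.single e r ∈ Icc (0 : Fin D → ℝ) 1 ∧
      y + Pi.single d t + Pi.single e (-r) ∈ Icc (0 : Fin D → ℝ) 1 ∧
      u.eval (x + Pi.single d (-t) + Pi.single e r) = u.eval x ∧
      u.eval (y + Pi.single d t + Pi.single e (-r)) = u.eval y := by
  -- As x has more of d but no higher level, it must have less of some other useful resource of the
  -- group.
  obtain ⟨e, heg, hea, hexy⟩ : ∃ e, u.group e = u.group d ∧ 0 < u.a e ∧ x e < y e := by
    by_contra! hcon
    refine absurd hl (not_le.2 ?_)
    simp only [u.level_apply]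
    refine Finset.sum_lt_sum (fun e he => ?_) ⟨d, by simp, mul_lt_mul_of_pos_left hd ha⟩
    rcases eq_or_lt_of_le (u.a_nonneg e) with h0 | h0
    · simp [← h0]
    · exact mul_le_mul_of_nonneg_left (hcon e (by simpa using he) h0) h0.le
  have hed : e ≠ d := by rintro rfl; linarith
  -- The exchange rate `u.a d * t = u.a e * r` keeps all levels fixed; t is the largest amount that
  -- overshoots neither resource.
  obtain ⟨t, r, ht, ht1, hr, hr1, htr⟩ : ∃ t r, 0 < t ∧ t ≤ x d - y d ∧ 0 < r ∧
      r ≤ y e - x e ∧ u.a d * t = u.a e * r := by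
    refine ⟨min (x d - y d) ((y e - x e) * u.a e / u.a d),
      min (x d - y d) ((y e - x e) * u.a e / u.a d) * u.a d / u.a e, ?_, min_le_left _ _, ?_, ?_, ?_⟩
    · exact lt_min (by linarith) (div_pos (mul_pos (by linarith) hea) ha)
    · exact div_pos (mul_pos (lt_min (by linarith)
        (div_pos (mul_pos (by linarith) hea) ha)) ha) hea
    · rw [div_le_iff₀ hea, ← le_div_iff₀ ha]
      exact min_le_right _ _
    · field_simp
  have hx0 := hx.1 d; have hx1 := hx.2 d; have hy0 := hy.1 d; have hy1 := hy.2 d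
  have hx2 := hx.1 e; have hx3 := hx.2 e; have hy2 := hy.1 e; have hy3 := hy.2 e
  simp only [Pi.zero_apply, Pi.one_apply] at hx0 hx1 hy0 hy1 hx2 hx3 hy2 hy3
  refine ⟨e, t, r, hed, ht, ht1, hr, hr1, ?_, ?_, ?_, ?_⟩
  · refine mem_Icc_add_single (mem_Icc_add_single hx (by linarith) (by linarith)) ?_ ?_ <;>
      simp [Pi.single_eq_of_ne hed] <;> linarith
  · refine mem_Icc_add_single (mem_Icc_add_single hy (by linarith) (by linarith)) ?_ ?_ <;>
      simp [Pi.single_eq_of_ne hed] <;> linarith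
  · simp only [SpeedUpUtility.eval_eq, map_add, u.level_single, heg]
    refine Finset.sum_congr rfl fun i _ => ?_
    congr 1
    split_ifs <;> linarith
  · simp only [SpeedUpUtility.eval_eq, map_add, u.level_single, heg]
    refine Finset.sum_congr rfl fun i _ => ?_
    congr 1
    split_ifs <;> linarith

end SpeedUpUtility

/-! ## Demand sets -/

namespace SpeedUpUtility

variable {D : ℕ} (u : SpeedUpUtility D)

lemma demand_objective_continuousOn (q : Fin D → ℝ) :
    ContinuousOn (fun x => u.eval x - ∑ d, q d * x d) (Icc (0 : Fin D → ℝ) 1) :=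
  (u.eval_continuousOn.mono Icc_subset_Ici_self).sub (by fun_prop)

lemma demand_nonempty (q : Fin D → ℝ) : (demand u.eval q).Nonempty := by
  obtain ⟨x, hx, hmax⟩ := isCompact_Icc.exists_isMaxOn
    (nonempty_Icc.2 (zero_le_one : (0 : Fin D → ℝ) ≤ 1)) (demand_objective_continuousOn u q)
  exact ⟨x, hx, fun y hy => hmax hy⟩

lemma demand_isCompact (q : Fin D → ℝ) : IsCompact (demand u.eval q) := by
  obtain ⟨x, hx, hmax⟩ := demand_nonempty u q
  have h := (demand_objective_continuousOn u q).preimage_isClosed_of_isClosed isClosed_Icc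
    (isClosed_Ici (a := u.eval x - ∑ d, q d * x d))
  convert isCompact_Icc.of_isClosed_subset h inter_subset_left using 1
  ext y
  exact ⟨fun hy => ⟨hy.1, hy.2 x hx⟩, fun hy => ⟨hy.1, fun z hz => (hmax z hz).trans hy.2⟩⟩

lemma mem_demand_of_le {q y z : Fin D → ℝ} (hy : y ∈ demand u.eval q)
    (hz : z ∈ Icc (0 : Fin D → ℝ) 1)
    (h : u.eval y - ∑ d, q d * y d ≤ u.eval z - ∑ d, q d * z d) : z ∈ demand u.eval q :=
  ⟨hz, fun w hw => (hy.2 w hw).trans h⟩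

/-- Among the demanded bundles there is one that minimizes a given continuous function. -/
lemma exists_demand_min (q : Fin D → ℝ) {φ : (Fin D → ℝ) → ℝ} (hφ : Continuous φ) :
    ∃ y ∈ demand u.eval q, ∀ z ∈ demand u.eval q, φ y ≤ φ z := by
  obtain ⟨y, hy, hmin⟩ := (u.demand_isCompact q).exists_isMinOn (u.demand_nonempty q)
    hφ.continuousOn
  exact ⟨y, hy, fun z hz => hmin hz⟩

/-- Progress measure of the exchange arguments: a move towards x in coordinate d lowers the total
shortfall, provided that every other coordinate is unchanged, ends up with no shortfall, or moves
up. -/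
lemma sum_excess_lt {x y z : Fin D → ℝ} {s : Finset (Fin D)} {d : Fin D} (hd : d ∈ s)
    (hlt : y d < z d) (hle : z d ≤ x d) (h : ∀ e, e ≠ d → z e = y e ∨ x e ≤ z e ∨ y e ≤ z e) :
    ∑ e ∈ s, max (x e - z e) 0 < ∑ e ∈ s, max (x e - y e) 0 := by
  refine Finset.sum_lt_sum (fun e _ => ?_) ⟨d, hd, ?_⟩
  · by_cases he : e = d
    · subst he
      exact max_le_max (by linarith) le_rfl
    · rcases h e he with h | h | h
      · rw [h]
      · rw [max_eq_right (by linarith)]; exact le_max_right _ _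
      · exact max_le_max (by linarith) le_rfl
  · rw [max_eq_left (by linarith), max_eq_left (by linarith)]
    linarith

lemma sum_excess_lt' {x y z : Fin D → ℝ} {s : Finset (Fin D)} {d : Fin D} (hd : d ∈ s)
    (hlt : z d < y d) (hle : x d ≤ z d) (h : ∀ e, e ≠ d → z e = y e ∨ z e ≤ x e ∨ z e ≤ y e) :
    ∑ e ∈ s, max (z e - x e) 0 < ∑ e ∈ s, max (y e - x e) 0 := by
  have := sum_excess_lt (x := -x) (y := -y) (z := -z) hd (neg_lt_neg hlt) (neg_le_neg hle)
    fun e he => by simpa using h e he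
  simpa only [Pi.neg_apply, neg_sub_neg] using this

/-- Take a bundle y demanded at q' with the least shortfall against x on the resources of unchanged
price. If d is short, an exchange repairs part of it. Optimality of x at q bounds the opposite move:
a transfer gains y at least its unchanged price, and a swap gives up a resource e whose amount was
worth enough at q and is worth no less at q'. So the new bundle is still demanded, a contradiction.
-/
theorem linearSubstitute : LinearSubstitute u.eval := by
  intro q q' _ hqq x hx
  obtain ⟨y, hy, hmin⟩ := u.exists_demand_min q'
    (φ := fun y => ∑ d with q d = q' d, max (x d - y d) 0) (by fun_prop)
  refine ⟨y, hy, fun d hd => ?_⟩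
  by_contra! hlt
  have hds : d ∈ Finset.univ.filter (fun d => q d = q' d) := by simpa using hd
  by_cases hl : u.a d = 0 ∨ u.level (u.group d) y < u.level (u.group d) x
  · obtain ⟨t, ht, ht1, hx', hy', hu⟩ := u.exists_transfer hx.1 hy.1 hlt hl
    refine absurd (hmin _ (u.mem_demand_of_le hy hy' ?_)) (not_le.2 (sum_excess_lt hds ?_ ?_ ?_))
    · have := hx.2 _ hx'
      simp only [dot_add_single, hd] at this ⊢
      linarith
    · simpa using ht
    · simp; linarith
    · intro e he; left; simp [Pi.single_eq_of_ne he]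
  · push Not at hl
    obtain ⟨e, t, r, hed, ht, ht1, hr, hr1, hx', hy', hux, huy⟩ :=
      u.exists_swap hx.1 hy.1 hlt (lt_of_le_of_ne (u.a_nonneg d) hl.1.symm) hl.2
    refine absurd (hmin _ (u.mem_demand_of_le hy hy' ?_)) (not_le.2 (sum_excess_lt hds ?_ ?_ ?_))
    · have := hx.2 _ hx'
      have he := mul_le_mul_of_nonneg_right (hqq e) hr.le
      simp only [dot_add_single, hux, huy, hd] at this ⊢
      linarith
    · simpa [Pi.single_eq_of_ne hed.symm] using ht
    · simp [Pi.single_eq_of_ne hed.symm]; linarith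
    · intro e' he'
      by_cases hee : e' = e
      · subst hee; right; left; simp [Pi.single_eq_of_ne he']; linarith
      · left; simp [Pi.single_eq_of_ne he', Pi.single_eq_of_ne hee]

/-- Mirror image of `linearSubstitute`: minimize the excess over y among the bundles demanded at the
scaled prices. Optimality of y at q bounds the gain from receiving d by its price, which has only
grown; in a swap the utilities do not change, and scaling preserves which side is cheaper. -/
theorem scalingShrinksDemand : ScalingShrinksDemand u.eval := by
  intro q hq l hl y hy
  obtain ⟨x, hx, hmin⟩ := u.exists_demand_min (l • q)
    (φ := fun x => ∑ d, max (x d - y d) 0) (by fun_prop)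
  refine ⟨x, hx, fun d => ?_⟩
  by_contra! hlt
  by_cases hl' : u.a d = 0 ∨ u.level (u.group d) y < u.level (u.group d) x
  · obtain ⟨t, ht, ht1, hx', hy', hu⟩ := u.exists_transfer hx.1 hy.1 hlt hl'
    refine absurd (hmin _ (u.mem_demand_of_le hx hx' ?_)) (not_le.2
      (sum_excess_lt' (Finset.mem_univ d) ?_ ?_ ?_))
    · have := hy.2 _ hy'
      have h2 := mul_nonneg (mul_nonneg (sub_nonneg.2 hl) (hq d)) ht.le
      simp only [dot_add_single, Pi.smul_apply, smul_eq_mul] at this ⊢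
      linarith
    · simpa using ht
    · simp; linarith
    · intro e he; left; simp [Pi.single_eq_of_ne he]
  · push Not at hl'
    obtain ⟨e, t, r, hed, ht, ht1, hr, hr1, hx', hy', hux, huy⟩ :=
      u.exists_swap hx.1 hy.1 hlt (lt_of_le_of_ne (u.a_nonneg d) hl'.1.symm) hl'.2
    refine absurd (hmin _ (u.mem_demand_of_le hx hx' ?_)) (not_le.2
      (sum_excess_lt' (Finset.mem_univ d) ?_ ?_ ?_))
    · have := hy.2 _ hy'
      simp only [dot_add_single, hux, huy, Pi.smul_apply, smul_eq_mul] at this ⊢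
      have h2 : 0 ≤ q d * t - q e * r := by linarith
      nlinarith [mul_nonneg (zero_le_one.trans hl) h2]
    · simpa [Pi.single_eq_of_ne hed.symm] using ht
    · simp [Pi.single_eq_of_ne hed.symm]; linarith
    · intro e' he'
      by_cases hee : e' = e
      · subst hee; right; left; simp [Pi.single_eq_of_ne he']; linarith
      · left; simp [Pi.single_eq_of_ne he', Pi.single_eq_of_ne hee]

/-- The minimizer of the total level among the bundles demanded at q' has no group level above that
of y: otherwise some useful resource d of that group could be transferred to y. Since the level of
the whole group is higher, no swap is needed. -/
theorem raisingLowersUtility : RaisingLowersUtility u.eval := by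
  intro q q' _ hqq y hy
  obtain ⟨x, hx, hmin⟩ := u.exists_demand_min q' (φ := fun x => ∑ d, u.a d * x d) (by fun_prop)
  refine ⟨x, hx, Finset.sum_le_sum fun i _ => u.g_mono i (u.level_nonneg i hx.1.1)
    (u.level_nonneg i hy.1.1) (not_lt.1 fun hlt => ?_)⟩
  change u.level i y < u.level i x at hlt
  have hlt0 := hlt
  simp only [level_apply] at hlt
  obtain ⟨d, hd, hlt'⟩ := Finset.exists_lt_of_sum_lt hlt
  have hdi : u.group d = i := by simpa using hd
  subst hdi
  have hyx : y d < x d := lt_of_mul_lt_mul_left hlt' (u.a_nonneg d)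
  have had : 0 < u.a d := by
    rcases eq_or_lt_of_le (u.a_nonneg d) with h | h
    · simp [← h] at hlt'
    · exact h
  obtain ⟨t, ht, ht1, hx', hy', hu⟩ := u.exists_transfer hx.1 hy.1 hyx (Or.inr hlt0)
  refine absurd (hmin _ (u.mem_demand_of_le hx hx' ?_)) (not_le.2 ?_)
  · have := hy.2 _ hy'
    have he := mul_le_mul_of_nonneg_right (hqq d) ht.le
    simp only [dot_add_single] at this ⊢
    linarith
  · simp only [dot_add_single]
    linarith [mul_pos had ht]

/-- The indirect utility is submodular in the weight of the utility and the prices (ordered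
weights). -/
lemma exists_submodular_exchange_of_le {b c : ℝ} (hb : 0 ≤ b) (hbc : b ≤ c) (q p : Fin D → ℝ)
    {x y : Fin D → ℝ} (hx : x ∈ Icc (0 : Fin D → ℝ) 1) (hy : y ∈ Icc (0 : Fin D → ℝ) 1) :
    ∃ x' ∈ Icc (0 : Fin D → ℝ) 1, ∃ y' ∈ Icc (0 : Fin D → ℝ) 1,
      c * u.eval x + b * u.eval y - ∑ d, max (q d) (p d) * x d - ∑ d, min (q d) (p d) * y d ≤
        b * u.eval x' + c * u.eval y' - ∑ d, q d * x' d - ∑ d, p d * y' d := by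
  classical
  -- The new bundles are `x + m` (weight c, prices p) and `y - m` (weight b, prices q). Where p is
  -- below q and y has more, the two amounts trade places, which raises the level of `x + m` by
  -- `gain`. Where x has more, a fraction θ of the difference, chosen per group, is handed over to
  -- offset this; `slack` is what can be offset.
  let gain : Fin u.k → ℝ := fun i => u.level i fun d => if p d < q d ∧ x d < y d then y d - x d else 0
  let slack : Fin u.k → ℝ := fun i => u.level i fun d => if y d < x d then x d - y d else 0
  have hgain : ∀ i, 0 ≤ gain i := fun i => u.level_nonneg i fun d => by
    dsimp only; split_ifs with h <;> simp; linarith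
  have hslack : ∀ i, 0 ≤ slack i := fun i => u.level_nonneg i fun d => by
    dsimp only; split_ifs with h <;> simp; linarith
  let θ : Fin u.k → ℝ := fun i => min 1 (gain i / slack i)
  have hθ0 : ∀ i, 0 ≤ θ i := fun i => le_min zero_le_one (div_nonneg (hgain i) (hslack i))
  have hθ1 : ∀ i, θ i ≤ 1 := fun i => min_le_left _ _
  let m : Fin D → ℝ := fun d => if p d < q d ∧ x d < y d then y d - x d
    else if y d < x d then -(θ (u.group d) * (x d - y d)) else 0
  have hm : ∀ d, min (x d) (y d) ≤ x d + m d ∧ x d + m d ≤ max (x d) (y d) := by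
    intro d
    have h0 := hθ0 (u.group d); have h1 := hθ1 (u.group d)
    simp only [m]
    split_ifs with h h'
    · simp
    · rw [min_eq_right h'.le, max_eq_left h'.le]
      constructor <;> nlinarith
    · simp
  have hlev : ∀ i, u.level i m = gain i - θ i * slack i := by
    intro i
    simp only [gain, slack, level_apply, Finset.mul_sum, ← Finset.sum_sub_distrib]
    refine Finset.sum_congr rfl fun d hd => ?_
    have hdi : u.group d = i := by simpa using hd
    simp only [m, hdi]
    split_ifs with h h' <;> first | (exfalso; linarith [h.2]) | ring
  refine ⟨y - m, ⟨fun d => ?_, fun d => ?_⟩, x + m, ⟨fun d => ?_, fun d => ?_⟩, ?_⟩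
  · have := (hm d).2; have := hx.1 d; have := hy.1 d
    simp only [Pi.zero_apply, Pi.sub_apply] at *
    rcases max_cases (x d) (y d) with ⟨h, _⟩ | ⟨h, _⟩ <;> linarith
  · have := (hm d).1; have := hx.2 d; have := hy.2 d
    simp only [Pi.one_apply, Pi.sub_apply] at *
    rcases min_cases (x d) (y d) with ⟨h, _⟩ | ⟨h, _⟩ <;> linarith
  · exact (le_min (hx.1 d) (hy.1 d)).trans (hm d).1
  · exact (hm d).2.trans (max_le (hx.2 d) (hy.2 d))
  · have hprice : ∑ d, q d * (y - m) d + ∑ d, p d * (x + m) d ≤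
        ∑ d, max (q d) (p d) * x d + ∑ d, min (q d) (p d) * y d := by
      rw [← Finset.sum_add_distrib, ← Finset.sum_add_distrib]
      refine Finset.sum_le_sum fun d _ => ?_
      have h0 := hθ0 (u.group d); have h1 := hθ1 (u.group d)
      simp only [Pi.sub_apply, Pi.add_apply]
      rcases lt_or_ge (p d) (q d) with h | h
      · rw [max_eq_left h.le, min_eq_right h.le]
        have : y d ≤ x d + m d := by
          simp only [m]
          split_ifs with h2 h3
          · linarith
          · nlinarith
          · push Not at h2; linarith [h2 h]
        nlinarith
      · rw [max_eq_right h, min_eq_left h]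
        have : m d ≤ 0 := by
          simp only [m]
          split_ifs with h2 h3
          · linarith [h2.1]
          · nlinarith
          · exact le_rfl
        nlinarith
    -- In each group the net change of level is 0 if `slack` suffices. Otherwise it is positive and
    -- keeps the level of `x + m` below that of y; then b times the concavity inequality plus c - b
    -- times monotonicity gives the bound.
    have hutil : c * u.eval x + b * u.eval y ≤ b * u.eval (y - m) + c * u.eval (x + m) := by
      simp only [eval_eq, Finset.mul_sum, ← Finset.sum_add_distrib]
      refine Finset.sum_le_sum fun i _ => ?_
      simp only [map_add, map_sub, hlev]
      have hxl := u.level_nonneg i hx.1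
      have hyl := u.level_nonneg i hy.1
      by_cases hgs : gain i ≤ slack i
      · have hz : gain i - θ i * slack i = 0 := by
          simp only [θ]
          rcases eq_or_lt_of_le (hslack i) with h | h
          · have : gain i = 0 := le_antisymm (by linarith) (hgain i)
            simp [this, ← h]
          · rw [min_eq_right ((div_le_one h).2 hgs)]
            field_simp; simp
        rw [hz]
        simp only [sub_zero, add_zero]
        linarith
      · push Not at hgs
        have hz : θ i * slack i = slack i := by
          simp only [θ]
          rcases eq_or_lt_of_le (hslack i) with h | h
          · simp [← h]
          · rw [min_eq_left ((one_le_div h).2 hgs.le), one_mul]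
        rw [hz]
        have hle : u.level i x + gain i - slack i ≤ u.level i y := by
          have : gain i - slack i ≤ u.level i (y - x) := by
            simp only [gain, slack, ← map_sub]
            refine u.level_mono i fun d => ?_
            simp only [Pi.sub_apply]
            split_ifs with h2 h3 h3
            · linarith [h2.2]
            · linarith
            · linarith
            · linarith
          rw [map_sub] at this
          linarith
        have h1 := (u.g_concave i).add_le_add_of_between hxl hyl
          (c := u.level i x + (gain i - slack i)) (d := u.level i y - (gain i - slack i))
          (by linarith) (by linarith) (by ring)
        have h2 := u.g_mono i hxl (show u.level i x + (gain i - slack i) ∈ Ici 0 from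
          by simp only [mem_Ici]; linarith) (by linarith)
        nlinarith [mul_le_mul_of_nonneg_left h1 hb,
          mul_le_mul_of_nonneg_left h2 (sub_nonneg.2 hbc)]
    linarith

lemma exists_submodular_exchange {b c : ℝ} (hb : 0 ≤ b) (hc : 0 ≤ c) (q p : Fin D → ℝ)
    {x y : Fin D → ℝ} (hx : x ∈ Icc (0 : Fin D → ℝ) 1) (hy : y ∈ Icc (0 : Fin D → ℝ) 1) :
    ∃ x' ∈ Icc (0 : Fin D → ℝ) 1, ∃ y' ∈ Icc (0 : Fin D → ℝ) 1,
      max b c * u.eval x + min b c * u.eval y - ∑ d, max (q d) (p d) * x d -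
          ∑ d, min (q d) (p d) * y d ≤
        b * u.eval x' + c * u.eval y' - ∑ d, q d * x' d - ∑ d, p d * y' d := by
  rcases le_total b c with h | h
  · rw [max_eq_right h, min_eq_left h]
    exact u.exists_submodular_exchange_of_le hb h q p hx hy
  · rw [max_eq_left h, min_eq_right h]
    obtain ⟨x', hx', y', hy', H⟩ := u.exists_submodular_exchange_of_le hc h p q hx hy
    refine ⟨y', hy', x', hx', ?_⟩
    simp only [max_comm (p _), min_comm (p _)] at H
    linarith

end SpeedUpUtility

/-! ## The greedy procedure -/

section FirstMax

variable {ψ : ℝ → ℝ}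

/-- The first point of `[0,1]` after which a function does not exceed its current value. -/
noncomputable def firstMax (ψ : ℝ → ℝ) : ℝ :=
  sInf {t | t ∈ Icc (0 : ℝ) 1 ∧ (t = 1 ∨ ∀ e > 0, ψ (t + e) ≤ ψ t)}

lemma firstMax_bddBelow (ψ : ℝ → ℝ) :
    BddBelow {t | t ∈ Icc (0 : ℝ) 1 ∧ (t = 1 ∨ ∀ e > 0, ψ (t + e) ≤ ψ t)} :=
  ⟨0, fun _ ht => ht.1.1⟩

lemma firstMax_nonempty (ψ : ℝ → ℝ) :
    {t | t ∈ Icc (0 : ℝ) 1 ∧ (t = 1 ∨ ∀ e > 0, ψ (t + e) ≤ ψ t)}.Nonempty :=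
  ⟨1, ⟨zero_le_one, le_rfl⟩, Or.inl rfl⟩

lemma firstMax_nonneg (ψ : ℝ → ℝ) : 0 ≤ firstMax ψ :=
  le_csInf (firstMax_nonempty ψ) fun _ ht => ht.1.1

lemma firstMax_le_one (ψ : ℝ → ℝ) : firstMax ψ ≤ 1 :=
  csInf_le (firstMax_bddBelow ψ) ⟨⟨zero_le_one, le_rfl⟩, Or.inl rfl⟩

/-- The infimum need not visibly belong to its set, but it is a limit of points that dominate
everything to their right, and continuity passes this on. -/
lemma le_firstMax_of_ge (hc : ContinuousOn ψ (Ici 0)) (h1 : firstMax ψ < 1) {τ : ℝ}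
    (hτ : firstMax ψ ≤ τ) : ψ τ ≤ ψ (firstMax ψ) := by
  rcases eq_or_lt_of_le hτ with h | hτ
  · rw [h]
  obtain ⟨v, -, hv, hvS⟩ := exists_seq_tendsto_sInf (firstMax_nonempty ψ) (firstMax_bddBelow ψ)
  have hlim : Filter.Tendsto (fun n => ψ (v n)) Filter.atTop (nhds (ψ (firstMax ψ))) :=
    (hc _ (firstMax_nonneg ψ)).tendsto.comp (tendsto_nhdsWithin_iff.2
      ⟨hv, Filter.Eventually.of_forall fun n => (hvS n).1.1⟩)
  refine ge_of_tendsto hlim ?_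
  filter_upwards [hv.eventually_lt_const h1, hv.eventually_lt_const hτ] with n hn1 hn2
  have := (hvS n).2.resolve_left hn1.ne (τ - v n) (by linarith)
  simpa using this

/-- If the maximum over `[τ, firstMax ψ]` were strictly above the right endpoint, then by concavity
its maximizer would dominate everything to its right, and so would belong to the set whose infimum
is `firstMax ψ`. -/
lemma le_firstMax_of_le (hψ : ConcaveOn ℝ (Ici 0) ψ) (hc : ContinuousOn ψ (Ici 0)) {τ : ℝ}
    (h0 : 0 ≤ τ) (hτ : τ ≤ firstMax ψ) : ψ τ ≤ ψ (firstMax ψ) := by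
  obtain ⟨m, hm, hmax⟩ := isCompact_Icc.exists_isMaxOn (nonempty_Icc.2 hτ)
    (hc.mono fun t ht => h0.trans ht.1)
  by_contra! hlt
  have hlt' : ψ (firstMax ψ) < ψ m := hlt.trans_le (hmax ⟨le_rfl, hτ⟩)
  have hmlt : m < firstMax ψ := lt_of_le_of_ne hm.2 (by rintro rfl; exact lt_irrefl _ hlt')
  refine absurd (csInf_le (firstMax_bddBelow ψ) ⟨⟨h0.trans hm.1, hm.2.trans (firstMax_le_one ψ)⟩,
    Or.inr fun e he => ?_⟩) (not_le.2 hmlt)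
  rcases le_total (m + e) (firstMax ψ) with h | h
  · exact hmax ⟨hm.1.trans (by linarith), h⟩
  · by_contra! hcon
    have := hψ.min_le_of_mem_Icc (x := m) (y := m + e) (h0.trans hm.1)
      (show (0 : ℝ) ≤ m + e by linarith [h0.trans hm.1]) ⟨hmlt.le, h⟩
    rw [min_eq_left hcon.le] at this
    linarith

end FirstMax

section Greedy

variable {D : ℕ}

lemma greedyAmount_eq (g : ℝ → ℝ) (a q z : ℝ) :
    greedyAmount g a q z = firstMax fun t => g (z + t * a) - t * q := by
  unfold greedyAmount firstMax
  congr 1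
  ext t
  refine and_congr_right fun _ => or_congr_right (forall₂_congr fun e _ => ?_)
  constructor <;> intro h <;> linarith

/-- Cross-multiplication loses the convention `0 / 0 = 0`: for `ad = qd = 0` the inequality says
nothing, so the first component is recorded separately. -/
lemma ratio_le {ad qd ae qe : ℝ} (had : 0 ≤ ad) (hqd : 0 ≤ qd) (hae : 0 ≤ ae) (hqe : 0 ≤ qe)
    (h : ENNReal.ofReal ae / ENNReal.ofReal qe ≤ ENNReal.ofReal ad / ENNReal.ofReal qd) :
    (ad = 0 → ae = 0) ∧ ae * qd ≤ ad * qe := by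
  have key : ad = 0 → ae = 0 := by
    rintro rfl
    simp only [ENNReal.ofReal_zero, ENNReal.zero_div, nonpos_iff_eq_zero, ENNReal.div_eq_zero_iff,
      ENNReal.ofReal_eq_zero, ENNReal.ofReal_ne_top, or_false] at h
    exact le_antisymm h hae
  refine ⟨key, ?_⟩
  rcases eq_or_lt_of_le hqd with h0 | hqd
  · rw [← h0, mul_zero]; positivity
  rcases eq_or_lt_of_le hqe with h0 | hqe
  · rcases eq_or_lt_of_le hae with h1 | hae
    · rw [← h1, ← h0]; simp
    · exfalso
      rw [← h0, ENNReal.ofReal_zero, ENNReal.div_zero (by simpa using hae), top_le_iff] at h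
      exact ENNReal.div_ne_top ENNReal.ofReal_ne_top (by simpa using hqd) h
  · rw [← ENNReal.ofReal_div_of_pos hqe, ← ENNReal.ofReal_div_of_pos hqd,
      ENNReal.ofReal_le_ofReal_iff (by positivity), div_le_div_iff₀ hqe hqd] at h
    exact h

variable {g : ℝ → ℝ} {a q : Fin D → ℝ}

lemma greedyFill_mem : ∀ (L : List (Fin D)) (z : ℝ) (d : Fin D),
    greedyFill g a q L z d ∈ Icc (0 : ℝ) 1
  | [], z, d => ⟨le_rfl, zero_le_one⟩
  | e :: L, z, d => by
    rw [greedyFill]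
    by_cases he : d = e
    · subst he
      split_ifs with h
      · rw [Pi.single_eq_same, greedyAmount_eq]
        exact ⟨firstMax_nonneg _, firstMax_le_one _⟩
      · simp
    · split_ifs
      · simp [Pi.single_eq_of_ne he]
      · rw [Function.update_of_ne he]; exact greedyFill_mem L _ d

/-- Induction on the list for an arbitrary starting level. As d has the best ratio, the level that a
competitor y draws from later resources could be bought through d at no greater price, so y is worth
at most ψ at an equivalent amount τ of d. If greedy stops at d, then it has maximized ψ over all
nonnegative amounts; if it exhausts d, then y can be made to use all of d and the rest is the
induction hypothesis. -/
lemma greedyFill_optimal (hg : ConcaveOn ℝ (Ici 0) g) (hgc : ContinuousOn g (Ici 0))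
    (ha : ∀ d, 0 ≤ a d) (hq : ∀ d, 0 ≤ q d) :
    ∀ (L : List (Fin D)), L.Nodup →
      L.Pairwise (fun d e => (a d = 0 → a e = 0) ∧ a e * q d ≤ a d * q e) →
      ∀ z, 0 ≤ z → ∀ y : Fin D → ℝ, (∀ d, y d ∈ Icc (0 : ℝ) 1) →
      g (z + (L.map fun d => a d * y d).sum) - (L.map fun d => q d * y d).sum ≤
        g (z + (L.map fun d => a d * greedyFill g a q L z d).sum) -
          (L.map fun d => q d * greedyFill g a q L z d).sum
  | [], _, _, z, _, y, _ => by simp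
  | d :: L, hL, hP, z, hz, y, hy => by
    rw [List.nodup_cons] at hL
    rw [List.pairwise_cons] at hP
    have IH := greedyFill_optimal hg hgc ha hq L hL.2 hP.2
    set S := (L.map fun e => a e * y e).sum with hS
    set Q := (L.map fun e => q e * y e).sum with hQ
    have hS0 : 0 ≤ S := List.sum_nonneg (by
      simp only [List.mem_map]; rintro _ ⟨e, _, rfl⟩; exact mul_nonneg (ha e) (hy e).1)
    have hQ0 : 0 ≤ Q := List.sum_nonneg (by
      simp only [List.mem_map]; rintro _ ⟨e, _, rfl⟩; exact mul_nonneg (hq e) (hy e).1)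
    have hSQ : q d * S ≤ a d * Q := by
      rw [hS, hQ, ← List.sum_map_mul_left, ← List.sum_map_mul_left]
      refine List.sum_le_sum fun e he => ?_
      nlinarith [mul_le_mul_of_nonneg_right (hP.1 e he).2 (hy e).1]
    have hS1 : a d = 0 → S = 0 := by
      intro h
      refine List.sum_eq_zero ?_
      simp only [List.mem_map]
      rintro _ ⟨e, he, rfl⟩
      rw [(hP.1 e he).1 h, zero_mul]
    set ψ : ℝ → ℝ := fun t => g (z + t * a d) - t * q d with hψ
    have hlevel : ∀ t, 0 ≤ t → 0 ≤ z + t * a d := fun t ht =>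
      add_nonneg hz (mul_nonneg ht (ha d))
    have hψc : ContinuousOn ψ (Ici 0) :=
      (hgc.comp (by fun_prop) fun t ht => hlevel t ht).sub (by fun_prop)
    have hψv : ConcaveOn ℝ (Ici 0) ψ := by
      refine ⟨convex_Ici 0, fun s hs t ht b c hb hc hbc => ?_⟩
      have := hg.2 (hlevel s hs) (hlevel t ht) hb hc hbc
      simp only [smul_eq_mul] at this ⊢
      have e : b * (z + s * a d) + c * (z + t * a d) = z + (b * s + c * t) * a d := by
        linear_combination z * hbc
      rw [e] at this
      simp only [hψ]
      linarith
    have hamt : greedyAmount g (a d) (q d) z = firstMax ψ := greedyAmount_eq _ _ _ _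
    -- For `a d = 0` the quotient is 0 by convention, which is right because then S = 0. The amount
    -- τ may exceed 1.
    set τ := y d + S / a d with hτ
    have hτ0 : 0 ≤ τ := add_nonneg (hy d).1 (div_nonneg hS0 (ha d))
    have hτa : τ * a d = a d * y d + S := by
      rcases eq_or_lt_of_le (ha d) with h | h
      · rw [hS1 h.symm, ← h]; simp
      · rw [hτ]; field_simp
    have hτq : τ * q d ≤ q d * y d + Q := by
      rcases eq_or_lt_of_le (ha d) with h | h
      · rw [hτ, ← h]; simp; linarith
      · have : S / a d * q d ≤ Q := by
          rw [div_mul_eq_mul_div, div_le_iff₀ h]; linarith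
        rw [hτ]; linarith
    have hval : g (z + ((d :: L).map fun e => a e * y e).sum) -
        ((d :: L).map fun e => q e * y e).sum ≤ ψ τ := by
      simp only [List.map_cons, List.sum_cons, ← hS, ← hQ, hψ]
      rw [← hτa]
      linarith
    rw [greedyFill]
    split_ifs with ht
    · have hne : ∀ e ∈ L, e ≠ d := fun e he h => hL.1 (h ▸ he)
      have hz1 : ∀ b : Fin D → ℝ, (L.map fun e => b e *
          (Pi.single d (greedyAmount g (a d) (q d) z) : Fin D → ℝ) e).sum = 0 := fun b => by
        refine List.sum_eq_zero ?_
        simp only [List.mem_map]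
        rintro _ ⟨e, he, rfl⟩
        rw [Pi.single_eq_of_ne (hne e he), mul_zero]
      have hmax : ψ τ ≤ ψ (firstMax ψ) := by
        rcases le_total τ (firstMax ψ) with h | h
        · exact le_firstMax_of_le hψv hψc hτ0 h
        · exact le_firstMax_of_ge hψc (hamt ▸ ht) h
      refine hval.trans (hmax.trans (le_of_eq ?_))
      simp only [List.map_cons, List.sum_cons, hz1, Pi.single_eq_same, add_zero]
      rw [hamt, mul_comm (a d), mul_comm (q d)]
    · have ht1 : firstMax ψ = 1 := le_antisymm (firstMax_le_one ψ) (by rw [← hamt]; linarith)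
      have hcongr : ∀ b : Fin D → ℝ, (L.map fun e => b e *
          Function.update (greedyFill g a q L (z + a d)) d 1 e) =
          L.map fun e => b e * greedyFill g a q L (z + a d) e := fun b =>
        List.map_congr_left fun e he => by
          rw [Function.update_of_ne (show e ≠ d by rintro rfl; exact hL.1 he)]
      have hza : 0 ≤ z + a d := add_nonneg hz (ha d)
      simp only [List.map_cons, List.sum_cons, Function.update_self, mul_one, hcongr, ← add_assoc]
      simp only [List.map_cons, List.sum_cons, ← add_assoc, ← hS, ← hQ] at hval
      -- If τ ≤ 1, then filling d completely is at least as good as y, and the induction hypothesis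
      -- is applied against taking nothing else.
      rcases le_or_gt τ 1 with h | h
      · have h1 := le_firstMax_of_le hψv hψc hτ0 (ht1 ▸ h)
        rw [ht1] at h1
        have h2 := IH (z + a d) hza 0 fun e => ⟨le_rfl, zero_le_one⟩
        simp only [Pi.zero_apply, mul_zero, List.map_const', List.sum_replicate, smul_zero,
          add_zero] at h2
        simp only [hψ, one_mul] at h1
        simp only [hψ] at hval
        linarith
      · have hyd := (hy d).2
        have had : 0 < a d := by
          rcases eq_or_lt_of_le (ha d) with h0 | h0
          · exfalso; rw [hτ, ← h0, div_zero] at h; linarith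
          · exact h0
        have hS2 : (1 - y d) * a d < S := by
          rw [← lt_div_iff₀ had]; rw [hτ] at h; linarith
        have hSpos : 0 < S := lt_of_le_of_lt (mul_nonneg (by linarith) had.le) hS2
        -- Fraction of the later resources that y gives up for the missing part of d: the total
        -- level is the same and the price is no higher.
        set θ := (1 - y d) * a d / S with hθ
        have hθ0 : 0 ≤ θ := div_nonneg (mul_nonneg (by linarith) had.le) hSpos.le
        have hθ1 : θ ≤ 1 := (div_le_one hSpos).2 hS2.le
        have hθS : θ * S = (1 - y d) * a d := by rw [hθ]; field_simp
        have hθQ : q d * (1 - y d) ≤ θ * Q := by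
          rw [hθ, div_mul_eq_mul_div, le_div_iff₀ hSpos]
          nlinarith [mul_le_mul_of_nonneg_left hSQ (sub_nonneg.2 hyd)]
        have h2 := IH (z + a d) hza (fun e => (1 - θ) * y e) fun e =>
          ⟨mul_nonneg (by linarith) (hy e).1, by nlinarith [(hy e).1, (hy e).2]⟩
        simp only [mul_left_comm _ (1 - θ), List.sum_map_mul_left, ← hS, ← hQ] at h2
        have e1 : z + a d + (1 - θ) * S = z + a d * y d + S := by
          linear_combination -hθS
        rw [e1] at h2
        linarith

end Greedy

namespace SpeedUpUtility

variable {D : ℕ} (u : SpeedUpUtility D)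

lemma sum_map_filter_group {L : List (Fin D)} (hL : L.Nodup) (hmem : ∀ d, d ∈ L) (i : Fin u.k)
    (f : Fin D → ℝ) :
    ((L.filter fun e => u.group e = i).map f).sum = ∑ d with u.group d = i, f d := by
  rw [← List.sum_toFinset f (hL.filter _)]
  refine Finset.sum_congr ?_ fun _ _ => rfl
  ext d; simp [hmem]

/-- The objective is a sum over the groups, and the restriction of the order to a group is still
sorted, so each group is maximized on its own. -/
theorem greedy_mem_demand {q : Fin D → ℝ} (hq : 0 ≤ q) {L : List (Fin D)}
    (hL : IsGreedyOrder u.a q L) : u.greedy q L ∈ demand u.eval q := by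
  obtain ⟨hnd, hmem, hP⟩ := hL
  refine ⟨⟨fun d => (greedyFill_mem _ _ d).1, fun d => (greedyFill_mem _ _ d).2⟩, fun y hy => ?_⟩
  have hsplit : ∀ x : Fin D → ℝ, u.eval x - ∑ d, q d * x d =
      ∑ i, (u.g i (u.level i x) - ∑ d with u.group d = i, q d * x d) := fun x => by
    rw [Finset.sum_sub_distrib, Finset.sum_fiberwise]; rfl
  rw [hsplit, hsplit]
  refine Finset.sum_le_sum fun i _ => ?_
  have h := greedyFill_optimal (u.g_concave i) (u.g_cont i) u.a_nonneg hq
    (L.filter fun e => u.group e = i) (hnd.filter _) ((hP.imp fun {d e} h => ratio_le (u.a_nonneg d)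
      (hq d) (u.a_nonneg e) (hq e) h).filter _) 0 le_rfl y fun d => ⟨hy.1 d, hy.2 d⟩
  simp only [u.sum_map_filter_group hnd hmem, zero_add] at h
  refine h.trans (le_of_eq ?_)
  have hx : ∀ b : Fin D → ℝ, ∑ d with u.group d = i, b d *
      greedyFill (u.g i) u.a q (L.filter fun e => u.group e = i) 0 d =
      ∑ d with u.group d = i, b d * u.greedy q L d := fun b =>
    Finset.sum_congr rfl fun d hd => by
      have hdi : u.group d = i := by simpa using hd
      subst hdi; rfl
  rw [hx, hx]
  rfl

end SpeedUpUtility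

/-! ## The region of feasible rate vectors -/

/-- The properties of the set of feasible rate vectors on which the analysis of gradient descent
rests; the last one says that its support function is submodular on the positive orthant. -/
structure IsRateRegion {ι : Type*} [Fintype ι] (P : Set (ι → ℝ)) : Prop where
  convex : Convex ℝ P
  isCompact : IsCompact P
  nonneg : ∀ z ∈ P, 0 ≤ z
  lower : ∀ z ∈ P, ∀ y, 0 ≤ y → y ≤ z → y ∈ P
  exists_pos : ∃ z ∈ P, ∀ j, 0 < z j
  submodular : ∀ b c : ι → ℝ, 0 ≤ b → 0 ≤ c → ∀ z ∈ P, ∀ z' ∈ P, ∃ y ∈ P, ∃ y' ∈ P,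
    ∑ j, max (b j) (c j) * z j + ∑ j, min (b j) (c j) * z' j ≤ ∑ j, b j * y j + ∑ j, c j * y' j

section RateSet

variable {ι : Type*} [Fintype ι] {D : ℕ}

/-- The rate vectors that the resources allow for jobs with given utilities. -/
def rateSet (U : ι → SpeedUpUtility D) : Set (ι → ℝ) :=
  {z | ∃ x : ι → Fin D → ℝ, (∀ j d, 0 ≤ x j d) ∧ (∀ d, ∑ j, x j d ≤ 1) ∧
    ∀ j, 0 ≤ z j ∧ z j ≤ (U j).eval (x j)}

variable (U : ι → SpeedUpUtility D)

lemma allocation_le_one {x : ι → Fin D → ℝ} (h0 : ∀ j d, 0 ≤ x j d) (h1 : ∀ d, ∑ j, x j d ≤ 1) :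
    x ∈ Icc (0 : ι → Fin D → ℝ) 1 :=
  ⟨h0, fun j d => (Finset.single_le_sum (f := fun j => x j d) (fun j _ => h0 j d)
    (Finset.mem_univ j)).trans (h1 d)⟩

lemma rateSet_convex : Convex ℝ (rateSet U) := by
  rintro z ⟨x, hx0, hx1, hxz⟩ z' ⟨x', hx0', hx1', hxz'⟩ s t hs ht hst
  refine ⟨s • x + t • x', fun j d => ?_, fun d => ?_, fun j => ⟨?_, ?_⟩⟩
  · exact add_nonneg (mul_nonneg hs (hx0 j d)) (mul_nonneg ht (hx0' j d))
  · have : ∑ j, (s • x + t • x') j d = s * ∑ j, x j d + t * ∑ j, x' j d := by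
      simp [Finset.sum_add_distrib, Finset.mul_sum]
    rw [this]
    nlinarith [mul_le_mul_of_nonneg_left (hx1 d) hs, mul_le_mul_of_nonneg_left (hx1' d) ht]
  · exact add_nonneg (mul_nonneg hs (hxz j).1) (mul_nonneg ht (hxz' j).1)
  · have h := (U j).eval_concaveOn.2 (hx0 j) (hx0' j) hs ht hst
    refine le_trans ?_ h
    exact add_le_add (mul_le_mul_of_nonneg_left (hxz j).2 hs)
      (mul_le_mul_of_nonneg_left (hxz' j).2 ht)

/-- The region is the projection of a compact set of pairs of allocation and rates; `(U j).eval 1`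
bounds the rates by monotonicity. -/
lemma rateSet_isCompact : IsCompact (rateSet U) := by
  let B : Set ((ι → Fin D → ℝ) × (ι → ℝ)) := Icc 0 1 ×ˢ Icc 0 fun j => (U j).eval 1
  have hB : IsCompact B := isCompact_Icc.prod isCompact_Icc
  have hcont : ContinuousOn (fun p : (ι → Fin D → ℝ) × (ι → ℝ) =>
      fun j => (U j).eval (p.1 j) - p.2 j) B := by
    refine continuousOn_pi.2 fun j => ContinuousOn.sub ?_ (by fun_prop)
    exact (U j).eval_continuousOn.comp (by fun_prop) fun p hp => hp.1.1 j
  have hcl := hcont.preimage_isClosed_of_isClosed hB.isClosed (isClosed_Ici (a := 0))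
  have hcl2 : IsClosed {p : (ι → Fin D → ℝ) × (ι → ℝ) | ∀ d, ∑ j, p.1 j d ≤ 1} := by
    simp only [ofPred_forall]
    exact isClosed_iInter fun d => isClosed_le (by fun_prop) (by fun_prop)
  have hK := (hB.of_isClosed_subset hcl inter_subset_left).inter_right hcl2
  convert hK.image continuous_snd using 1
  ext z
  constructor
  · rintro ⟨x, hx0, hx1, hxz⟩
    have hx := allocation_le_one hx0 hx1
    exact ⟨(x, z), ⟨⟨⟨hx, fun j => (hxz j).1, fun j => (hxz j).2.trans
      ((U j).eval_mono (hx0 j) (hx.2 j))⟩, fun j => sub_nonneg.2 (hxz j).2⟩, hx1⟩, rfl⟩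
  · rintro ⟨⟨x, z⟩, ⟨⟨hb, hz⟩, hx1⟩, rfl⟩
    exact ⟨x, hb.1.1, hx1, fun j => ⟨hb.2.1 j, sub_nonneg.1 (hz j)⟩⟩

/-- Share every resource equally among the jobs; concavity leaves each job at least that share of
its full rate. -/
lemma exists_pos_mem_rateSet (h0 : ∀ j, 0 ≤ (U j).eval 0) (h1 : ∀ j, 0 < (U j).eval 1) :
    ∃ z ∈ rateSet U, ∀ j, 0 < z j := by
  rcases isEmpty_or_nonempty ι with hι | hι
  · exact ⟨0, ⟨0, fun j => isEmptyElim j, fun d => by simp, fun j => isEmptyElim j⟩,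
      fun j => isEmptyElim j⟩
  have hn : (0 : ℝ) < Fintype.card ι := by exact_mod_cast Fintype.card_pos
  have hn1 : (Fintype.card ι : ℝ)⁻¹ ≤ 1 := inv_le_one_of_one_le₀ (by
    exact_mod_cast Fintype.card_pos)
  have hpos : ∀ j, 0 < (U j).eval ((Fintype.card ι : ℝ)⁻¹ • 1) := fun j => by
    have h := (U j).eval_concaveOn.2 (mem_Ici.2 (le_refl (0 : Fin D → ℝ)))
      (mem_Ici.2 (zero_le_one : (0 : Fin D → ℝ) ≤ 1))
      (show 0 ≤ 1 - (Fintype.card ι : ℝ)⁻¹ by linarith)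
      (show 0 ≤ (Fintype.card ι : ℝ)⁻¹ by positivity) (by ring)
    simp only [smul_zero, zero_add, smul_eq_mul] at h
    refine lt_of_lt_of_le ?_ h
    exact add_pos_of_nonneg_of_pos (mul_nonneg (by linarith) (h0 j))
      (mul_pos (by positivity) (h1 j))
  refine ⟨fun j => (U j).eval ((Fintype.card ι : ℝ)⁻¹ • 1), ⟨fun _ => (Fintype.card ι : ℝ)⁻¹ • 1,
    fun j d => by simp, fun d => ?_, fun j => ⟨(hpos j).le, le_rfl⟩⟩, hpos⟩
  simp [hn.ne']

/-- Market clearing prices for the resources: strong duality for welfare maximization. -/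
lemma exists_prices {b : ι → ℝ} (hb : 0 ≤ b) {W : ℝ}
    (hW : ∀ x : ι → Fin D → ℝ, (∀ j d, 0 ≤ x j d) → (∀ d, ∑ j, x j d ≤ 1) →
      ∑ j, b j * (U j).eval (x j) ≤ W) :
    ∃ q : Fin D → ℝ, 0 ≤ q ∧ ∀ x ∈ Icc (0 : ι → Fin D → ℝ) 1,
      ∑ j, (b j * (U j).eval (x j) - ∑ d, q d * x j d) + ∑ d, q d ≤ W := by
  let welfare : (ι → Fin D → ℝ) → ℝ := fun x => ∑ j, b j * (U j).eval (x j)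
  -- Supplies and welfare levels that some allocation beats strictly. The set is open and convex and
  -- misses (1, W); a separating functional supplies the prices.
  let C : Set ((Fin D → ℝ) × ℝ) :=
    {p | ∃ x ∈ Icc (0 : ι → Fin D → ℝ) 1, (∀ d, ∑ j, x j d < p.1 d) ∧ p.2 < welfare x}
  have hCconv : Convex ℝ C := by
    rintro p ⟨x, hx, hx1, hx2⟩ p' ⟨x', hx', hx1', hx2'⟩ s t hs ht hst
    refine ⟨s • x + t • x', convex_Icc _ _ hx hx' hs ht hst, fun d => ?_, ?_⟩
    · have : ∑ j, (s • x + t • x') j d = s * ∑ j, x j d + t * ∑ j, x' j d := by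
        simp [Finset.sum_add_distrib, Finset.mul_sum]
      rw [this]
      simp only [Prod.fst_add, Prod.smul_fst, Pi.add_apply, Pi.smul_apply, smul_eq_mul]
      rcases eq_or_lt_of_le hs with rfl | hs
      · have : t = 1 := by linarith
        subst this; simpa using hx1' d
      · nlinarith [mul_lt_mul_of_pos_left (hx1 d) hs, mul_le_mul_of_nonneg_left (hx1' d).le ht]
    · have : s * welfare x + t * welfare x' ≤ welfare (s • x + t • x') := by
        simp only [welfare, Finset.mul_sum, ← Finset.sum_add_distrib]
        refine Finset.sum_le_sum fun j _ => ?_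
        have h := (U j).eval_concaveOn.2 (hx.1 j) (hx'.1 j) hs ht hst
        simp only [smul_eq_mul] at h
        calc _ = b j * (s * (U j).eval (x j) + t * (U j).eval (x' j)) := by ring
          _ ≤ _ := mul_le_mul_of_nonneg_left h (hb j)
      refine lt_of_lt_of_le ?_ this
      simp only [Prod.snd_add, Prod.smul_snd, smul_eq_mul]
      rcases eq_or_lt_of_le hs with rfl | hs
      · have : t = 1 := by linarith
        subst this; simpa using hx2'
      · nlinarith [mul_lt_mul_of_pos_left hx2 hs, mul_le_mul_of_nonneg_left hx2'.le ht]
  have hCopen : IsOpen C := by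
    have : C = ⋃ x ∈ Icc (0 : ι → Fin D → ℝ) 1,
        {p : (Fin D → ℝ) × ℝ | (∀ d, ∑ j, x j d < p.1 d) ∧ p.2 < welfare x} := by
      ext p; simp only [C, mem_ofPred_eq, mem_iUnion, exists_prop]
    rw [this]
    refine isOpen_biUnion fun x _ => ?_
    rw [ofPred_and, ofPred_forall]
    exact (isOpen_iInter_of_finite fun d => isOpen_lt (by fun_prop) (by fun_prop)).inter
      (isOpen_lt (by fun_prop) (by fun_prop))
  have hnot : ((1 : Fin D → ℝ), W) ∉ C := by
    rintro ⟨x, hx, hx1, hx2⟩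
    exact absurd (hW x hx.1 fun d => (hx1 d).le) (not_le.2 hx2)
  obtain ⟨f, hf⟩ := geometric_hahn_banach_open_point hCconv hCopen hnot
  let L : Fin D → ℝ := fun d => f (Pi.single d 1, 0)
  set κ := f (0, 1) with hκ
  have hfs : ∀ (s : Fin D → ℝ) (r : ℝ), f (s, r) = ∑ d, s d * L d + κ * r := by
    intro s r
    have h1 : f (s, r) = f (s, 0) + r * f (0, 1) := by
      rw [← smul_eq_mul, ← map_smul, ← map_add]; simp
    have h2 : f (s, 0) = ∑ d, s d * L d := by
      have := LinearMap.pi_apply_eq_sum_univ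
        (f.toLinearMap.comp (LinearMap.inl ℝ (Fin D → ℝ) ℝ)) s
      have hs : ∀ d : Fin D, (fun j => if d = j then (1 : ℝ) else 0) = Pi.single d 1 := fun d => by
        ext j; simp [Pi.single_apply, eq_comm]
      simpa [L, hs] using this
    rw [h1, h2, hκ, mul_comm]
  have hzero : (0 : ι → Fin D → ℝ) ∈ Icc (0 : ι → Fin D → ℝ) 1 := ⟨le_rfl, zero_le_one⟩
  -- Slater's condition: the zero allocation leaves a surplus of every resource, so points (1, r)
  -- with r below W lie in C.
  have hκpos : 0 < κ := by
    have h := hf (1, min (welfare 0) W - 1) ⟨0, hzero, fun d => by simp, by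
      have := min_le_left (welfare 0) W; simp only; linarith⟩
    rw [hfs, hfs] at h
    have := min_le_right (welfare 0) W
    by_contra! hneg
    nlinarith
  -- More supply never leaves C, so a positive coefficient would let the functional grow without
  -- bound on C.
  have hL : ∀ d, L d ≤ 0 := by
    intro d
    by_contra! hpos
    set r := min (welfare 0) W - 1 with hr
    set t := (κ * W - κ * r) / L d with ht
    have hrW : r ≤ W := by have := min_le_right (welfare 0) W; linarith
    have ht0 : 0 ≤ t := div_nonneg (by nlinarith) hpos.le
    have h := hf (1 + Pi.single d t, r) ⟨0, hzero, fun e => by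
        by_cases he : e = d
        · subst he; simp; linarith
        · simp [Pi.single_eq_of_ne he], by
      have := min_le_left (welfare 0) W; simp only; linarith⟩
    rw [hfs, hfs] at h
    simp only [Pi.add_apply, Pi.one_apply, add_mul, one_mul, Finset.sum_add_distrib] at h
    rw [Finset.sum_eq_single (f := fun e => (Pi.single d t : Fin D → ℝ) e * L e) d
      (fun e _ he => by simp [Pi.single_eq_of_ne he]) (by simp)] at h
    simp only [Pi.single_eq_same] at h
    have : t * L d = κ * W - κ * r := by rw [ht]; field_simp
    linarith
  refine ⟨fun d => -L d / κ, fun d => div_nonneg (by linarith [hL d]) hκpos.le, fun x hx => ?_⟩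
  -- The strict inequalities in C are relaxed by moving an allocation into C with a small margin η.
  have hx' : ∑ d, (∑ j, x j d) * L d + κ * welfare x ≤ ∑ d, L d + κ * W := by
    by_contra! hcon
    set δ := ∑ d, (∑ j, x j d) * L d + κ * welfare x - (∑ d, L d + κ * W) with hδ
    have hden : 0 < |κ - ∑ d, L d| + 1 := by positivity
    set η := δ / (|κ - ∑ d, L d| + 1) with hη
    have hη0 : 0 < η := div_pos (by linarith) hden
    have h := hf (fun d => ∑ j, x j d + η, welfare x - η) ⟨x, hx, fun d => by simp [hη0],
      by simp [hη0]⟩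
    rw [hfs, hfs] at h
    simp only [add_mul, Finset.sum_add_distrib, Pi.one_apply, one_mul, ← Finset.mul_sum] at h
    have h1 : η * (κ - ∑ d, L d) ≤ η * |κ - ∑ d, L d| :=
      mul_le_mul_of_nonneg_left (le_abs_self _) hη0.le
    have h2 : η * (|κ - ∑ d, L d| + 1) = δ := by rw [hη]; field_simp
    nlinarith
  have e1 : κ * (∑ j, (b j * (U j).eval (x j) - ∑ d, -L d / κ * x j d) + ∑ d, -L d / κ) =
      κ * welfare x + ∑ d, (∑ j, x j d) * L d - ∑ d, L d := by
    have h1 : κ * ∑ j, ∑ d, -L d / κ * x j d = -∑ d, (∑ j, x j d) * L d := by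
      rw [Finset.sum_comm, Finset.mul_sum, ← Finset.sum_neg_distrib]
      refine Finset.sum_congr rfl fun d _ => ?_
      rw [← Finset.mul_sum]; field_simp
    have h2 : κ * ∑ d, -L d / κ = -∑ d, L d := by
      rw [Finset.mul_sum, ← Finset.sum_neg_distrib]
      refine Finset.sum_congr rfl fun d _ => ?_
      field_simp
    rw [Finset.sum_sub_distrib, mul_add, mul_sub, h1, h2]
    ring
  refine le_of_mul_le_mul_left ?_ hκpos
  rw [e1]
  linarith

/-- Take welfare maximizers for b and c together with clearing prices q and p. Feasible allocations
for the max and min weights cost at most the total of the prices max(q,p) and min(q,p), whose sum is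
the total of q and p. Exchanging job by job turns them into bundles evaluated at (b,q) and (c,p),
where the prices certify the two optima as upper bounds. -/
lemma rateSet_submodular (b c : ι → ℝ) (hb : 0 ≤ b) (hc : 0 ≤ c)
    {z z' : ι → ℝ} (hz : z ∈ rateSet U) (hz' : z' ∈ rateSet U)
    (h0 : ∀ j, 0 ≤ (U j).eval 0) :
    ∃ y ∈ rateSet U, ∃ y' ∈ rateSet U,
    ∑ j, max (b j) (c j) * z j + ∑ j, min (b j) (c j) * z' j ≤ ∑ j, b j * y j + ∑ j, c j * y' j := by
  have hmax : ∀ b : ι → ℝ, ∃ y ∈ rateSet U, ∀ x : ι → Fin D → ℝ, (∀ j d, 0 ≤ x j d) →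
      (∀ d, ∑ j, x j d ≤ 1) → ∑ j, b j * (U j).eval (x j) ≤ ∑ j, b j * y j := by
    intro b
    obtain ⟨y, hy, hmax⟩ := (rateSet_isCompact U).exists_isMaxOn ⟨z, hz⟩
      (f := fun y => ∑ j, b j * y j) (by fun_prop)
    exact ⟨y, hy, fun x hx0 hx1 => hmax (show (fun j => (U j).eval (x j)) ∈ rateSet U from
      ⟨x, hx0, hx1, fun j => ⟨(h0 j).trans ((U j).eval_mono le_rfl (hx0 j)), le_rfl⟩⟩)⟩
  obtain ⟨y, hy, hyW⟩ := hmax b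
  obtain ⟨y', hy', hyW'⟩ := hmax c
  refine ⟨y, hy, y', hy', ?_⟩
  obtain ⟨q, hq0, hq⟩ := exists_prices U hb hyW
  obtain ⟨p, hp0, hp⟩ := exists_prices U hc hyW'
  obtain ⟨x, hx0, hx1, hxz⟩ := hz
  obtain ⟨x', hx0', hx1', hxz'⟩ := hz'
  have hx := allocation_le_one hx0 hx1
  have hx' := allocation_le_one hx0' hx1'
  choose v hv v' hv' hvv using fun j => (U j).exists_submodular_exchange (hb j) (hc j) q p
    (x := x j) (y := x' j) ⟨hx.1 j, hx.2 j⟩ ⟨hx'.1 j, hx'.2 j⟩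
  have h1 := hq v ⟨fun j => (hv j).1, fun j => (hv j).2⟩
  have h2 := hp v' ⟨fun j => (hv' j).1, fun j => (hv' j).2⟩
  have h3 := Finset.sum_le_sum fun j (_ : j ∈ Finset.univ) => hvv j
  simp only [Finset.sum_sub_distrib, Finset.sum_add_distrib] at h1 h2 h3
  have h4 : ∑ j, ∑ d, max (q d) (p d) * x j d ≤ ∑ d, max (q d) (p d) := by
    rw [Finset.sum_comm]
    refine Finset.sum_le_sum fun d _ => ?_
    rw [← Finset.mul_sum]
    exact mul_le_of_le_one_right (le_max_of_le_left (hq0 d)) (hx1 d)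
  have h5 : ∑ j, ∑ d, min (q d) (p d) * x' j d ≤ ∑ d, min (q d) (p d) := by
    rw [Finset.sum_comm]
    refine Finset.sum_le_sum fun d _ => ?_
    rw [← Finset.mul_sum]
    exact mul_le_of_le_one_right (le_min (hq0 d) (hp0 d)) (hx1' d)
  have h6 : ∑ d, max (q d) (p d) + ∑ d, min (q d) (p d) = ∑ d, q d + ∑ d, p d := by
    simp only [← Finset.sum_add_distrib, max_add_min]
  have h7 : ∑ j, max (b j) (c j) * z j ≤ ∑ j, max (b j) (c j) * (U j).eval (x j) :=
    Finset.sum_le_sum fun j _ => mul_le_mul_of_nonneg_left (hxz j).2 (le_max_of_le_left (hb j))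
  have h8 : ∑ j, min (b j) (c j) * z' j ≤ ∑ j, min (b j) (c j) * (U j).eval (x' j) :=
    Finset.sum_le_sum fun j _ => mul_le_mul_of_nonneg_left (hxz' j).2 (le_min (hb j) (hc j))
  linarith

lemma isRateRegion_rateSet (h0 : ∀ j, 0 ≤ (U j).eval 0) (h1 : ∀ j, 0 < (U j).eval 1) :
    IsRateRegion (rateSet U) where
  convex := rateSet_convex U
  isCompact := rateSet_isCompact U
  nonneg := fun _ ⟨_, _, _, hz⟩ j => (hz j).1
  lower := fun _ ⟨x, hx0, hx1, hz⟩ _ hy hyz => ⟨x, hx0, hx1, fun j => ⟨hy j, (hyz j).trans (hz j).2⟩⟩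
  exists_pos := exists_pos_mem_rateSet U h0 h1
  submodular := fun b c hb hc _ hz _ hz' => rateSet_submodular U b c hb hc hz hz' h0

end RateSet

/-! ## Processing histories -/

/-- The costs of the schedules with rates in `P` for jobs with remaining sizes `x` and costs `c`
per unit of size and time. -/
def costSet {ι : Type*} [Fintype ι] (P : Set (ι → ℝ)) (c x : ι → ℝ) : Set ℝ :=
  {v | ∃ z : ℝ → ι → ℝ, (∀ j, Measurable fun t => z t j) ∧ (∀ t, z t ∈ P) ∧
    (∀ j, IntegrableOn (fun t => z t j) (Ioi 0)) ∧
    (∀ j, IntegrableOn (fun t => t * z t j) (Ioi 0)) ∧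
    (∀ j, ∫ t in Ioi (0 : ℝ), z t j = x j) ∧
    v = ∑ j, c j * ∫ t in Ioi (0 : ℝ), t * z t j}

/-- The least cost of a schedule for jobs with remaining sizes `x`. -/
noncomputable def optCost {ι : Type*} [Fintype ι] (P : Set (ι → ℝ)) (c x : ι → ℝ) : ℝ :=
  sInf (costSet P c x)

/-- `X t j` is the amount of job `j` processed until time `t`, at rates in `P`, never exceeding
the size of the job. -/
structure IsCumulative {ι : Type*} (P : Set (ι → ℝ)) (x : ι → ℝ) (X : ℝ → ι → ℝ) : Prop where
  zero : X 0 = 0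
  incr : ∀ s t, 0 ≤ s → s ≤ t → ∃ p ∈ P, X t - X s = (t - s) • p
  le : ∀ t, 0 ≤ t → X t ≤ x

/-- The cost of a processing history: the integral of the weighted remaining sizes. -/
noncomputable def cumCost {ι : Type*} [Fintype ι] (c x : ι → ℝ) (X : ℝ → ι → ℝ) : ENNReal :=
  ∫⁻ t in Ioi (0 : ℝ), ENNReal.ofReal (∑ j, c j * (x j - X t j))

namespace IsRateRegion

variable {ι : Type*} [Fintype ι] {P : Set (ι → ℝ)}

lemma zero_mem (hP : IsRateRegion P) : (0 : ι → ℝ) ∈ P := by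
  obtain ⟨z, hz, -⟩ := hP.exists_pos
  exact hP.lower z hz 0 le_rfl (hP.nonneg z hz)

lemma exists_bound (hP : IsRateRegion P) : ∃ M : NNReal, ∀ z ∈ P, ∀ j, z j ≤ M := by
  obtain ⟨b, hb⟩ := hP.isCompact.isBounded.subset_closedBall 0
  refine ⟨b.toNNReal, fun z hz j => ?_⟩
  have h := hb hz
  rw [mem_closedBall_zero_iff] at h
  exact ((le_abs_self _).trans (norm_le_pi_norm z j)).trans (h.trans (Real.le_coe_toNNReal b))

end IsRateRegion

namespace IsCumulative

variable {ι : Type*} [Fintype ι] {P : Set (ι → ℝ)} {x : ι → ℝ} {X : ℝ → ι → ℝ}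

lemma monotoneOn (hP : IsRateRegion P) (hX : IsCumulative P x X) : MonotoneOn X (Ici 0) := by
  intro s hs t _ hst
  obtain ⟨p, hp, h⟩ := hX.incr s t hs hst
  rw [← sub_nonneg, h]
  exact smul_nonneg (sub_nonneg.2 hst) (hP.nonneg p hp)

lemma nonneg (hP : IsRateRegion P) (hX : IsCumulative P x X) {t : ℝ} (ht : 0 ≤ t) : 0 ≤ X t := by
  rw [← hX.zero]
  exact hX.monotoneOn hP (mem_Ici.2 le_rfl) ht ht

lemma exists_lipschitzOnWith (hP : IsRateRegion P) (hX : IsCumulative P x X) :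
    ∃ M : NNReal, ∀ j, LipschitzOnWith M (fun t => X t j) (Ici 0) := by
  obtain ⟨M, hM⟩ := hP.exists_bound
  refine ⟨M, fun j => LipschitzOnWith.of_le_add_mul M fun s hs t ht => ?_⟩
  rcases le_total s t with hst | hst
  · have h1 := hX.monotoneOn hP hs ht hst j
    have h2 : 0 ≤ (M : ℝ) * dist s t := by positivity
    linarith
  · obtain ⟨p, hp, h⟩ := hX.incr t s ht hst
    have h1 := congrFun h j
    simp only [Pi.sub_apply, Pi.smul_apply, smul_eq_mul] at h1
    rw [Real.dist_eq, abs_of_nonneg (sub_nonneg.2 hst)]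
    have := mul_le_mul_of_nonneg_left (hM p hp j) (sub_nonneg.2 hst)
    linarith

lemma continuousOn (hP : IsRateRegion P) (hX : IsCumulative P x X) : ContinuousOn X (Ici 0) := by
  obtain ⟨M, hM⟩ := hX.exists_lipschitzOnWith hP
  exact continuousOn_pi.2 fun j => (hM j).continuousOn

lemma aemeasurable (hP : IsRateRegion P) (hX : IsCumulative P x X) (j : ι) :
    AEMeasurable (fun t => X t j) (volume.restrict (Ioi 0)) :=
  ((continuousOn_pi.1 (hX.continuousOn hP) j).mono Ioi_subset_Ici_self).aemeasurable
    measurableSet_Ioi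

lemma cumCost_eq (hP : IsRateRegion P) {c : ι → ℝ} (hc : ∀ j, 0 < c j)
    (hX : IsCumulative P x X) :
    cumCost c x X =
      ∑ j, ENNReal.ofReal (c j) * ∫⁻ t in Ioi (0 : ℝ), ENNReal.ofReal (x j - X t j) := by
  have h1 : cumCost c x X = ∫⁻ t in Ioi (0 : ℝ), ∑ j, ENNReal.ofReal (c j) *
      ENNReal.ofReal (x j - X t j) := by
    refine setLIntegral_congr_fun measurableSet_Ioi fun t ht => ?_
    rw [ENNReal.ofReal_sum_of_nonneg fun j _ => mul_nonneg (hc j).le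
      (sub_nonneg.2 (hX.le t (le_of_lt ht) j))]
    exact Finset.sum_congr rfl fun j _ => ENNReal.ofReal_mul (hc j).le
  have hm : ∀ j, AEMeasurable (fun t => ENNReal.ofReal (x j - X t j)) (volume.restrict (Ioi 0)) :=
    fun j => ((hX.aemeasurable hP j).const_sub (x j)).ennreal_ofReal
  rw [h1, lintegral_finsetSum' _ fun j _ => (hm j).const_mul _]
  refine Finset.sum_congr rfl fun j _ => ?_
  rw [lintegral_const_mul'' _ (hm j)]

end IsCumulative

/-- The first moment of a density is the integral of its tails. -/
lemma lintegral_mul_eq_lintegral_tail {z : ℝ → ℝ} (hz : Measurable z) (hz0 : ∀ t, 0 ≤ z t)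
    (hi : IntegrableOn z (Ioi 0)) :
    ∫⁻ t in Ioi (0 : ℝ), ENNReal.ofReal (t * z t) =
      ∫⁻ t in Ioi (0 : ℝ), ENNReal.ofReal ((∫ τ in Ioi (0 : ℝ), z τ) - ∫ τ in (0 : ℝ)..t, z τ) := by
  -- Layer-cake formula for the identity function under the measure with density z.
  set μ := (volume.restrict (Ioi (0 : ℝ))).withDensity fun t => ENNReal.ofReal (z t) with hμ
  have h := lintegral_eq_lintegral_meas_lt μ (f := fun t : ℝ => t) (by
    refine (withDensity_absolutelyContinuous _ _).ae_le ?_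
    exact (ae_restrict_iff' measurableSet_Ioi).2 (Filter.Eventually.of_forall fun t ht =>
      le_of_lt ht)) measurable_id.aemeasurable
  rw [hμ, lintegral_withDensity_eq_lintegral_mul _ hz.ennreal_ofReal
    ENNReal.measurable_ofReal] at h
  have h1 : ∫⁻ t in Ioi (0 : ℝ), ENNReal.ofReal (t * z t) = ∫⁻ t in Ioi (0 : ℝ),
      ((fun t => ENNReal.ofReal (z t)) * ENNReal.ofReal) t := by
    refine lintegral_congr fun t => ?_
    rw [Pi.mul_apply, mul_comm t, ENNReal.ofReal_mul (hz0 t)]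
  rw [h1]
  refine h.trans (setLIntegral_congr_fun measurableSet_Ioi fun t ht => ?_)
  have ht' : Ioi t ⊆ Ioi (0 : ℝ) := Ioi_subset_Ioi (le_of_lt ht)
  change (Measure.withDensity _ _) (Ioi t) = _
  rw [withDensity_apply _ measurableSet_Ioi, Measure.restrict_restrict measurableSet_Ioi,
    inter_eq_left.2 ht', ← ofReal_integral_eq_lintegral_ofReal (hi.mono_set ht')
      (Filter.Eventually.of_forall hz0)]
  congr 1
  rw [← intervalIntegral.integral_Ioi_sub_Ioi hi (le_of_lt ht)]
  ring

/-! ### Processing histories and their rates -/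

section DensityOfHistory

variable {ι : Type*} [Fintype ι] {P : Set (ι → ℝ)} {x : ι → ℝ} {X : ℝ → ι → ℝ}

/-- The rates of a processing history. -/
noncomputable def historyRate (X : ℝ → ι → ℝ) (t : ℝ) : ι → ℝ := if 0 < t then deriv X t else 0

lemma historyRate_measurable (X : ℝ → ι → ℝ) : Measurable (historyRate X) :=
  Measurable.ite measurableSet_Ioi (measurable_deriv X) measurable_const

namespace IsCumulative

/-- Slopes of a history lie in P, hence so do their limits, as P is closed. Where X is not
differentiable `deriv` is 0, which also lies in P. -/
lemma historyRate_mem (hP : IsRateRegion P) (hX : IsCumulative P x X) (t : ℝ) :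
    historyRate X t ∈ P := by
  unfold historyRate
  split_ifs with ht
  · by_cases hd : DifferentiableAt ℝ X t
    · have h := hd.hasDerivAt.hasDerivWithinAt (s := Ioi t)
      rw [hasDerivWithinAt_iff_tendsto_slope' (by simp)] at h
      refine hP.isCompact.isClosed.mem_of_tendsto h ?_
      filter_upwards [self_mem_nhdsWithin] with s hs
      obtain ⟨p, hp, h⟩ := hX.incr t s ht.le (le_of_lt hs)
      rw [slope, vsub_eq_sub, h, smul_smul, inv_mul_cancel₀ (sub_pos.2 hs).ne', one_smul]
      exact hp
    · rw [deriv_zero_of_not_differentiableAt hd]; exact hP.zero_mem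
  · exact hP.zero_mem

lemma absolutelyContinuous (hP : IsRateRegion P) (hX : IsCumulative P x X) (j : ι) {t : ℝ}
    (ht : 0 ≤ t) : AbsolutelyContinuousOnInterval (fun t => X t j) 0 t := by
  obtain ⟨M, hM⟩ := hX.exists_lipschitzOnWith hP
  refine ((hM j).mono ?_).absolutelyContinuousOnInterval
  rw [uIcc_of_le ht]
  exact Icc_subset_Ici_self

lemma ae_hasDerivAt (hP : IsRateRegion P) (hX : IsCumulative P x X) :
    ∀ᵐ t, 0 < t → HasDerivAt X (historyRate X t) t := by
  have h : ∀ j, ∀ᵐ t, 0 < t → DifferentiableAt ℝ (fun t => X t j) t := by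
    intro j
    have h1 : ∀ n : ℕ, ∀ᵐ t, t ∈ uIcc (0 : ℝ) n → DifferentiableAt ℝ (fun t => X t j) t :=
      fun n => (hX.absolutelyContinuous hP j n.cast_nonneg).ae_differentiableAt
    filter_upwards [ae_all_iff.2 h1] with t ht h0
    obtain ⟨n, hn⟩ := exists_nat_ge t
    refine ht n ?_
    rw [uIcc_of_le n.cast_nonneg]
    exact ⟨h0.le, hn⟩
  filter_upwards [ae_all_iff.2 h] with t ht h0
  rw [historyRate, if_pos h0]
  exact (differentiableAt_pi.2 fun j => ht j h0).hasDerivAt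

lemma integral_historyRate (hP : IsRateRegion P) (hX : IsCumulative P x X) (j : ι) {t : ℝ}
    (ht : 0 ≤ t) : ∫ τ in (0 : ℝ)..t, historyRate X τ j = X t j := by
  have h := (hX.absolutelyContinuous hP j ht).integral_deriv_eq_sub
  rw [hX.zero, Pi.zero_apply, sub_zero] at h
  rw [← h]
  refine intervalIntegral.integral_congr_ae ?_
  filter_upwards [hX.ae_hasDerivAt hP] with τ hτ hmem
  rw [uIoc_of_le ht] at hmem
  exact ((hasDerivAt_pi.1 (hτ hmem.1)) j).deriv.symm

lemma historyRate_intervalIntegrable (hP : IsRateRegion P) (hX : IsCumulative P x X) (j : ι)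
    (a b : ℝ) : IntervalIntegrable (fun t => historyRate X t j) volume a b := by
  obtain ⟨M, hM⟩ := hP.exists_bound
  refine (intervalIntegrable_const (c := (M : ℝ))).mono_fun
    ((measurable_pi_iff.1 (historyRate_measurable X) j).aestronglyMeasurable)
    (Filter.Eventually.of_forall fun t => ?_)
  have h1 := hP.nonneg _ (hX.historyRate_mem hP t) j
  have h2 := hM _ (hX.historyRate_mem hP t) j
  rw [Pi.zero_apply] at h1
  simpa [abs_of_nonneg h1] using h2

/-- A job that stays below some a < x j leaves at least x j - a unprocessed forever, at infinite
cost. -/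
lemma tendsto_of_cumCost_ne_top (hP : IsRateRegion P) {c : ι → ℝ} (hc : ∀ j, 0 < c j)
    (hX : IsCumulative P x X) (hfin : cumCost c x X ≠ ⊤) (j : ι) :
    Filter.Tendsto (fun t => X t j) Filter.atTop (nhds (x j)) := by
  rw [tendsto_order]
  refine ⟨fun a ha => ?_, fun a ha => ?_⟩
  · by_contra hcon
    apply hfin
    have hle : ∀ t, 0 ≤ t → X t j ≤ a := by
      intro t ht
      by_contra! hlt
      refine hcon ?_
      filter_upwards [Filter.eventually_ge_atTop t] with s hs
      exact hlt.trans_le (hX.monotoneOn hP ht (ht.trans hs) hs j)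
    rw [hX.cumCost_eq hP hc, ENNReal.sum_eq_top]
    refine ⟨j, Finset.mem_univ j, ?_⟩
    have h1 : ∫⁻ t in Ioi (0 : ℝ), ENNReal.ofReal (x j - X t j) = ⊤ := by
      refine top_le_iff.1 (le_trans (le_of_eq ?_) (setLIntegral_mono' measurableSet_Ioi
        fun t ht => ENNReal.ofReal_le_ofReal (show x j - a ≤ x j - X t j by
          linarith [hle t (le_of_lt ht)])))
      rw [setLIntegral_const, Real.volume_Ioi, ENNReal.mul_top]
      simpa using ha
    rw [h1, ENNReal.mul_top]
    simpa using hc j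
  · filter_upwards [Filter.eventually_ge_atTop 0] with t ht
    exact (hX.le t ht j).trans_lt ha

lemma integrableOn_historyRate (hP : IsRateRegion P) {c : ι → ℝ} (hc : ∀ j, 0 < c j)
    (hX : IsCumulative P x X) (hfin : cumCost c x X ≠ ⊤) (j : ι) :
    IntegrableOn (fun t => historyRate X t j) (Ioi 0) ∧
      ∫ t in Ioi (0 : ℝ), historyRate X t j = x j := by
  have hlim : Filter.Tendsto (fun t => ∫ τ in (0 : ℝ)..t, historyRate X τ j) Filter.atTop
      (nhds (x j)) := by
    refine (hX.tendsto_of_cumCost_ne_top hP hc hfin j).congr' ?_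
    filter_upwards [Filter.eventually_ge_atTop 0] with t ht
    exact (hX.integral_historyRate hP j ht).symm
  have hint : IntegrableOn (fun t => historyRate X t j) (Ioi 0) := by
    refine integrableOn_Ioi_of_intervalIntegral_norm_tendsto (x j) 0
      (fun t => (intervalIntegrable_iff.1 (hX.historyRate_intervalIntegrable hP j 0 t)).mono_set
        Ioc_subset_uIoc) Filter.tendsto_id ?_
    refine hlim.congr fun t => ?_
    refine intervalIntegral.integral_congr fun τ _ => ?_
    exact (abs_of_nonneg (hP.nonneg _ (hX.historyRate_mem hP τ) j)).symm
  exact ⟨hint, tendsto_nhds_unique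
    (intervalIntegral_tendsto_integral_Ioi 0 hint Filter.tendsto_id) hlim⟩

end IsCumulative

/-- Every processing history costs at least the optimum. -/
theorem IsCumulative.optCost_le (hP : IsRateRegion P) {c : ι → ℝ} (hc : ∀ j, 0 < c j)
    (hX : IsCumulative P x X) :
    ENNReal.ofReal (optCost P c x) ≤ cumCost c x X := by
  by_cases hfin : cumCost c x X = ⊤
  · rw [hfin]; exact le_top
  have hint := hX.integrableOn_historyRate hP hc hfin
  have hmem := hX.historyRate_mem hP
  have hmeas := measurable_pi_iff.1 (historyRate_measurable X)
  have hnn : ∀ t j, 0 ≤ historyRate X t j := fun t j => hP.nonneg _ (hmem t) j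
  have htail : ∀ j, ∫⁻ t in Ioi (0 : ℝ), ENNReal.ofReal (t * historyRate X t j) =
      ∫⁻ t in Ioi (0 : ℝ), ENNReal.ofReal (x j - X t j) := fun j => by
    rw [lintegral_mul_eq_lintegral_tail (hmeas j) (fun t => hnn t j) (hint j).1, (hint j).2]
    refine setLIntegral_congr_fun measurableSet_Ioi fun t ht => ?_
    rw [hX.integral_historyRate hP j (le_of_lt ht)]
  have hfin' : ∀ j, ∫⁻ t in Ioi (0 : ℝ), ENNReal.ofReal (x j - X t j) ≠ ⊤ := by
    intro j htop
    refine hfin ?_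
    rw [hX.cumCost_eq hP hc, ENNReal.sum_eq_top]
    exact ⟨j, Finset.mem_univ j, by rw [htop, ENNReal.mul_top]; simpa using hc j⟩
  have hnn2 : ∀ j, 0 ≤ᵐ[volume.restrict (Ioi (0 : ℝ))] fun t => t * historyRate X t j := fun j =>
    (ae_restrict_iff' measurableSet_Ioi).2 (Filter.Eventually.of_forall fun t ht =>
      mul_nonneg (le_of_lt ht) (hnn t j))
  have hint2 : ∀ j, IntegrableOn (fun t => t * historyRate X t j) (Ioi 0) := fun j => by
    refine ⟨(measurable_id.mul (hmeas j)).aestronglyMeasurable, ?_⟩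
    rw [hasFiniteIntegral_iff_ofReal (hnn2 j), htail]
    exact (hfin' j).lt_top
  have hbdd : BddBelow (costSet P c x) := by
    refine ⟨0, ?_⟩
    rintro _ ⟨z, -, hz, -, -, -, rfl⟩
    exact Finset.sum_nonneg fun j _ => mul_nonneg (hc j).le
      (setIntegral_nonneg measurableSet_Ioi fun t ht => mul_nonneg (le_of_lt ht)
        (hP.nonneg _ (hz t) j))
  have hle := csInf_le hbdd ⟨historyRate X, hmeas, hmem, fun j => (hint j).1, hint2,
    fun j => (hint j).2, rfl⟩
  refine (ENNReal.ofReal_le_ofReal hle).trans (le_of_eq ?_)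
  rw [hX.cumCost_eq hP hc, ENNReal.ofReal_sum_of_nonneg fun j _ => mul_nonneg (hc j).le
    (integral_nonneg_of_ae (hnn2 j))]
  refine Finset.sum_congr rfl fun j _ => ?_
  rw [ENNReal.ofReal_mul (hc j).le, ofReal_integral_eq_lintegral_ofReal (hint2 j) (hnn2 j), htail]

end DensityOfHistory

/-! ## Existence of optimal processing histories -/

/-! ### Lower sums of antitone functions -/

section Riemann

variable {φ : ℝ → ENNReal} {δ : ℝ}

lemma lintegral_Ioi_eq_tsum (hδ : 0 < δ) (a : ℝ) :
    ∫⁻ t in Ioi a, φ t = ∑' i : ℕ, ∫⁻ t in Ioc (a + i * δ) (a + (i + 1) * δ), φ t := by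
  have hmono : Monotone fun i : ℕ => a + i * δ := fun i j hij => by
    have : (i : ℝ) ≤ j := by exact_mod_cast hij
    simp only; nlinarith
  have hunb : ¬BddAbove (range fun i : ℕ => a + i * δ) := by
    rintro ⟨b, hb⟩
    obtain ⟨n, hn⟩ := exists_nat_gt ((b - a) / δ)
    rw [div_lt_iff₀ hδ] at hn
    have := hb ⟨n, rfl⟩
    simp only at this
    linarith
  have h1 := iUnion_Ioc_map_succ_eq_Ioi (fun i => hmono (bot_le (a := i))) hunb
  have h2 := hmono.pairwise_disjoint_on_Ioc_succ
  simp only [Nat.succ_eq_succ, Nat.succ_eq_add_one, Nat.bot_eq_zero, Nat.cast_zero, zero_mul,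
    add_zero, Nat.cast_add, Nat.cast_one] at h1 h2
  rw [← h1, lintegral_iUnion (fun i => measurableSet_Ioc) h2]

lemma tsum_le_lintegral_of_antitoneOn (hφ : AntitoneOn φ (Ici 0)) (hδ : 0 < δ) :
    ∑' i : ℕ, ENNReal.ofReal δ * φ ((i + 1) * δ) ≤ ∫⁻ t in Ioi 0, φ t := by
  rw [lintegral_Ioi_eq_tsum hδ]
  refine ENNReal.tsum_le_tsum fun i => ?_
  have h : ∫⁻ _ in Ioc (0 + i * δ) (0 + (i + 1) * δ), φ ((i + 1) * δ) =
      ENNReal.ofReal δ * φ ((i + 1) * δ) := by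
    rw [setLIntegral_const, Real.volume_Ioc, mul_comm]
    congr 2; ring
  rw [← h]
  refine setLIntegral_mono' measurableSet_Ioc fun t ht => ?_
  have hi : 0 ≤ (i : ℝ) * δ := by positivity
  refine hφ ?_ ?_ ?_
  · simp only [mem_Ici]; linarith [ht.1]
  · simp only [mem_Ici]; linarith
  · linarith [ht.2]

lemma lintegral_le_tsum_of_antitoneOn (hφ : AntitoneOn φ (Ici 0)) (hδ : 0 < δ) :
    ∫⁻ t in Ioi δ, φ t ≤ ∑' i : ℕ, ENNReal.ofReal δ * φ ((i + 1) * δ) := by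
  rw [lintegral_Ioi_eq_tsum hδ]
  refine ENNReal.tsum_le_tsum fun i => ?_
  have h : ∫⁻ _ in Ioc (δ + i * δ) (δ + (i + 1) * δ), φ ((i + 1) * δ) =
      ENNReal.ofReal δ * φ ((i + 1) * δ) := by
    rw [setLIntegral_const, Real.volume_Ioc, mul_comm]
    congr 2; ring
  rw [← h]
  refine setLIntegral_mono' measurableSet_Ioc fun t ht => ?_
  have hi : 0 ≤ (i : ℝ) * δ := by positivity
  refine hφ ?_ ?_ ?_
  · simp only [mem_Ici]; linarith
  · simp only [mem_Ici]; linarith [ht.1]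
  · linarith [ht.1]

/-- The integral of an antitone function as a supremum of lower sums. -/
lemma lintegral_eq_iSup_tsum_of_antitoneOn (hφ : AntitoneOn φ (Ici 0)) :
    ∫⁻ t in Ioi 0, φ t = ⨆ m : ℕ, ∑' i : ℕ, ENNReal.ofReal (1 / (m + 1)) *
      φ ((i + 1) * (1 / (m + 1))) := by
  have hpos : ∀ m : ℕ, (0 : ℝ) < 1 / (m + 1) := fun m => by positivity
  refine le_antisymm ?_ (iSup_le fun m => tsum_le_lintegral_of_antitoneOn hφ (hpos m))
  have hU : Ioi (0 : ℝ) = ⋃ m : ℕ, Ioi (1 / ((m : ℝ) + 1)) := by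
    ext t
    simp only [mem_Ioi, mem_iUnion]
    exact ⟨fun ht => exists_nat_one_div_lt ht, fun ⟨m, hm⟩ => (hpos m).trans hm⟩
  rw [hU, setLIntegral_iUnion_of_directed]
  · exact iSup_mono fun m => lintegral_le_tsum_of_antitoneOn hφ (hpos m)
  · exact directed_of_isDirected_le fun m n hmn =>
      Ioi_subset_Ioi (one_div_le_one_div_of_le (by positivity) (by
        have : (m : ℝ) ≤ n := by exact_mod_cast hmn
        linarith))

end Riemann

/-! ### Optimal histories by compactness -/

section Optimal

variable {ι : Type*} [Fintype ι] {P : Set (ι → ℝ)} {x c : ι → ℝ}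

/-- Time averages of feasible rates are feasible. -/
lemma IsRateRegion.exists_average (hP : IsRateRegion P) {z : ℝ → ι → ℝ}
    (hz : ∀ j, Measurable fun t => z t j) (hzP : ∀ t, z t ∈ P) {s t : ℝ} (hst : s ≤ t) :
    ∃ p ∈ P, ∀ j, ∫ τ in s..t, z τ j = (t - s) * p j := by
  rcases eq_or_lt_of_le hst with rfl | hst
  · exact ⟨0, hP.zero_mem, fun j => by simp⟩
  have hvol : volume (Ioc s t) ≠ ⊤ := by simp
  have hint : ∀ j, IntegrableOn (fun τ => z τ j) (Ioc s t) := by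
    obtain ⟨M, hM⟩ := hP.exists_bound
    refine fun j => Measure.integrableOn_of_bounded (M := M) hvol (hz j).aestronglyMeasurable
      (Filter.Eventually.of_forall fun τ => ?_)
    rw [Real.norm_of_nonneg (hP.nonneg _ (hzP τ) j)]
    exact hM _ (hzP τ) j
  refine ⟨_, hP.convex.set_average_mem (μ := volume) (t := Ioc s t) (f := z)
    hP.isCompact.isClosed (by simp [hst]) hvol (Filter.Eventually.of_forall hzP)
    (Integrable.of_eval hint), fun j => ?_⟩
  rw [setAverage_eq, Pi.smul_apply, smul_eq_mul, eval_integral hint,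
    intervalIntegral.integral_of_le hst.le, measureReal_def, Real.volume_Ioc,
    ENNReal.toReal_ofReal (sub_pos.2 hst).le, ← mul_assoc, mul_inv_cancel₀ (sub_pos.2 hst).ne',
    one_mul]

lemma IsRateRegion.intervalIntegrable (hP : IsRateRegion P) {z : ℝ → ι → ℝ}
    (hz : ∀ j, Measurable fun t => z t j) (hzP : ∀ t, z t ∈ P) (j : ι) (a b : ℝ) :
    IntervalIntegrable (fun t => z t j) volume a b := by
  obtain ⟨M, hM⟩ := hP.exists_bound
  refine (intervalIntegrable_const (c := (M : ℝ))).mono_fun (hz j).aestronglyMeasurable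
    (Filter.Eventually.of_forall fun t => ?_)
  have h1 := hP.nonneg _ (hzP t) j
  rw [Pi.zero_apply] at h1
  simpa [abs_of_nonneg h1] using hM _ (hzP t) j

lemma IsRateRegion.isCumulative_integral (hP : IsRateRegion P) {z : ℝ → ι → ℝ}
    (hz : ∀ j, Measurable fun t => z t j) (hzP : ∀ t, z t ∈ P)
    (hle : ∀ t, 0 ≤ t → ∀ j, ∫ τ in (0 : ℝ)..t, z τ j ≤ x j) :
    IsCumulative P x fun t j => ∫ τ in (0 : ℝ)..t, z τ j where
  zero := by ext j; simp
  incr s t _ hst := by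
    obtain ⟨p, hp, h⟩ := hP.exists_average hz hzP hst
    refine ⟨p, hp, funext fun j => ?_⟩
    rw [Pi.sub_apply, Pi.smul_apply, smul_eq_mul, ← h j, intervalIntegral.integral_interval_sub_left
      (hP.intervalIntegrable hz hzP j _ _) (hP.intervalIntegrable hz hzP j _ _)]
  le t ht j := hle t ht j

lemma exists_cumCost_eq_of_mem_costSet (hP : IsRateRegion P) (hc : ∀ j, 0 < c j) {v : ℝ}
    (hv : v ∈ costSet P c x) :
    ∃ X, IsCumulative P x X ∧ cumCost c x X = ENNReal.ofReal v := by
  obtain ⟨z, hz, hzP, hi, hi2, hx, rfl⟩ := hv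
  have hnn : ∀ t j, 0 ≤ z t j := fun t j => hP.nonneg _ (hzP t) j
  have hX : IsCumulative P x fun t j => ∫ τ in (0 : ℝ)..t, z τ j := by
    refine hP.isCumulative_integral hz hzP fun t ht j => ?_
    rw [intervalIntegral.integral_of_le ht, ← hx j]
    exact setIntegral_mono_set (hi j) (Filter.Eventually.of_forall fun t => hnn t j)
      (Filter.Eventually.of_forall fun _ h => Ioc_subset_Ioi_self h)
  have hnn2 : ∀ j, 0 ≤ᵐ[volume.restrict (Ioi (0 : ℝ))] fun t => t * z t j := fun j =>
    (ae_restrict_iff' measurableSet_Ioi).2 (Filter.Eventually.of_forall fun t ht =>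
      mul_nonneg (le_of_lt ht) (hnn t j))
  refine ⟨_, hX, ?_⟩
  rw [hX.cumCost_eq hP hc, ENNReal.ofReal_sum_of_nonneg fun j _ => mul_nonneg (hc j).le
    (integral_nonneg_of_ae (hnn2 j))]
  refine Finset.sum_congr rfl fun j _ => ?_
  rw [ENNReal.ofReal_mul (hc j).le, ofReal_integral_eq_lintegral_ofReal (hi2 j) (hnn2 j),
    lintegral_mul_eq_lintegral_tail (hz j) (fun t => hnn t j) (hi j), hx j]

/-- Run all jobs in parallel at strictly positive rates r j, each until its own time x j / r j;
downward closure of P allows the finished ones to idle. -/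
lemma costSet_nonempty (hP : IsRateRegion P) (hx : 0 ≤ x) : (costSet P c x).Nonempty := by
  obtain ⟨r, hr, hpos⟩ := hP.exists_pos
  have hvol : ∀ j, volume (Ioc 0 (x j / r j)) ≠ ⊤ := fun j => by simp
  have hz : ∀ j, Measurable ((Ioc 0 (x j / r j)).indicator fun _ : ℝ => r j) := fun j =>
    measurable_const.indicator measurableSet_Ioc
  have hsub : ∀ j, Ioc 0 (x j / r j) ⊆ Ioi (0 : ℝ) := fun j => Ioc_subset_Ioi_self
  refine ⟨_, fun t j => (Ioc 0 (x j / r j)).indicator (fun _ => r j) t, hz, fun t => ?_, fun j => ?_,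
    fun j => ?_, fun j => ?_, rfl⟩
  · refine hP.lower r hr _ (fun j => indicator_nonneg (fun _ _ => (hpos j).le) _) fun j => ?_
    exact indicator_le_self' (fun _ _ => (hpos j).le) t
  · exact ((integrable_indicator_iff measurableSet_Ioc).2
      (integrableOn_const (hvol j))).integrableOn
  · have : (fun t => t * (Ioc 0 (x j / r j)).indicator (fun _ => r j) t) =
        (Ioc 0 (x j / r j)).indicator fun t => t * r j := by
      ext t; simp only [indicator]; split_ifs <;> simp
    simp only [this]
    refine ((integrable_indicator_iff measurableSet_Ioc).2 ?_).integrableOn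
    exact (Continuous.integrableOn_Ioc (by fun_prop))
  · rw [setIntegral_indicator measurableSet_Ioc, inter_eq_right.2 (hsub j), setIntegral_const,
      measureReal_def, Real.volume_Ioc, sub_zero,
      ENNReal.toReal_ofReal (div_nonneg (hx j) (hpos j).le), smul_eq_mul]
    field_simp [(hpos j).ne']

lemma costSet_nonneg (hP : IsRateRegion P) (hc : ∀ j, 0 < c j) {v : ℝ} (hv : v ∈ costSet P c x) :
    0 ≤ v := by
  obtain ⟨z, -, hz, -, -, -, rfl⟩ := hv
  exact Finset.sum_nonneg fun j _ => mul_nonneg (hc j).le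
    (setIntegral_nonneg measurableSet_Ioi fun t ht => mul_nonneg (le_of_lt ht)
      (hP.nonneg _ (hz t) j))

lemma optCost_nonneg (hP : IsRateRegion P) (hc : ∀ j, 0 < c j) : 0 ≤ optCost P c x :=
  Real.sInf_nonneg fun _ hv => costSet_nonneg hP hc hv

lemma optCost_le_of_mem (hP : IsRateRegion P) (hc : ∀ j, 0 < c j) {v : ℝ}
    (hv : v ∈ costSet P c x) : optCost P c x ≤ v :=
  csInf_le ⟨0, fun _ hv => costSet_nonneg hP hc hv⟩ hv

/-- Histories, made constant before time `0`. -/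
def histories (P : Set (ι → ℝ)) (x : ι → ℝ) : Set (ℝ → ι → ℝ) :=
  {X | IsCumulative P x X ∧ ∀ t, t < 0 → X t = 0}

/-- Tychonoff: a history is a point of a product of boxes over all real times, and each defining
condition involves at most two times and is closed. Fixing the values at negative times makes the
set a subset of this product. -/
lemma isCompact_histories (hP : IsRateRegion P) (hx : 0 ≤ x) : IsCompact (histories P x) := by
  have hbox : IsCompact (univ.pi fun _ : ℝ => Icc (0 : ι → ℝ) x) :=
    isCompact_univ_pi fun _ => isCompact_Icc
  have heq : histories P x = (univ.pi fun _ : ℝ => Icc (0 : ι → ℝ) x) ∩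
      (⋂ t ∈ Iic (0 : ℝ), {X : ℝ → ι → ℝ | X t = 0}) ∩
      ⋂ s ∈ Ici (0 : ℝ), ⋂ t ∈ Ici s, {X : ℝ → ι → ℝ | X t - X s ∈ (fun p => (t - s) • p) '' P} := by
    ext X
    simp only [histories, mem_inter_iff, mem_iInter, mem_pi, mem_univ, true_implies]
    constructor
    · rintro ⟨hX, hneg⟩
      refine ⟨⟨fun t => ?_, fun t ht => ?_⟩, fun s hs t ht => ?_⟩
      · rcases lt_or_ge t 0 with h | h
        · rw [hneg t h]; exact ⟨le_rfl, hx⟩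
        · exact ⟨hX.nonneg hP h, hX.le t h⟩
      · rcases eq_or_lt_of_le (mem_Iic.1 ht) with h | h
        · change X t = 0
          rw [h, hX.zero]
        · exact hneg t h
      · obtain ⟨p, hp, h⟩ := hX.incr s t hs ht
        exact ⟨p, hp, h.symm⟩
    · rintro ⟨⟨hbox, hneg⟩, hincr⟩
      refine ⟨⟨hneg 0 (mem_Iic.2 le_rfl), fun s t hs hst => ?_, fun t _ => (hbox t).2⟩,
        fun t ht => hneg t (le_of_lt ht)⟩
      obtain ⟨p, hp, h⟩ := hincr s hs t hst
      exact ⟨p, hp, h.symm⟩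
  rw [heq]
  refine (hbox.inter_right ?_).inter_right ?_
  · exact isClosed_biInter fun t _ => isClosed_eq (continuous_apply t) continuous_const
  · refine isClosed_biInter fun s _ => isClosed_biInter fun t _ => ?_
    have hcl : IsClosed ((fun p : ι → ℝ => (t - s) • p) '' P) :=
      (hP.isCompact.image (by fun_prop)).isClosed
    exact hcl.preimage (f := fun X : ℝ → ι → ℝ => X t - X s)
      ((continuous_apply t).sub (continuous_apply s))

lemma IsCumulative.antitoneOn_cost (hP : IsRateRegion P) (hc : ∀ j, 0 < c j) {X : ℝ → ι → ℝ}
    (hX : IsCumulative P x X) :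
    AntitoneOn (fun t => ENNReal.ofReal (∑ j, c j * (x j - X t j))) (Ici 0) :=
  fun s hs t ht hst => ENNReal.ofReal_le_ofReal (Finset.sum_le_sum fun j _ =>
    mul_le_mul_of_nonneg_left (by linarith [hX.monotoneOn hP hs ht hst j]) (hc j).le)

/-- There is an optimal processing history. -/
theorem exists_optimal (hP : IsRateRegion P) (hc : ∀ j, 0 < c j) (hx : 0 ≤ x) :
    ∃ X, IsCumulative P x X ∧ cumCost c x X = ENNReal.ofReal (optCost P c x) := by
  -- On histories the cost is a supremum of sums whose terms each depend continuously on a single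
  -- value of X. So J is lower semicontinuous for pointwise convergence and attains its minimum on
  -- the compact set.
  let J : (ℝ → ι → ℝ) → ENNReal := fun X => ⨆ m : ℕ, ∑' i : ℕ, ENNReal.ofReal (1 / (m + 1)) *
    ENNReal.ofReal (∑ j, c j * (x j - X ((i + 1) * (1 / (m + 1))) j))
  have hJ : ∀ X, IsCumulative P x X → cumCost c x X = J X := fun X hX =>
    lintegral_eq_iSup_tsum_of_antitoneOn (hX.antitoneOn_cost hP hc)
  have hlsc : LowerSemicontinuous J := by
    refine lowerSemicontinuous_iSup fun m => lowerSemicontinuous_tsum fun i => ?_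
    refine Continuous.lowerSemicontinuous ?_
    refine (ENNReal.continuous_const_mul ENNReal.ofReal_ne_top).comp
      (ENNReal.continuous_ofReal.comp ?_)
    exact continuous_finsetSum _ fun j _ => continuous_const.mul
      (continuous_const.sub ((continuous_apply j).comp (continuous_apply _)))
  have hmem : ∀ X, IsCumulative P x X → ∃ Y ∈ histories P x, cumCost c x Y = cumCost c x X := by
    intro X hX
    have hpos : ∀ t, 0 ≤ t → (if t < 0 then 0 else X t) = X t := fun t ht => if_neg (not_lt.2 ht)
    refine ⟨fun t => if t < 0 then 0 else X t, ⟨⟨?_, fun s t hs hst => ?_, fun t ht => ?_⟩,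
      fun t ht => if_pos ht⟩, setLIntegral_congr_fun measurableSet_Ioi fun t ht => ?_⟩
    · rw [hpos 0 le_rfl, hX.zero]
    · simp only [hpos s hs, hpos t (hs.trans hst)]; exact hX.incr s t hs hst
    · simp only [hpos t ht]; exact hX.le t ht
    · simp only [hpos t (le_of_lt ht)]
  obtain ⟨v, hv⟩ := costSet_nonempty (c := c) hP hx
  obtain ⟨X₀, hX₀, -⟩ := exists_cumCost_eq_of_mem_costSet hP hc hv
  obtain ⟨Y₀, hY₀, -⟩ := hmem X₀ hX₀
  obtain ⟨X, hX, hmin⟩ := (hlsc.lowerSemicontinuousOn _).exists_isMinOn ⟨Y₀, hY₀⟩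
    (isCompact_histories hP hx)
  refine ⟨X, hX.1, le_antisymm ?_ (hX.1.optCost_le hP hc)⟩
  have hle : ∀ v ∈ costSet P c x, cumCost c x X ≤ ENNReal.ofReal v := by
    intro v hv
    obtain ⟨Y, hY, hYv⟩ := exists_cumCost_eq_of_mem_costSet hP hc hv
    obtain ⟨Z, hZ, hZY⟩ := hmem Y hY
    rw [← hYv, ← hZY, hJ X hX.1, hJ Z hZ.1]
    exact hmin hZ
  have hfin : cumCost c x X ≠ ⊤ := ((hle v hv).trans_lt ENNReal.ofReal_lt_top).ne
  rw [← ENNReal.ofReal_toReal hfin]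
  refine ENNReal.ofReal_le_ofReal (le_csInf ⟨v, hv⟩ fun w hw => ?_)
  exact ENNReal.toReal_le_of_le_ofReal (costSet_nonneg hP hc hw) (hle w hw)

end Optimal

/-! ## The optimal cost as a function of the remaining sizes -/

namespace IsCumulative

variable {ι : Type*} {P : Set (ι → ℝ)} {x : ι → ℝ} {X : ℝ → ι → ℝ}

lemma sub_nonneg' (hX : IsCumulative P x X) {t : ℝ} (ht : 0 ≤ t) : 0 ≤ x - X t :=
  sub_nonneg.2 (hX.le t ht)

lemma tail (hX : IsCumulative P x X) {T : ℝ} (hT : 0 ≤ T) :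
    IsCumulative P (x - X T) fun t => X (T + t) - X T where
  zero := by simp
  incr s t hs hst := by
    obtain ⟨p, hp, h⟩ := hX.incr (T + s) (T + t) (by linarith) (by linarith)
    refine ⟨p, hp, ?_⟩
    rw [sub_sub_sub_cancel_right, h, add_sub_add_left_eq_sub]
  le t ht := sub_le_sub_right (hX.le (T + t) (by linarith)) _

end IsCumulative

section OptCost

variable {ι : Type*} [Fintype ι] {P : Set (ι → ℝ)} {x c : ι → ℝ} {X Y : ℝ → ι → ℝ}

namespace IsCumulative

/-- Follow one history until time `T`, then another one. -/
lemma splice (hP : IsRateRegion P) (hX : IsCumulative P x X) {T : ℝ} (hT : 0 ≤ T)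
    (hY : IsCumulative P (x - X T) Y) :
    IsCumulative P x fun t => if t ≤ T then X t else X T + Y (t - T) where
  zero := by simp [hT, hX.zero]
  incr s t hs hst := by
    by_cases htT : t ≤ T
    · simp only [htT, hst.trans htT, if_true]; exact hX.incr s t hs hst
    by_cases hsT : s ≤ T
    · simp only [htT, hsT, if_true, if_false]
      push Not at htT
      obtain ⟨p, hp, hp'⟩ := hX.incr s T hs hsT
      obtain ⟨q, hq, hq'⟩ := hY.incr 0 (t - T) le_rfl (by linarith)
      rw [hY.zero, sub_zero, sub_zero] at hq'
      have hts : 0 < t - s := by linarith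
      -- Across the junction the average rate is the time-weighted mean of the two averages.
      refine ⟨((T - s) / (t - s)) • p + ((t - T) / (t - s)) • q, hP.convex hp hq
        (div_nonneg (by linarith) hts.le) (div_nonneg (by linarith) hts.le)
        (by field_simp; ring), ?_⟩
      rw [smul_add, smul_smul, smul_smul, mul_div_cancel₀ _ hts.ne', mul_div_cancel₀ _ hts.ne',
        ← hp', ← hq']
      abel
    · simp only [htT, hsT, if_false]
      push Not at htT hsT
      obtain ⟨q, hq, hq'⟩ := hY.incr (s - T) (t - T) (by linarith) (by linarith)
      refine ⟨q, hq, ?_⟩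
      rw [add_sub_add_left_eq_sub, hq', sub_sub_sub_cancel_right]
  le t ht := by
    split_ifs with h
    · exact hX.le t ht
    · push Not at h
      have := hY.le (t - T) (by linarith)
      rwa [le_sub_iff_add_le, add_comm] at this

lemma weight_continuousOn (hP : IsRateRegion P) (hX : IsCumulative P x X) :
    ContinuousOn (fun t => ∑ j, c j * (x j - X t j)) (Ici 0) :=
  continuousOn_finsetSum _ fun j _ => continuousOn_const.mul
    (continuousOn_const.sub (continuousOn_pi.1 (hX.continuousOn hP) j))

lemma weight_nonneg (hc : ∀ j, 0 < c j) (hX : IsCumulative P x X) {t : ℝ} (ht : 0 ≤ t) :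
    0 ≤ ∑ j, c j * (x j - X t j) :=
  Finset.sum_nonneg fun j _ => mul_nonneg (hc j).le (hX.sub_nonneg' ht j)

lemma lintegral_weight (hP : IsRateRegion P) (hc : ∀ j, 0 < c j) (hX : IsCumulative P x X)
    {a b : ℝ} (ha : 0 ≤ a) (hab : a ≤ b) :
    ∫⁻ t in Ioc a b, ENNReal.ofReal (∑ j, c j * (x j - X t j)) =
      ENNReal.ofReal (∫ t in a..b, ∑ j, c j * (x j - X t j)) := by
  rw [intervalIntegral.integral_of_le hab, ofReal_integral_eq_lintegral_ofReal]
  · exact ((hX.weight_continuousOn hP).mono fun t ht => ha.trans ht.1).integrableOn_Icc.mono_set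
      Ioc_subset_Icc_self
  · exact (ae_restrict_iff' measurableSet_Ioc).2 (Filter.Eventually.of_forall fun t ht =>
      hX.weight_nonneg hc (ha.trans ht.1.le))

lemma integral_weight_nonneg (hc : ∀ j, 0 < c j) (hX : IsCumulative P x X)
    {a b : ℝ} (ha : 0 ≤ a) (hab : a ≤ b) : 0 ≤ ∫ t in a..b, ∑ j, c j * (x j - X t j) :=
  intervalIntegral.integral_nonneg hab fun _ ht => hX.weight_nonneg hc (ha.trans ht.1)

lemma cumCost_split {T : ℝ} (hT : 0 ≤ T) : cumCost c x X =
    (∫⁻ t in Ioc 0 T, ENNReal.ofReal (∑ j, c j * (x j - X t j))) +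
      ∫⁻ t in Ioi T, ENNReal.ofReal (∑ j, c j * (x j - X t j)) := by
  rw [cumCost, ← Ioc_union_Ioi_eq_Ioi hT, lintegral_union measurableSet_Ioi]
  exact disjoint_left.2 fun t h1 h2 => not_lt.2 h1.2 h2

lemma setLIntegral_Ioi_add (f : ℝ → ENNReal) (T : ℝ) :
    ∫⁻ t in Ioi (0 : ℝ), f (T + t) = ∫⁻ t in Ioi T, f t := by
  have h := (measurePreserving_add_left volume T).setLIntegral_comp_preimage_emb
    (MeasurableEquiv.addLeft T).measurableEmbedding f (Ioi T)
  rw [← h]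
  congr 2
  ext t; simp

lemma optCost_le_tail (hP : IsRateRegion P) (hc : ∀ j, 0 < c j) (hX : IsCumulative P x X)
    {T : ℝ} (hT : 0 ≤ T) : ENNReal.ofReal (optCost P c (x - X T)) ≤
      ∫⁻ t in Ioi T, ENNReal.ofReal (∑ j, c j * (x j - X t j)) := by
  refine ((hX.tail hT).optCost_le hP hc).trans (le_of_eq ?_)
  rw [← setLIntegral_Ioi_add, cumCost]
  simp

/-- Dynamic programming, upper bound. -/
lemma optCost_le_add (hP : IsRateRegion P) (hc : ∀ j, 0 < c j) (hX : IsCumulative P x X)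
    {T : ℝ} (hT : 0 ≤ T) :
    optCost P c x ≤ (∫ t in (0 : ℝ)..T, ∑ j, c j * (x j - X t j)) + optCost P c (x - X T) := by
  obtain ⟨Y, hY, hYc⟩ := exists_optimal hP hc (hX.sub_nonneg' hT)
  have h := (hX.splice hP hT hY).optCost_le hP hc
  rw [cumCost_split hT] at h
  have h1 : ∫⁻ t in Ioc 0 T, ENNReal.ofReal
      (∑ j, c j * (x j - (if t ≤ T then X t else X T + Y (t - T)) j)) =
      ENNReal.ofReal (∫ t in (0 : ℝ)..T, ∑ j, c j * (x j - X t j)) := by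
    rw [← hX.lintegral_weight hP hc le_rfl hT]
    refine setLIntegral_congr_fun measurableSet_Ioc fun t ht => ?_
    simp only [ht.2, if_true]
  have h2 : ∫⁻ t in Ioi T, ENNReal.ofReal
      (∑ j, c j * (x j - (if t ≤ T then X t else X T + Y (t - T)) j)) =
      ENNReal.ofReal (optCost P c (x - X T)) := by
    rw [← hYc, cumCost, ← setLIntegral_Ioi_add]
    refine setLIntegral_congr_fun measurableSet_Ioi fun t ht => ?_
    have : ¬T + t ≤ T := by have := mem_Ioi.1 ht; linarith
    simp only [this, if_false, add_sub_cancel_left, Pi.add_apply, Pi.sub_apply, sub_sub]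
  rw [h1, h2, ← ENNReal.ofReal_add (hX.integral_weight_nonneg hc le_rfl hT)
    (optCost_nonneg hP hc)] at h
  exact (ENNReal.ofReal_le_ofReal_iff (add_nonneg (hX.integral_weight_nonneg hc le_rfl hT)
    (optCost_nonneg hP hc))).1 h

/-- Dynamic programming along an optimal history. -/
lemma optCost_eq_add (hP : IsRateRegion P) (hc : ∀ j, 0 < c j) (hX : IsCumulative P x X)
    (hopt : cumCost c x X = ENNReal.ofReal (optCost P c x)) {T : ℝ} (hT : 0 ≤ T) :
    optCost P c x = (∫ t in (0 : ℝ)..T, ∑ j, c j * (x j - X t j)) + optCost P c (x - X T) := by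
  refine le_antisymm (hX.optCost_le_add hP hc hT) ?_
  rw [cumCost_split hT, hX.lintegral_weight hP hc le_rfl hT] at hopt
  rw [← ENNReal.ofReal_le_ofReal_iff (optCost_nonneg hP hc), ← hopt,
    ENNReal.ofReal_add (hX.integral_weight_nonneg hc le_rfl hT) (optCost_nonneg hP hc)]
  gcongr
  exact hX.optCost_le_tail hP hc hT

end IsCumulative

lemma isCumulative_linear (hP : IsRateRegion P) {z : ι → ℝ} (hz : z ∈ P) {δ : ℝ} (hδ : 0 ≤ δ)
    (hle : δ • z ≤ x) : IsCumulative P x fun t => min t δ • z where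
  zero := by simp [hδ]
  incr s t hs hst := by
    have hmono : min s δ ≤ min t δ := min_le_min_right δ hst
    rcases eq_or_lt_of_le hst with rfl | hlt
    · exact ⟨0, hP.zero_mem, by simp⟩
    have h1 : min t δ - min s δ ≤ t - s := by
      rcases min_cases t δ with h | h <;> rcases min_cases s δ with h' | h' <;> linarith
    have hθ0 : 0 ≤ (min t δ - min s δ) / (t - s) :=
      div_nonneg (by linarith) (by linarith)
    have hθ1 : (min t δ - min s δ) / (t - s) ≤ 1 := (div_le_one (by linarith)).2 h1
    refine ⟨((min t δ - min s δ) / (t - s)) • z, hP.lower z hz _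
      (smul_nonneg hθ0 (hP.nonneg z hz)) (fun j => ?_), ?_⟩
    · exact mul_le_of_le_one_left (hP.nonneg z hz j) hθ1
    · rw [smul_smul, mul_div_cancel₀ _ (sub_pos.2 hlt).ne', sub_smul]
  le t ht j := (mul_le_mul_of_nonneg_right (min_le_right t δ) (hP.nonneg z hz j)).trans (hle j)

/-- Processing for time `δ` saves at most `δ` times the total weight. -/
lemma optCost_le_add_mul (hP : IsRateRegion P) (hc : ∀ j, 0 < c j) {z : ι → ℝ} (hz : z ∈ P)
    {δ : ℝ} (hδ : 0 ≤ δ) (hle : δ • z ≤ x) :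
    optCost P c x ≤ δ * ∑ j, c j * x j + optCost P c (x - δ • z) := by
  have hX := isCumulative_linear hP hz hδ hle
  have h := hX.optCost_le_add hP hc hδ
  simp only [min_self] at h
  refine h.trans (add_le_add ?_ le_rfl)
  have hint : IntervalIntegrable (fun t => ∑ j, c j * (x j - (min t δ • z) j)) volume 0 δ :=
    ((hX.weight_continuousOn hP).mono (by
      rw [uIcc_of_le hδ]; exact Icc_subset_Ici_self)).intervalIntegrable
  refine (intervalIntegral.integral_mono_on hδ hint intervalIntegrable_const fun t ht =>
    Finset.sum_le_sum fun j _ => mul_le_mul_of_nonneg_left (b := _) (c := x j) ?_ (hc j).le).trans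
      (le_of_eq (by rw [intervalIntegral.integral_const, sub_zero, smul_eq_mul]))
  have := mul_nonneg (le_min ht.1 hδ) (hP.nonneg z hz j)
  simp only [Pi.smul_apply, smul_eq_mul]
  linarith

/-- Scale each coordinate of an optimal history for y by x j / y j ≤ 1. If y j = 0 then x j = 0 and
the quotient 0 / 0 = 0 is harmless. -/
lemma optCost_mono (hP : IsRateRegion P) (hc : ∀ j, 0 < c j) {y : ι → ℝ} (hx : 0 ≤ x)
    (hxy : x ≤ y) : optCost P c x ≤ optCost P c y := by
  obtain ⟨Y, hY, hYc⟩ := exists_optimal hP hc (hx.trans hxy)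
  have hr0 : ∀ j, 0 ≤ x j / y j := fun j => div_nonneg (hx j) ((hx j).trans (hxy j))
  have hr1 : ∀ j, x j / y j ≤ 1 := fun j => div_le_one_of_le₀ (hxy j) ((hx j).trans (hxy j))
  have hry : ∀ j, x j / y j * y j = x j := fun j => by
    rcases eq_or_ne (y j) 0 with h | h
    · have h1 := hxy j; have h2 := hx j
      rw [Pi.zero_apply] at h2
      rw [h, mul_zero]; linarith
    · field_simp
  have hX : IsCumulative P x fun t j => x j / y j * Y t j := by
    refine ⟨by ext j; simp [hY.zero], fun s t hs hst => ?_, fun t ht j => ?_⟩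
    · obtain ⟨p, hp, h⟩ := hY.incr s t hs hst
      refine ⟨fun j => x j / y j * p j, hP.lower p hp _ (fun j => mul_nonneg (hr0 j)
        (hP.nonneg p hp j)) (fun j => mul_le_of_le_one_left (hP.nonneg p hp j) (hr1 j)), ?_⟩
      ext j
      have := congrFun h j
      simp only [Pi.sub_apply, Pi.smul_apply, smul_eq_mul] at this ⊢
      rw [← mul_sub, this]; ring
    · calc x j / y j * Y t j ≤ x j / y j * y j :=
          mul_le_mul_of_nonneg_left (hY.le t ht j) (hr0 j)
        _ = x j := hry j
  have h : cumCost c x (fun t j => x j / y j * Y t j) ≤ cumCost c y Y := by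
    refine setLIntegral_mono' measurableSet_Ioi fun t ht => ENNReal.ofReal_le_ofReal
      (Finset.sum_le_sum fun j _ => mul_le_mul_of_nonneg_left ?_ (hc j).le)
    have h1 : x j - x j / y j * Y t j = x j / y j * (y j - Y t j) := by rw [mul_sub, hry]
    rw [h1]
    exact mul_le_of_le_one_left (hY.sub_nonneg' (le_of_lt ht) j) (hr1 j)
  have := (hX.optCost_le hP hc).trans (h.trans hYc.le)
  exact (ENNReal.ofReal_le_ofReal_iff (optCost_nonneg hP hc)).1 this

/-- Convex combinations of optimal histories are histories, and the cost is linear in the pair of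
sizes and history. -/
lemma optCost_convexOn (hP : IsRateRegion P) (hc : ∀ j, 0 < c j) :
    ConvexOn ℝ (Ici 0) (optCost P c) := by
  refine ⟨convex_Ici 0, fun x hx y hy a b ha hb hab => ?_⟩
  obtain ⟨X, hX, hXc⟩ := exists_optimal hP hc hx
  obtain ⟨Y, hY, hYc⟩ := exists_optimal hP hc hy
  have hZ : IsCumulative P (a • x + b • y) fun t => a • X t + b • Y t := by
    refine ⟨by simp [hX.zero, hY.zero], fun s t hs hst => ?_, fun t ht => ?_⟩
    · obtain ⟨p, hp, h⟩ := hX.incr s t hs hst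
      obtain ⟨q, hq, h'⟩ := hY.incr s t hs hst
      refine ⟨a • p + b • q, hP.convex hp hq ha hb hab, ?_⟩
      rw [add_sub_add_comm, ← smul_sub, ← smul_sub, h, h', smul_add, smul_comm a, smul_comm b]
    · exact add_le_add (smul_le_smul_of_nonneg_left (hX.le t ht) ha)
        (smul_le_smul_of_nonneg_left (hY.le t ht) hb)
  have hm : AEMeasurable (fun t => ENNReal.ofReal (∑ j, c j * (x j - X t j)))
      (volume.restrict (Ioi 0)) :=
    (((hX.weight_continuousOn hP).mono Ioi_subset_Ici_self).aemeasurable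
      measurableSet_Ioi).ennreal_ofReal
  have hm' : AEMeasurable (fun t => ENNReal.ofReal (∑ j, c j * (y j - Y t j)))
      (volume.restrict (Ioi 0)) :=
    (((hY.weight_continuousOn hP).mono Ioi_subset_Ici_self).aemeasurable
      measurableSet_Ioi).ennreal_ofReal
  have h : cumCost c (a • x + b • y) (fun t => a • X t + b • Y t) =
      ENNReal.ofReal a * cumCost c x X + ENNReal.ofReal b * cumCost c y Y := by
    rw [cumCost, cumCost, cumCost, ← lintegral_const_mul'' _ hm, ← lintegral_const_mul'' _ hm',
      ← lintegral_add_left' (hm.const_mul _)]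
    refine setLIntegral_congr_fun measurableSet_Ioi fun t ht => ?_
    rw [← ENNReal.ofReal_mul ha, ← ENNReal.ofReal_mul hb, ← ENNReal.ofReal_add
      (mul_nonneg ha (hX.weight_nonneg hc (le_of_lt ht)))
      (mul_nonneg hb (hY.weight_nonneg hc (le_of_lt ht))), Finset.mul_sum, Finset.mul_sum,
      ← Finset.sum_add_distrib]
    congr 1
    refine Finset.sum_congr rfl fun j _ => ?_
    simp only [Pi.add_apply, Pi.smul_apply, smul_eq_mul]
    ring
  have h2 := hZ.optCost_le hP hc
  have h3 : 0 ≤ a * optCost P c x := mul_nonneg ha (optCost_nonneg hP hc)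
  have h4 : 0 ≤ b * optCost P c y := mul_nonneg hb (optCost_nonneg hP hc)
  rw [h, hXc, hYc, ← ENNReal.ofReal_mul ha, ← ENNReal.ofReal_mul hb, ← ENNReal.ofReal_add h3 h4,
    ENNReal.ofReal_le_ofReal_iff (add_nonneg h3 h4)] at h2
  exact h2

/-- The optimal cost, extended to all vectors. -/
noncomputable def extCost (P : Set (ι → ℝ)) (c x : ι → ℝ) : ℝ :=
  optCost P c fun j => max (x j) 0

lemma extCost_of_nonneg (hx : 0 ≤ x) : extCost P c x = optCost P c x := by
  unfold extCost
  congr 1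
  ext j
  exact max_eq_left (hx j)

/-- Taking positive parts is convex and the optimal cost is convex and monotone. -/
lemma extCost_convexOn (hP : IsRateRegion P) (hc : ∀ j, 0 < c j) :
    ConvexOn ℝ univ (extCost P c) := by
  refine ⟨convex_univ, fun x _ y _ a b ha hb hab => ?_⟩
  have h0 : ∀ x : ι → ℝ, (0 : ι → ℝ) ≤ fun j => max (x j) 0 := fun x j => le_max_right _ _
  refine le_trans (optCost_mono hP hc (h0 _) ?_)
    ((optCost_convexOn hP hc).2 (h0 x) (h0 y) ha hb hab)
  intro j
  simp only [Pi.add_apply, Pi.smul_apply, smul_eq_mul]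
  refine max_le (add_le_add (mul_le_mul_of_nonneg_left (le_max_left _ _) ha)
    (mul_le_mul_of_nonneg_left (le_max_left _ _) hb)) (add_nonneg
    (mul_nonneg ha (le_max_right _ _)) (mul_nonneg hb (le_max_right _ _)))

/-- This is the purpose of the extension: a finite convex function on the whole space is locally
Lipschitz, also at points on the boundary of the orthant. -/
lemma extCost_locallyLipschitz (hP : IsRateRegion P) (hc : ∀ j, 0 < c j) :
    LocallyLipschitz (extCost P c) :=
  locallyLipschitzOn_univ.1 ((extCost_convexOn hP hc).locallyLipschitzOn isOpen_univ)

end OptCost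

/-! ## Directional derivatives of the optimal cost -/

lemma ConvexOn.exists_hasDerivWithinAt_ray {ι : Type*} {F : (ι → ℝ) → ℝ} (hF : ConvexOn ℝ univ F)
    (x z : ι → ℝ) : ∃ r, HasDerivWithinAt (fun δ : ℝ => F (x - δ • z)) r (Ici 0) 0 := by
  have h := hF.comp_affineMap (AffineMap.lineMap x (x - z) : ℝ →ᵃ[ℝ] (ι → ℝ))
  have h1 : F ∘ (AffineMap.lineMap x (x - z) : ℝ →ᵃ[ℝ] (ι → ℝ)) = fun δ : ℝ => F (x - δ • z) := by
    ext δ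
    simp only [Function.comp, AffineMap.lineMap_apply, vsub_eq_sub, vadd_eq_add]
    congr 1
    simp only [sub_sub_cancel_left, smul_neg]
    abel
  rw [h1, preimage_univ] at h
  exact ⟨_, hasDerivWithinAt_Ioi_iff_Ici.1
    (h.hasDerivWithinAt_rightDeriv_of_mem_interior (x := 0) (by simp))⟩

section Directional

variable {ι : Type*} [Fintype ι] {P : Set (ι → ℝ)} {x c z : ι → ℝ} {X : ℝ → ι → ℝ}

/-- One-sided directional derivatives of a locally Lipschitz function can be computed along
curves. -/
lemma LocallyLipschitz.tendsto_slope {F : (ι → ℝ) → ℝ} (hF : LocallyLipschitz F) {r : ℝ}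
    (h : HasDerivWithinAt (fun δ : ℝ => F (x - δ • z)) r (Ici 0) 0) {α : Type*} {l : Filter α}
    {δ : α → ℝ} {p : α → ι → ℝ} (hδ : Filter.Tendsto δ l (nhdsWithin 0 (Ioi 0)))
    (hp : Filter.Tendsto p l (nhds z)) :
    Filter.Tendsto (fun a => (F (x - δ a • p a) - F x) / δ a) l (nhds r) := by
  have h0 := (hasDerivWithinAt_iff_tendsto_slope' (by simp)).1 (hasDerivWithinAt_Ioi_iff_Ici.2 h)
  have h1 : Filter.Tendsto (fun a => (F (x - δ a • z) - F x) / δ a) l (nhds r) := by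
    refine (h0.comp hδ).congr fun a => ?_
    simp [slope, div_eq_inv_mul]
  obtain ⟨K, t, ht, hK⟩ := hF x
  have hδ0 : Filter.Tendsto δ l (nhds 0) := hδ.mono_right nhdsWithin_le_nhds
  have hpos : ∀ᶠ a in l, 0 < δ a := hδ self_mem_nhdsWithin
  have hmem : ∀ p : α → ι → ℝ, Filter.Tendsto p l (nhds z) → ∀ᶠ a in l, x - δ a • p a ∈ t := by
    intro p hp
    have : Filter.Tendsto (fun a => x - δ a • p a) l (nhds x) := by
      simpa using tendsto_const_nhds.sub (hδ0.smul hp)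
    exact this ht
  have h2 : Filter.Tendsto (fun a => (F (x - δ a • p a) - F (x - δ a • z)) / δ a) l (nhds 0) := by
    refine squeeze_zero_norm' (a := fun a => K * ‖p a - z‖) ?_ ?_
    · filter_upwards [hpos, hmem p hp, hmem (fun _ => z) tendsto_const_nhds] with a ha h1 h2
      have h3 := hK.dist_le_mul _ h1 _ h2
      rw [Real.dist_eq, dist_eq_norm, sub_sub_sub_cancel_left, ← smul_sub, norm_smul,
        Real.norm_of_nonneg ha.le, norm_sub_rev] at h3
      rw [norm_div, Real.norm_eq_abs, Real.norm_of_nonneg ha.le, div_le_iff₀ ha]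
      linarith
    · have := ((hp.sub_const z).norm).const_mul (K : ℝ)
      simpa using this
  have h3 := h2.add h1
  rw [zero_add] at h3
  refine h3.congr fun a => ?_
  rw [← add_div]
  congr 1
  ring

lemma eventually_sub_smul_nonneg (hx : 0 ≤ x) (hz : ∀ j, x j = 0 → z j = 0) :
    ∀ᶠ δ : ℝ in nhds 0, 0 ≤ x - δ • z := by
  have h : ∀ j, ∀ᶠ δ : ℝ in nhds 0, 0 ≤ x j - δ * z j := by
    intro j
    rcases eq_or_lt_of_le (hx j) with h | h
    · rw [Pi.zero_apply] at h
      exact Filter.Eventually.of_forall fun δ => by rw [hz j h.symm, ← h]; simp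
    · have hcont : Filter.Tendsto (fun δ : ℝ => x j - δ * z j) (nhds 0) (nhds (x j)) := by
        have : Continuous fun δ : ℝ => x j - δ * z j := by fun_prop
        simpa using this.tendsto 0
      exact (hcont.eventually_const_lt h).mono fun _ h => h.le
  filter_upwards [Filter.eventually_all.2 h] with δ hδ j
  exact hδ j

lemma hasDerivWithinAt_optCost_iff (hx : 0 ≤ x) (hz : ∀ j, x j = 0 → z j = 0) {r : ℝ} :
    HasDerivWithinAt (fun δ : ℝ => optCost P c (x - δ • z)) r (Ici 0) 0 ↔
      HasDerivWithinAt (fun δ : ℝ => extCost P c (x - δ • z)) r (Ici 0) 0 := by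
  refine Filter.EventuallyEq.hasDerivWithinAt_iff ?_ ?_
  · exact nhdsWithin_le_nhds ((eventually_sub_smul_nonneg hx hz).mono fun δ h =>
      (extCost_of_nonneg h).symm)
  · rw [extCost_of_nonneg]
    simpa using hx

/-- The optimal cost decreases at most at the rate of the total weight. -/
lemma neg_weight_le_of_hasDerivWithinAt (hP : IsRateRegion P) (hc : ∀ j, 0 < c j) (hx : 0 ≤ x)
    (hzP : z ∈ P) (hz : ∀ j, x j = 0 → z j = 0) {r : ℝ}
    (h : HasDerivWithinAt (fun δ : ℝ => extCost P c (x - δ • z)) r (Ici 0) 0) :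
    -∑ j, c j * x j ≤ r := by
  have h1 := (extCost_locallyLipschitz hP hc).tendsto_slope h (α := ℝ)
    (l := nhdsWithin 0 (Ioi 0)) (δ := id) (p := fun _ => z) Filter.tendsto_id tendsto_const_nhds
  refine ge_of_tendsto h1 ?_
  filter_upwards [self_mem_nhdsWithin,
    nhdsWithin_le_nhds (eventually_sub_smul_nonneg hx hz)] with δ hδ hnn
  have hδ' : (0 : ℝ) < δ := hδ
  rw [id, le_div_iff₀ hδ', extCost_of_nonneg hx, extCost_of_nonneg hnn]
  have := optCost_le_add_mul hP hc hzP hδ'.le (sub_nonneg.1 hnn)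
  linarith

/-- Some admissible direction decreases the optimal cost at the rate of the total weight. -/
lemma exists_steepest (hP : IsRateRegion P) (hc : ∀ j, 0 < c j) (hx : 0 ≤ x) :
    ∃ z ∈ P, (∀ j, x j = 0 → z j = 0) ∧
      HasDerivWithinAt (fun δ : ℝ => extCost P c (x - δ • z)) (-∑ j, c j * x j) (Ici 0) 0 := by
  obtain ⟨X, hX, hXc⟩ := exists_optimal hP hc hx
  have hδpos : ∀ k : ℕ, (0 : ℝ) < 1 / (k + 1) := fun k => by positivity
  choose p hp hXp using fun k : ℕ => hX.incr 0 (1 / ((k : ℝ) + 1)) le_rfl (hδpos k).le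
  simp only [hX.zero, sub_zero] at hXp
  -- The direction is a limit point of the average rates of an optimal history over shrinking
  -- initial intervals.
  obtain ⟨z, hz, φ, hφ, hlim⟩ := hP.isCompact.tendsto_subseq hp
  have hδ0 : Filter.Tendsto (fun k => 1 / ((φ k : ℝ) + 1)) Filter.atTop (nhds 0) :=
    tendsto_one_div_add_atTop_nhds_zero_nat.comp hφ.tendsto_atTop
  have hδ : Filter.Tendsto (fun k => 1 / ((φ k : ℝ) + 1)) Filter.atTop
      (nhdsWithin 0 (Ioi 0)) :=
    tendsto_nhdsWithin_iff.2 ⟨hδ0, Filter.Eventually.of_forall fun k => hδpos _⟩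
  have hzadm : ∀ j, x j = 0 → z j = 0 := by
    intro j hj
    refine tendsto_nhds_unique ((tendsto_pi_nhds.1 hlim) j) (tendsto_const_nhds.congr fun k => ?_)
    have h1 := hX.le _ (hδpos (φ k)).le j
    rw [hXp, hj, Pi.smul_apply, smul_eq_mul] at h1
    have h2 := hP.nonneg _ (hp (φ k)) j
    rw [Pi.zero_apply] at h2
    have h3 := hδpos (φ k)
    have h4 : p (φ k) j ≤ 0 := by
      by_contra! h
      exact absurd h1 (not_le.2 (mul_pos h3 h))
    exact le_antisymm h2 h4
  obtain ⟨r, hr⟩ := (extCost_convexOn hP hc).exists_hasDerivWithinAt_ray x z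
  have hge := neg_weight_le_of_hasDerivWithinAt hP hc hx hz hzadm hr
  have hslope := (extCost_locallyLipschitz hP hc).tendsto_slope hr hδ hlim
  have hupper : Filter.Tendsto (fun k => -∑ j, c j * (x j - X (1 / ((φ k : ℝ) + 1)) j))
      Filter.atTop (nhds (-∑ j, c j * (x j - X 0 j))) := by
    refine ((((hX.weight_continuousOn hP) 0 (mem_Ici.2 le_rfl)).tendsto).comp
      (tendsto_nhdsWithin_iff.2 ⟨hδ0, Filter.Eventually.of_forall fun k => ?_⟩)).neg
    exact (hδpos _).le
  -- By dynamic programming, the optimal history lowers the cost over an initial interval by the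
  -- integral of the weight, which is at least its length times the weight at its end.
  have hle : r ≤ -∑ j, c j * x j := by
    have h0 : -∑ j, c j * (x j - X 0 j) = -∑ j, c j * x j := by simp [hX.zero]
    rw [← h0]
    refine le_of_tendsto_of_tendsto' hslope hupper fun k => ?_
    have hpos := hδpos (φ k)
    simp only [Function.comp]
    rw [← hXp, div_le_iff₀ hpos, extCost_of_nonneg hx, extCost_of_nonneg (hX.sub_nonneg' hpos.le),
      hX.optCost_eq_add hP hc hXc hpos.le]
    have hmono : ∫ t in (0 : ℝ)..1 / ((φ k : ℝ) + 1),
        ∑ j, c j * (x j - X (1 / ((φ k : ℝ) + 1)) j) ≤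
        ∫ t in (0 : ℝ)..1 / ((φ k : ℝ) + 1), ∑ j, c j * (x j - X t j) := by
      refine intervalIntegral.integral_mono_on hpos.le intervalIntegrable_const
        ((hX.weight_continuousOn hP).mono (by
          rw [uIcc_of_le hpos.le]; exact Icc_subset_Ici_self)).intervalIntegrable fun t ht => ?_
      refine Finset.sum_le_sum fun j _ => mul_le_mul_of_nonneg_left ?_ (hc j).le
      have := hX.monotoneOn hP ht.1 hpos.le ht.2 j
      linarith
    rw [intervalIntegral.integral_const, smul_eq_mul, sub_zero] at hmono
    linarith
  refine ⟨z, hz, hzadm, ?_⟩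
  rwa [le_antisymm hle hge] at hr

/-- Along a differentiable curve the optimal cost changes at the rate given by the directional
derivative. -/
lemma hasDerivWithinAt_extCost_comp (hP : IsRateRegion P) (hc : ∀ j, 0 < c j) {A : ℝ → ι → ℝ}
    {t r : ℝ} (hA : HasDerivWithinAt A (-z) (Ici t) t)
    (h : HasDerivWithinAt (fun δ : ℝ => extCost P c (A t - δ • z)) r (Ici 0) 0) :
    HasDerivWithinAt (fun s => extCost P c (A s)) r (Ici t) t := by
  rw [← hasDerivWithinAt_Ioi_iff_Ici, hasDerivWithinAt_iff_tendsto_slope' (by simp)] at hA ⊢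
  have hδ : Filter.Tendsto (fun s => s - t) (nhdsWithin t (Ioi t)) (nhdsWithin 0 (Ioi 0)) := by
    refine tendsto_nhdsWithin_iff.2 ⟨?_, ?_⟩
    · have : Continuous fun s : ℝ => s - t := by fun_prop
      have h := this.tendsto t
      rw [sub_self] at h
      exact h.mono_left nhdsWithin_le_nhds
    · filter_upwards [self_mem_nhdsWithin] with s hs
      exact mem_Ioi.2 (sub_pos.2 (mem_Ioi.1 hs))
  have hp : Filter.Tendsto (fun s => -slope A t s) (nhdsWithin t (Ioi t)) (nhds z) := by
    simpa using hA.neg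
  refine ((extCost_locallyLipschitz hP hc).tendsto_slope h hδ hp).congr' ?_
  filter_upwards [self_mem_nhdsWithin] with s hs
  have hst : s - t ≠ 0 := (sub_pos.2 (mem_Ioi.1 hs)).ne'
  simp only [slope, vsub_eq_sub, smul_eq_mul, div_eq_inv_mul]
  congr 3
  rw [smul_neg, smul_smul, mul_inv_cancel₀ hst, one_smul]
  abel

/-- At almost every time an optimal history moves in a direction of steepest descent. -/
lemma IsCumulative.ae_steepest (hP : IsRateRegion P) (hc : ∀ j, 0 < c j)
    (hX : IsCumulative P x X) (hopt : cumCost c x X = ENNReal.ofReal (optCost P c x)) :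
    ∀ᵐ t, 0 < t → (∀ j, (x - X t) j = 0 → historyRate X t j = 0) ∧
      HasDerivWithinAt (fun δ : ℝ => extCost P c (x - X t - δ • historyRate X t))
        (-∑ j, c j * (x - X t) j) (Ici 0) 0 := by
  filter_upwards [hX.ae_hasDerivAt hP] with t ht h0
  have hd := ht h0
  refine ⟨fun j hj => ?_, ?_⟩
  -- A finished job stays finished: X is constant from t on in this coordinate.
  · have h1 : HasDerivWithinAt (fun s => X s j) (historyRate X t j) (Ici t) t :=
      ((hasDerivAt_pi.1 hd) j).hasDerivWithinAt
    have h2 : HasDerivWithinAt (fun s => X s j) 0 (Ici t) t := by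
      refine (hasDerivWithinAt_const t (Ici t) (X t j)).congr (fun s hs => ?_) rfl
      have h3 := hX.monotoneOn hP h0.le (h0.le.trans hs) hs j
      have h4 := hX.le s (h0.le.trans hs) j
      rw [Pi.sub_apply] at hj
      linarith
    exact (uniqueDiffOn_Ici t t (mem_Ici.2 le_rfl)).eq_deriv _ h1 h2
  · obtain ⟨r, hr⟩ := (extCost_convexOn hP hc).exists_hasDerivWithinAt_ray (x - X t)
      (historyRate X t)
    have h1 : HasDerivWithinAt (fun s => extCost P c (x - X s)) r (Ici t) t :=
      hasDerivWithinAt_extCost_comp hP hc (A := fun s => x - X s)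
        ((hd.const_sub x).hasDerivWithinAt) hr
    have hint : ∀ s, 0 ≤ s → IntervalIntegrable (fun t => ∑ j, c j * (x j - X t j)) volume 0 s :=
      fun s hs => ((hX.weight_continuousOn hP).mono (by
        rw [uIcc_of_le hs]; exact Icc_subset_Ici_self)).intervalIntegrable
    -- Along an optimal history the residual cost is the total minus the integral of the weight, so
    -- its right derivative is minus the current weight.
    have h2 : HasDerivWithinAt (fun s => extCost P c (x - X s)) (-∑ j, c j * (x - X t) j)
        (Ici t) t := by
      have hcont : ContinuousWithinAt (fun t => ∑ j, c j * (x j - X t j)) (Ici t) t :=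
        ((hX.weight_continuousOn hP) t h0.le).mono (Ici_subset_Ici.2 h0.le)
      have hder := intervalIntegral.integral_hasDerivWithinAt_right (hint t h0.le)
        (s := Ici t) (t := Ioi t)
        (((hX.weight_continuousOn hP).mono
          (Ici_subset_Ici.2 h0.le)).stronglyMeasurableAtFilter_nhdsWithin measurableSet_Ici t
          |>.filter_mono (nhdsWithin_mono t Ioi_subset_Ici_self))
        (hcont.mono Ioi_subset_Ici_self)
      refine ((hder.const_sub (optCost P c x))).congr (fun s hs => ?_) ?_
      · have hs0 : 0 ≤ s := h0.le.trans hs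
        rw [extCost_of_nonneg (hX.sub_nonneg' hs0), hX.optCost_eq_add hP hc hopt hs0]
        ring
      · rw [extCost_of_nonneg (hX.sub_nonneg' h0.le), hX.optCost_eq_add hP hc hopt h0.le]
        ring
    rw [(uniqueDiffOn_Ici t t (mem_Ici.2 le_rfl)).eq_deriv _ h1 h2] at hr
    exact hr

end Directional

/-! ## Supermodularity of the optimal cost -/

section Supermodular

variable {ι : Type*} [Fintype ι] {P : Set (ι → ℝ)} {c : ι → ℝ}

/-- Separate the open strict epigraph from the point (x, F x). The functional is negative in the
vertical direction, so it can be normalized to a slope. -/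
lemma ConvexOn.exists_subgradient {F : (ι → ℝ) → ℝ} (hF : ConvexOn ℝ univ F) (x : ι → ℝ) :
    ∃ a : ι → ℝ, ∀ y, F x + ∑ j, a j * (y j - x j) ≤ F y := by
  classical
  have hcont : Continuous F := continuousOn_univ.1 (hF.continuousOn isOpen_univ)
  have hconv : Convex ℝ {p : (ι → ℝ) × ℝ | F p.1 < p.2} := by
    simpa using hF.convex_strict_epigraph
  have hopen : IsOpen {p : (ι → ℝ) × ℝ | F p.1 < p.2} :=
    isOpen_lt (hcont.comp continuous_fst) continuous_snd
  obtain ⟨f, hf⟩ := geometric_hahn_banach_open_point hconv hopen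
    (show (x, F x) ∉ {p : (ι → ℝ) × ℝ | F p.1 < p.2} from fun h => lt_irrefl (F x) h)
  have hsplit : ∀ (y : ι → ℝ) (r : ℝ), f (y, r) = f (y, 0) + r * f (0, 1) := fun y r => by
    rw [← smul_eq_mul, ← map_smul, ← map_add]; simp
  have hκ : f (0, 1) < 0 := by
    have h := hf (x, F x + 1) (show F x < F x + 1 by linarith)
    rw [hsplit, hsplit x (F x)] at h
    linarith
  have hlin : ∀ y : ι → ℝ, f (y, 0) = ∑ j, y j * f (Pi.single j 1, 0) := by
    intro y
    have h := LinearMap.pi_apply_eq_sum_univ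
      (f.toLinearMap.comp (LinearMap.inl ℝ (ι → ℝ) ℝ)) y
    have hs : ∀ d : ι, (fun j => if d = j then (1 : ℝ) else 0) = Pi.single d 1 := fun d => by
      ext j; simp [Pi.single_apply, eq_comm]
    simpa [hs] using h
  refine ⟨fun j => f (Pi.single j 1, 0) / (-f (0, 1)), fun y => ?_⟩
  have h1 : f (y, 0) + F y * f (0, 1) ≤ f (x, 0) + F x * f (0, 1) := by
    by_contra! hcon
    set e := (f (y, 0) + F y * f (0, 1) - (f (x, 0) + F x * f (0, 1))) / (-f (0, 1)) with he
    have hepos : 0 < e := div_pos (by linarith) (by linarith)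
    have h := hf (y, F y + e) (show F y < F y + e by linarith)
    rw [hsplit, hsplit x] at h
    have : e * (-f (0, 1)) = f (y, 0) + F y * f (0, 1) - (f (x, 0) + F x * f (0, 1)) := by
      rw [he]; field_simp [hκ.ne]
    nlinarith
  have h2 : ∑ j, f (Pi.single j 1, 0) / (-f (0, 1)) * (y j - x j) =
      (f (y, 0) - f (x, 0)) / (-f (0, 1)) := by
    rw [hlin y, hlin x, ← Finset.sum_sub_distrib, Finset.sum_div]
    exact Finset.sum_congr rfl fun j _ => by ring
  rw [h2, ← le_sub_iff_add_le', div_le_iff₀ (by linarith)]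
  nlinarith

/-- The support function of the rate region. -/
noncomputable def maxRate (P : Set (ι → ℝ)) (b : ι → ℝ) : ℝ := sSup ((fun z => ∑ j, b j * z j) '' P)

lemma IsRateRegion.exists_maxRate (hP : IsRateRegion P) (b : ι → ℝ) :
    ∃ z ∈ P, ∑ j, b j * z j = maxRate P b :=
  (hP.isCompact.image (f := fun z => ∑ j, b j * z j) (by fun_prop)).sSup_mem
    (Nonempty.image (fun z => ∑ j, b j * z j) ⟨0, hP.zero_mem⟩)

lemma IsRateRegion.le_maxRate (hP : IsRateRegion P) (b : ι → ℝ) {z : ι → ℝ} (hz : z ∈ P) :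
    ∑ j, b j * z j ≤ maxRate P b :=
  le_csSup (hP.isCompact.image (f := fun z => ∑ j, b j * z j) (by fun_prop)).bddAbove
    (mem_image_of_mem _ hz)

lemma IsRateRegion.maxRate_mono (hP : IsRateRegion P) {b b' : ι → ℝ} (h : b ≤ b') :
    maxRate P b ≤ maxRate P b' := by
  obtain ⟨z, hz, hzb⟩ := hP.exists_maxRate b
  rw [← hzb]
  exact (Finset.sum_le_sum fun j _ => mul_le_mul_of_nonneg_right (h j) (hP.nonneg z hz j)).trans
    (hP.le_maxRate b' hz)

/-- The dual weights of the jobs at time `t`. -/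
def dualWeight (a c : ι → ℝ) (t : ℝ) : ι → ℝ := fun j => max (a j - c j * t) 0

lemma antitone_maxRate_dualWeight (hP : IsRateRegion P) (hc : ∀ j, 0 < c j) (a : ι → ℝ) :
    Antitone fun t => maxRate P (dualWeight a c t) := fun s t hst =>
  hP.maxRate_mono fun j => max_le_max (by nlinarith [hc j]) le_rfl

/-- Stopping the jobs of nonpositive reduced weight loses nothing, and then the truncation at 0 can
be dropped. -/
lemma IsRateRegion.exists_maxRate_dualWeight (hP : IsRateRegion P) (a c : ι → ℝ) (t : ℝ) :
    ∃ z ∈ P, maxRate P (dualWeight a c t) = ∑ j, (a j - c j * t) * z j := by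
  obtain ⟨z, hz, hzb⟩ := hP.exists_maxRate (dualWeight a c t)
  refine ⟨fun j => if a j - c j * t ≤ 0 then 0 else z j, hP.lower z hz _ (fun j => ?_)
    (fun j => ?_), ?_⟩
  · dsimp only; split_ifs
    · exact le_rfl
    · exact hP.nonneg z hz j
  · dsimp only; split_ifs
    · exact hP.nonneg z hz j
    · exact le_rfl
  · rw [← hzb]
    refine Finset.sum_congr rfl fun j _ => ?_
    simp only [dualWeight]
    split_ifs with h
    · rw [max_eq_right h]; ring
    · rw [max_eq_left (not_le.1 h).le]

/-- Weak duality. -/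
lemma le_optCost_of_dual (hP : IsRateRegion P) (hc : ∀ j, 0 < c j) {y : ι → ℝ} (hy : 0 ≤ y)
    (a : ι → ℝ) {T : ℝ} (hT : 0 ≤ T) (haT : ∀ j, a j ≤ c j * T) :
    ∑ j, a j * y j - ∫ t in (0 : ℝ)..T, maxRate P (dualWeight a c t) ≤ optCost P c y := by
  refine le_csInf (costSet_nonempty hP hy) ?_
  rintro _ ⟨z, hz, hzP, hi, hi2, hx, rfl⟩
  have hint : ∀ j, IntegrableOn (fun t => (a j - c j * t) * z t j) (Ioi 0) := fun j => by
    have := ((hi j).const_mul (a j)).sub ((hi2 j).const_mul (c j))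
    refine this.congr (Filter.Eventually.of_forall fun t => ?_)
    simp only [Pi.sub_apply]; ring
  have h1 : ∑ j, a j * y j - ∑ j, c j * ∫ t in Ioi (0 : ℝ), t * z t j =
      ∫ t in Ioi (0 : ℝ), ∑ j, (a j - c j * t) * z t j := by
    rw [integral_finsetSum _ fun j _ => hint j, ← Finset.sum_sub_distrib]
    refine Finset.sum_congr rfl fun j _ => ?_
    rw [← hx j, ← integral_const_mul, ← integral_const_mul,
      ← integral_sub ((hi j).const_mul _) ((hi2 j).const_mul _)]
    congr 1; ext t; ring
  have hW : IntegrableOn (fun t => maxRate P (dualWeight a c t)) (Ioc 0 T) := by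
    have := (antitone_maxRate_dualWeight hP hc a).antitoneOn (uIcc 0 T)
      |>.intervalIntegrable (μ := volume)
    rwa [intervalIntegrable_iff, uIoc_of_le hT] at this
  -- After T all reduced weights `a j - c j * t` are nonpositive, so only (0,T] can contribute.
  have h2 : ∫ t in Ioi (0 : ℝ), ∑ j, (a j - c j * t) * z t j ≤
      ∫ t in Ioi (0 : ℝ), (Ioc 0 T).indicator (fun t => maxRate P (dualWeight a c t)) t := by
    refine setIntegral_mono_on (integrable_finsetSum _ fun j _ => hint j)
      ((integrable_indicator_iff measurableSet_Ioc).2 hW).integrableOn measurableSet_Ioi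
      fun t ht => ?_
    by_cases htT : t ≤ T
    · rw [indicator_of_mem (show t ∈ Ioc 0 T from ⟨ht, htT⟩)]
      refine le_trans (Finset.sum_le_sum fun j _ => ?_) (hP.le_maxRate _ (hzP t))
      exact mul_le_mul_of_nonneg_right (le_max_left _ _) (hP.nonneg _ (hzP t) j)
    · rw [indicator_of_notMem (fun h => htT h.2)]
      refine Finset.sum_nonpos fun j _ => mul_nonpos_of_nonpos_of_nonneg ?_
        (hP.nonneg _ (hzP t) j)
      nlinarith [hc j, haT j]
  rw [setIntegral_indicator measurableSet_Ioc, inter_eq_right.2 Ioc_subset_Ioi_self,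
    ← intervalIntegral.integral_of_le hT] at h2
  linarith

/-- Strong duality: a subgradient is an optimal dual solution. -/
lemma integral_maxRate_le_of_subgradient (hP : IsRateRegion P) (hc : ∀ j, 0 < c j)
    {x a : ι → ℝ} (ha : ∀ y, extCost P c x + ∑ j, a j * (y j - x j) ≤ extCost P c y) {T : ℝ}
    (hT : 0 ≤ T) :
    ∫ t in (0 : ℝ)..T, maxRate P (dualWeight a c t) ≤ ∑ j, a j * x j - extCost P c x := by
  obtain ⟨M, hM⟩ := hP.exists_bound
  have hC : 0 ≤ ∑ j, c j * M := Finset.sum_nonneg fun j _ => mul_nonneg (hc j).le M.2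
  set C := ∑ j, c j * (M : ℝ) with hCdef
  refine le_of_forall_pos_le_add fun e he => ?_
  -- Grid width. Over a time δ the value of a fixed rate vector falls by at most δ C, for a total
  -- loss of at most e; the added 1 covers T * C = 0.
  set δ := e / (T * C + 1) with hδdef
  have hden : 0 < T * C + 1 := by positivity
  have hδ : 0 < δ := div_pos he hden
  have hδe : T * (δ * C) ≤ e := by
    have : δ * (T * C + 1) = e := by rw [hδdef]; field_simp
    nlinarith
  -- The schedule maximizing the reduced weight shows tightness. Maximizers are chosen only at grid
  -- times and kept in between, which makes measurability immediate. The subgradient inequality is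
  -- then applied at the amounts y that this schedule processes.
  choose Z hZ hZW using fun k : ℕ => hP.exists_maxRate_dualWeight a c (k * δ)
  let z : ℝ → ι → ℝ := fun t j => (Ioc 0 T).indicator (fun t => Z ⌊t / δ⌋₊ j) t
  have hzt : ∀ t ∈ Ioc 0 T, z t = Z ⌊t / δ⌋₊ := fun t ht => by
    ext j; exact indicator_of_mem ht _
  have hz0 : ∀ t ∉ Ioc 0 T, z t = 0 := fun t ht => by
    ext j; exact indicator_of_notMem ht _
  have hzP : ∀ t, z t ∈ P := fun t => by
    by_cases ht : t ∈ Ioc 0 T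
    · rw [hzt t ht]; exact hZ _
    · rw [hz0 t ht]; exact hP.zero_mem
  have hzm' : ∀ j, Measurable fun t : ℝ => Z ⌊t / δ⌋₊ j := fun j =>
    (measurable_from_nat (f := fun k => Z k j)).comp
      (Nat.measurable_floor.comp (measurable_id.div_const δ))
  have hzm : ∀ j, Measurable fun t => z t j := fun j => (hzm' j).indicator measurableSet_Ioc
  have hvol : volume (Ioc 0 T) ≠ ⊤ := by simp
  have hbd : ∀ t j, ‖Z ⌊t / δ⌋₊ j‖ ≤ M := fun t j => by
    rw [Real.norm_of_nonneg (hP.nonneg _ (hZ _) j)]; exact hM _ (hZ _) j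
  have hi0 : ∀ j, IntegrableOn (fun t => Z ⌊t / δ⌋₊ j) (Ioc 0 T) := fun j =>
    Measure.integrableOn_of_bounded (M := M) hvol (hzm' j).aestronglyMeasurable
      (Filter.Eventually.of_forall fun t => hbd t j)
  have hi : ∀ j, IntegrableOn (fun t => z t j) (Ioi 0) := fun j =>
    ((integrable_indicator_iff measurableSet_Ioc).2 (hi0 j)).integrableOn
  have hi2 : ∀ j, IntegrableOn (fun t => t * z t j) (Ioi 0) := fun j => by
    have : (fun t => t * z t j) = (Ioc 0 T).indicator fun t => t * Z ⌊t / δ⌋₊ j := by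
      ext t; simp only [z, indicator]; split_ifs <;> simp
    rw [this]
    refine ((integrable_indicator_iff measurableSet_Ioc).2 ?_).integrableOn
    refine Measure.integrableOn_of_bounded (M := T * M) hvol
      (measurable_id.mul (hzm' j)).aestronglyMeasurable
      ((ae_restrict_iff' measurableSet_Ioc).2 (Filter.Eventually.of_forall fun t ht => ?_))
    rw [norm_mul, Real.norm_of_nonneg ht.1.le]
    exact mul_le_mul ht.2 (hbd t j) (norm_nonneg _) hT
  set y : ι → ℝ := fun j => ∫ t in Ioi (0 : ℝ), z t j with hy
  have hy0 : 0 ≤ y := fun j => setIntegral_nonneg measurableSet_Ioi fun t _ =>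
    hP.nonneg _ (hzP t) j
  have hopt := optCost_le_of_mem hP hc (x := y) ⟨z, hzm, hzP, hi, hi2, fun j => rfl, rfl⟩
  have hsub := ha y
  rw [extCost_of_nonneg hy0] at hsub
  have hint : ∀ j, IntegrableOn (fun t => (a j - c j * t) * z t j) (Ioi 0) := fun j => by
    have := ((hi j).const_mul (a j)).sub ((hi2 j).const_mul (c j))
    refine this.congr (Filter.Eventually.of_forall fun t => ?_)
    simp only [Pi.sub_apply]; ring
  have h1 : ∑ j, a j * y j - ∑ j, c j * ∫ t in Ioi (0 : ℝ), t * z t j =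
      ∫ t in Ioi (0 : ℝ), ∑ j, (a j - c j * t) * z t j := by
    rw [integral_finsetSum _ fun j _ => hint j, ← Finset.sum_sub_distrib]
    refine Finset.sum_congr rfl fun j _ => ?_
    rw [hy, ← integral_const_mul, ← integral_const_mul,
      ← integral_sub ((hi j).const_mul _) ((hi2 j).const_mul _)]
    congr 1; ext t; ring
  have hW : IntegrableOn (fun t => maxRate P (dualWeight a c t)) (Ioc 0 T) := by
    have := (antitone_maxRate_dualWeight hP hc a).antitoneOn (uIcc 0 T)
      |>.intervalIntegrable (μ := volume)
    rwa [intervalIntegrable_iff, uIoc_of_le hT] at this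
  have h2 : ∫ t in Ioi (0 : ℝ), (Ioc 0 T).indicator
        (fun t => maxRate P (dualWeight a c t) - δ * C) t ≤
      ∫ t in Ioi (0 : ℝ), ∑ j, (a j - c j * t) * z t j := by
    refine setIntegral_mono_on ((integrable_indicator_iff measurableSet_Ioc).2
      (hW.sub (integrableOn_const hvol))).integrableOn
      (integrable_finsetSum _ fun j _ => hint j) measurableSet_Ioi fun t ht => ?_
    by_cases htT : t ∈ Ioc 0 T
    · rw [indicator_of_mem htT, hzt t htT]
      set k := ⌊t / δ⌋₊ with hk
      have hk1 : k * δ ≤ t := by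
        rw [← le_div_iff₀ hδ]; exact Nat.floor_le (div_nonneg htT.1.le hδ.le)
      have hk2 : t ≤ k * δ + δ := by
        have := (Nat.lt_floor_add_one (t / δ)).le
        rw [div_le_iff₀ hδ] at this
        linarith
      have h3 := antitone_maxRate_dualWeight hP hc a hk1
      simp only at h3
      rw [hZW k] at h3
      have h4 : ∑ j, (a j - c j * t) * Z k j = ∑ j, (a j - c j * (k * δ)) * Z k j -
          (t - k * δ) * ∑ j, c j * Z k j := by
        rw [Finset.mul_sum, ← Finset.sum_sub_distrib]
        exact Finset.sum_congr rfl fun j _ => by ring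
      have h5 : ∑ j, c j * Z k j ≤ C := Finset.sum_le_sum fun j _ =>
        mul_le_mul_of_nonneg_left (hM _ (hZ k) j) (hc j).le
      have h6 : (t - k * δ) * ∑ j, c j * Z k j ≤ δ * C :=
        mul_le_mul (by linarith) h5 (Finset.sum_nonneg fun j _ =>
          mul_nonneg (hc j).le (hP.nonneg _ (hZ k) j)) hδ.le
      linarith
    · rw [indicator_of_notMem htT, hz0 t htT]
      simp
  rw [setIntegral_indicator measurableSet_Ioc, inter_eq_right.2 Ioc_subset_Ioi_self,
    integral_sub hW (integrableOn_const hvol), setIntegral_const, measureReal_def, Real.volume_Ioc,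
    sub_zero, ENNReal.toReal_ofReal hT, smul_eq_mul, ← intervalIntegral.integral_of_le hT] at h2
  simp only [mul_sub, Finset.sum_sub_distrib] at hsub
  linarith

/-- The optimal cost is supermodular. -/
theorem optCost_supermodular (hP : IsRateRegion P) (hc : ∀ j, 0 < c j) {x y : ι → ℝ}
    (hx : 0 ≤ x) (hy : 0 ≤ y) :
    optCost P c x + optCost P c y ≤ optCost P c (x ⊔ y) + optCost P c (x ⊓ y) := by
  -- The subgradients a and b are optimal dual solutions for x and y; a ⊔ b and a ⊓ b will serve as
  -- feasible ones for x ⊔ y and x ⊓ y.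
  obtain ⟨a, ha⟩ := (extCost_convexOn hP hc).exists_subgradient x
  obtain ⟨b, hb⟩ := (extCost_convexOn hP hc).exists_subgradient y
  obtain ⟨T, hT, haT, hbT⟩ : ∃ T : ℝ, 0 ≤ T ∧ (∀ j, a j ≤ c j * T) ∧ ∀ j, b j ≤ c j * T := by
    have h0 : ∀ j, 0 ≤ max (|a j| / c j) (|b j| / c j) := fun j =>
      le_max_of_le_left (div_nonneg (abs_nonneg _) (hc j).le)
    have hle : ∀ j, max (|a j| / c j) (|b j| / c j) ≤
        ∑ j, max (|a j| / c j) (|b j| / c j) := fun j =>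
      Finset.single_le_sum (f := fun j => max (|a j| / c j) (|b j| / c j)) (fun j _ => h0 j)
        (Finset.mem_univ j)
    refine ⟨∑ j, max (|a j| / c j) (|b j| / c j), Finset.sum_nonneg fun j _ => h0 j,
      fun j => ?_, fun j => ?_⟩
    · have := (le_max_left _ _).trans (hle j)
      rw [div_le_iff₀ (hc j)] at this
      linarith [le_abs_self (a j)]
    · have := (le_max_right _ _).trans (hle j)
      rw [div_le_iff₀ (hc j)] at this
      linarith [le_abs_self (b j)]
  have h1 := integral_maxRate_le_of_subgradient hP hc ha hT
  have h2 := integral_maxRate_le_of_subgradient hP hc hb hT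
  have h3 := le_optCost_of_dual hP hc (hx.trans (le_sup_left (b := y))) (a ⊔ b) hT
    fun j => max_le (haT j) (hbT j)
  have h4 := le_optCost_of_dual hP hc (le_inf hx hy) (a ⊓ b) hT
    fun j => (min_le_left _ _).trans (haT j)
  have hint : ∀ a : ι → ℝ, IntervalIntegrable (fun t => maxRate P (dualWeight a c t))
      volume 0 T := fun a => (antitone_maxRate_dualWeight hP hc a).intervalIntegrable
  -- Truncated dual weights commute with max and min, so submodularity of the support function
  -- applies at each time.
  have h5 : (∫ t in (0 : ℝ)..T, maxRate P (dualWeight (a ⊔ b) c t)) +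
      (∫ t in (0 : ℝ)..T, maxRate P (dualWeight (a ⊓ b) c t)) ≤
      (∫ t in (0 : ℝ)..T, maxRate P (dualWeight a c t)) +
      ∫ t in (0 : ℝ)..T, maxRate P (dualWeight b c t) := by
    rw [← intervalIntegral.integral_add (hint _) (hint _),
      ← intervalIntegral.integral_add (hint _) (hint _)]
    refine intervalIntegral.integral_mono_on hT ((hint _).add (hint _)) ((hint _).add (hint _))
      fun t _ => ?_
    obtain ⟨z, hz, hzW⟩ := hP.exists_maxRate (dualWeight (a ⊔ b) c t)
    obtain ⟨z', hz', hzW'⟩ := hP.exists_maxRate (dualWeight (a ⊓ b) c t)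
    obtain ⟨v, hv, v', hv', hvv⟩ := hP.submodular (dualWeight a c t) (dualWeight b c t)
      (fun j => le_max_right _ _) (fun j => le_max_right _ _) z hz z' hz'
    have e1 : ∀ j, dualWeight (a ⊔ b) c t j = max (dualWeight a c t j) (dualWeight b c t j) :=
      fun j => by
        simp only [dualWeight, Pi.sup_apply]
        rw [← max_sub_sub_right, max_max_max_comm, max_self]
    have e2 : ∀ j, dualWeight (a ⊓ b) c t j = min (dualWeight a c t j) (dualWeight b c t j) :=
      fun j => by
        simp only [dualWeight, Pi.inf_apply]
        rw [← min_sub_sub_right, max_min_distrib_right]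
    rw [← hzW, ← hzW']
    simp only [e1, e2]
    exact hvv.trans (add_le_add (hP.le_maxRate _ hv) (hP.le_maxRate _ hv'))
  -- Rearrangement: pairing the larger multiplier with the larger size can only increase the sum.
  have h6 : ∑ j, (a ⊔ b) j * (x ⊔ y) j + ∑ j, (a ⊓ b) j * (x ⊓ y) j ≥
      ∑ j, a j * x j + ∑ j, b j * y j := by
    rw [← Finset.sum_add_distrib, ← Finset.sum_add_distrib]
    refine Finset.sum_le_sum fun j _ => ?_
    simp only [Pi.sup_apply, Pi.inf_apply]
    rcases le_total (a j) (b j) with h | h <;> rcases le_total (x j) (y j) with h' | h' <;>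
      simp only [h, h', sup_of_le_left, sup_of_le_right, inf_of_le_left, inf_of_le_right] <;>
      nlinarith
  rw [extCost_of_nonneg hx] at h1
  rw [extCost_of_nonneg hy] at h2
  linarith

end Supermodular

/-! ## Two copies of every job -/

/-- `P₂` is the rate region of two copies of each of the jobs with rate region `P`. -/
structure IsDoubleRegion {ι : Type*} [Fintype ι] (P : Set (ι → ℝ)) (P₂ : Set (ι ⊕ ι → ℝ)) :
    Prop where
  region : IsRateRegion P₂
  inl_mem : ∀ p ∈ P, Sum.elim p (0 : ι → ℝ) ∈ P₂
  inr_mem : ∀ p ∈ P, Sum.elim (0 : ι → ℝ) p ∈ P₂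
  -- One copy must be idle: by concavity two active copies can together exceed the rate of a single
  -- job with their combined resources.
  merge : ∀ p ∈ P₂, (∀ j, p (Sum.inl j) = 0 ∨ p (Sum.inr j) = 0) →
    (fun j => p (Sum.inl j) + p (Sum.inr j)) ∈ P

lemma isDoubleRegion_rateSet {ι : Type*} [Fintype ι] {D : ℕ} (U : ι → SpeedUpUtility D)
    (h0 : ∀ j, 0 ≤ (U j).eval 0) (h1 : ∀ j, 0 < (U j).eval 1) :
    IsDoubleRegion (rateSet U) (rateSet (Sum.elim U U)) where
  region := isRateRegion_rateSet _ (by rintro (j | j) <;> exact h0 j)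
    (by rintro (j | j) <;> exact h1 j)
  inl_mem := by
    rintro p ⟨x, hx0, hx1, hxp⟩
    refine ⟨Sum.elim x 0, ?_, fun d => ?_, ?_⟩
    · rintro (j | j) d
      · exact hx0 j d
      · exact le_rfl
    · simpa using hx1 d
    · rintro (j | j)
      · exact hxp j
      · exact ⟨le_rfl, h0 j⟩
  inr_mem := by
    rintro p ⟨x, hx0, hx1, hxp⟩
    refine ⟨Sum.elim 0 x, ?_, fun d => ?_, ?_⟩
    · rintro (j | j) d
      · exact le_rfl
      · exact hx0 j d
    · simpa using hx1 d
    · rintro (j | j)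
      · exact ⟨le_rfl, h0 j⟩
      · exact hxp j
  merge := by
    rintro p ⟨x, hx0, hx1, hxp⟩ hp
    refine ⟨fun j => if p (Sum.inl j) = 0 then x (Sum.inr j) else x (Sum.inl j), fun j d => ?_,
      fun d => ?_, fun j => ?_⟩
    · dsimp only; split_ifs
      · exact hx0 _ d
      · exact hx0 _ d
    · refine le_trans ?_ (hx1 d)
      rw [Fintype.sum_sum_type, ← Finset.sum_add_distrib]
      refine Finset.sum_le_sum fun j _ => ?_
      dsimp only
      split_ifs
      · linarith [hx0 (Sum.inl j) d]
      · linarith [hx0 (Sum.inr j) d]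
    · dsimp only; split_ifs with h
      · rw [h, zero_add]; exact hxp (Sum.inr j)
      · rw [(hp j).resolve_left h, add_zero]; exact hxp (Sum.inl j)

lemma Sum.elim_pos {ι κ : Type*} {c : ι → ℝ} {d : κ → ℝ} (hc : ∀ j, 0 < c j)
    (hd : ∀ j, 0 < d j) : ∀ j, 0 < Sum.elim c d j := by
  rintro (j | j)
  · exact hc j
  · exact hd j

lemma Sum.elim_nonneg {ι κ : Type*} {v : ι → ℝ} {w : κ → ℝ} (hv : 0 ≤ v) (hw : 0 ≤ w) :
    0 ≤ Sum.elim v w := by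
  rintro (j | j)
  · exact hv j
  · exact hw j

namespace IsDoubleRegion

variable {ι : Type*} [Fintype ι] {P : Set (ι → ℝ)} {P₂ : Set (ι ⊕ ι → ℝ)} {c v w : ι → ℝ}

lemma convex_comb_mem (hD : IsDoubleRegion P P₂) {p q : ι → ℝ} (hp : p ∈ P) (hq : q ∈ P)
    {a b : ℝ} (ha : 0 ≤ a) (hb : 0 ≤ b) (hab : a + b = 1) : Sum.elim (a • p) (b • q) ∈ P₂ := by
  have h := hD.region.convex (hD.inl_mem p hp) (hD.inr_mem q hq) ha hb hab
  convert h using 1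
  ext (j | j) <;> simp

/-- Two copies of which one is void are as good as a single job. -/
lemma optCost_add_le (hD : IsDoubleRegion P P₂) (hP : IsRateRegion P) (hc : ∀ j, 0 < c j)
    (hv : 0 ≤ v) (hw : 0 ≤ w) (hvw : ∀ j, v j = 0 ∨ w j = 0) :
    optCost P c (v + w) ≤ optCost P₂ (Sum.elim c c) (Sum.elim v w) := by
  obtain ⟨X, hX, hXc⟩ := exists_optimal hD.region (Sum.elim_pos hc hc) (Sum.elim_nonneg hv hw)
  have hzero : ∀ i, (Sum.elim v w) i = 0 → ∀ t, 0 ≤ t → X t i = 0 := fun i hi t ht =>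
    le_antisymm (hi ▸ hX.le t ht i) (hX.nonneg hD.region ht i)
  have hY : IsCumulative P (v + w) fun t j => X t (Sum.inl j) + X t (Sum.inr j) := by
    refine ⟨by ext j; simp [hX.zero], fun s t hs hst => ?_, fun t ht j =>
      add_le_add (hX.le t ht (Sum.inl j)) (hX.le t ht (Sum.inr j))⟩
    rcases eq_or_lt_of_le hst with rfl | hlt
    · exact ⟨0, hP.zero_mem, by simp⟩
    obtain ⟨p, hp, h⟩ := hX.incr s t hs hst
    -- A copy of size zero is never processed, so one copy of every job is idle and `merge` applies.
    have hp0 : ∀ i, (Sum.elim v w) i = 0 → p i = 0 := fun i hi => by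
      have h1 := congrFun h i
      rw [Pi.sub_apply, hzero i hi t (hs.trans hst), hzero i hi s hs, sub_zero, Pi.smul_apply,
        smul_eq_mul, eq_comm, mul_eq_zero] at h1
      exact h1.resolve_left (sub_pos.2 hlt).ne'
    refine ⟨_, hD.merge p hp fun j => (hvw j).imp (hp0 (Sum.inl j)) (hp0 (Sum.inr j)), ?_⟩
    ext j
    have h1 := congrFun h (Sum.inl j)
    have h2 := congrFun h (Sum.inr j)
    simp only [Pi.sub_apply, Pi.smul_apply, smul_eq_mul] at h1 h2 ⊢
    linarith
  have h := hY.optCost_le hP hc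
  have heq : cumCost c (v + w) (fun t j => X t (Sum.inl j) + X t (Sum.inr j)) =
      cumCost (Sum.elim c c) (Sum.elim v w) X := by
    refine lintegral_congr fun t => ?_
    congr 1
    rw [Fintype.sum_sum_type, ← Finset.sum_add_distrib]
    refine Finset.sum_congr rfl fun j _ => ?_
    simp only [Pi.add_apply, Sum.elim_inl, Sum.elim_inr]
    ring
  rw [heq, hXc] at h
  exact (ENNReal.ofReal_le_ofReal_iff (optCost_nonneg hD.region (Sum.elim_pos hc hc))).1 h

lemma optCost_elim_zero_le (hD : IsDoubleRegion P P₂) (hc : ∀ j, 0 < c j)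
    (hP : IsRateRegion P) (hv : 0 ≤ v) :
    optCost P₂ (Sum.elim c c) (Sum.elim v 0) ≤ optCost P c v := by
  obtain ⟨X, hX, hXc⟩ := exists_optimal hP hc hv
  have hY : IsCumulative P₂ (Sum.elim v 0) fun t => Sum.elim (X t) 0 := by
    refine ⟨by ext (j | j) <;> simp [hX.zero], fun s t hs hst => ?_, fun t ht => ?_⟩
    · obtain ⟨p, hp, h⟩ := hX.incr s t hs hst
      refine ⟨_, hD.inl_mem p hp, ?_⟩
      ext (j | j)
      · exact congrFun h j
      · simp
    · rintro (j | j)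
      · exact hX.le t ht j
      · exact le_rfl
  have h := hY.optCost_le hD.region (Sum.elim_pos hc hc)
  have heq : cumCost (Sum.elim c c) (Sum.elim v 0) (fun t => Sum.elim (X t) 0) = cumCost c v X := by
    refine lintegral_congr fun t => ?_
    congr 1
    rw [Fintype.sum_sum_type]
    simp
  rw [heq, hXc] at h
  exact (ENNReal.ofReal_le_ofReal_iff (optCost_nonneg hP hc)).1 h

lemma setLIntegral_Ioi_half (f : ℝ → ENNReal) :
    ∫⁻ t in Ioi (0 : ℝ), f (t / 2) = 2 * ∫⁻ t in Ioi (0 : ℝ), f t := by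
  have h2 : (2 : ℝ)⁻¹ ≠ 0 := by norm_num
  have hmap := Real.map_volume_mul_left h2
  have hemb : MeasurableEmbedding fun t : ℝ => 2⁻¹ * t :=
    (Homeomorph.mulLeft₀ _ h2).measurableEmbedding
  have hpre : (fun t : ℝ => 2⁻¹ * t) ⁻¹' Ioi 0 = Ioi 0 := by
    ext t; simp
  calc ∫⁻ t in Ioi (0 : ℝ), f (t / 2) = ∫⁻ t in (fun t : ℝ => 2⁻¹ * t) ⁻¹' Ioi 0, f (2⁻¹ * t) := by
        rw [hpre]; simp only [div_eq_inv_mul]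
    _ = ∫⁻ t in Ioi 0, f t ∂(Measure.map (fun t : ℝ => 2⁻¹ * t) volume) := by
        rw [hemb.restrict_map, hemb.lintegral_map]
    _ = 2 * ∫⁻ t in Ioi (0 : ℝ), f t := by
        rw [hmap, Measure.restrict_smul, lintegral_smul_measure]
        norm_num

/-- Time sharing. -/
lemma optCost_elim_le (hD : IsDoubleRegion P P₂) (hP : IsRateRegion P) (hc : ∀ j, 0 < c j)
    (hv : 0 ≤ v) (hw : 0 ≤ w) :
    optCost P₂ (Sum.elim c c) (Sum.elim v w) ≤ 2 * optCost P c v + 2 * optCost P c w := by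
  obtain ⟨X, hX, hXc⟩ := exists_optimal hP hc hv
  obtain ⟨Y, hY, hYc⟩ := exists_optimal hP hc hw
  -- Both optimal histories run simultaneously at half speed, which doubles each cost.
  have hZ : IsCumulative P₂ (Sum.elim v w) fun t => Sum.elim (X (t / 2)) (Y (t / 2)) := by
    refine ⟨by ext (j | j) <;> simp [hX.zero, hY.zero], fun s t hs hst => ?_, fun t ht => ?_⟩
    · obtain ⟨p, hp, h⟩ := hX.incr (s / 2) (t / 2) (by positivity) (by linarith)
      obtain ⟨q, hq, h'⟩ := hY.incr (s / 2) (t / 2) (by positivity) (by linarith)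
      refine ⟨_, hD.convex_comb_mem hp hq (a := 1 / 2) (b := 1 / 2) (by norm_num) (by norm_num)
        (by norm_num), ?_⟩
      ext (j | j)
      · have := congrFun h j
        simp only [Pi.sub_apply, Pi.smul_apply, smul_eq_mul, Sum.elim_inl] at this ⊢
        rw [this]; ring
      · have := congrFun h' j
        simp only [Pi.sub_apply, Pi.smul_apply, smul_eq_mul, Sum.elim_inr] at this ⊢
        rw [this]; ring
    · rintro (j | j)
      · exact hX.le _ (by positivity) j
      · exact hY.le _ (by positivity) j
  have h := hZ.optCost_le hD.region (Sum.elim_pos hc hc)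
  have hm : AEMeasurable (fun t => ENNReal.ofReal (∑ j, c j * (v j - X t j)))
      (volume.restrict (Ioi 0)) :=
    (((hX.weight_continuousOn hP).mono Ioi_subset_Ici_self).aemeasurable
      measurableSet_Ioi).ennreal_ofReal
  have heq : cumCost (Sum.elim c c) (Sum.elim v w) (fun t => Sum.elim (X (t / 2)) (Y (t / 2))) =
      2 * cumCost c v X + 2 * cumCost c w Y := by
    rw [← mul_add, cumCost, cumCost, cumCost, ← lintegral_add_left' hm, ← setLIntegral_Ioi_half]
    refine setLIntegral_congr_fun measurableSet_Ioi fun t ht => ?_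
    have ht2 : 0 ≤ t / 2 := by have := mem_Ioi.1 ht; linarith
    rw [← ENNReal.ofReal_add (hX.weight_nonneg hc ht2) (hY.weight_nonneg hc ht2),
      Fintype.sum_sum_type]
    simp
  have hX0 := optCost_nonneg (x := v) hP hc
  have hY0 := optCost_nonneg (x := w) hP hc
  have h2 : (2 : ENNReal) = ENNReal.ofReal 2 := by simp
  rw [heq, hXc, hYc, h2, ← ENNReal.ofReal_mul (by norm_num), ← ENNReal.ofReal_mul (by norm_num),
    ← ENNReal.ofReal_add (by positivity) (by positivity)] at h
  exact (ENNReal.ofReal_le_ofReal_iff (by positivity)).1 h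

/-- The potential does not increase when jobs arrive. -/
lemma potential_add_le (hD : IsDoubleRegion P P₂) (hP : IsRateRegion P) (hc : ∀ j, 0 < c j)
    {u : ι → ℝ} (hv : 0 ≤ v) (hw : 0 ≤ w) (hu : 0 ≤ u) (hvu : ∀ j, v j = 0 ∨ u j = 0)
    (hwu : ∀ j, w j = 0 ∨ u j = 0) :
    optCost P c (v + u) - optCost P₂ (Sum.elim c c) (Sum.elim (v + u) (w + u)) / 2 ≤
      optCost P c v - optCost P₂ (Sum.elim c c) (Sum.elim v w) / 2 := by
  -- With F the doubled optimum, u is added first to the second copy and then to the first. Summing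
  -- both inequalities, F(v+u,0) + F(v,u) + F(v,w) ≤ F(v+u,w+u) + 2 F(v,0). The first two terms are
  -- each at least the single-copy cost of v + u and F(v,0) is at most that of v; this explains the
  -- factor 1/2 in the potential.
  have h1 := optCost_supermodular hD.region (Sum.elim_pos hc hc)
    (Sum.elim_nonneg (add_nonneg hv hu) (le_refl (0 : ι → ℝ))) (Sum.elim_nonneg hv (add_nonneg hw hu))
  have h2 := optCost_supermodular hD.region (Sum.elim_pos hc hc) (Sum.elim_nonneg hv hu)
    (Sum.elim_nonneg hv hw)
  have e1 : Sum.elim (v + u) 0 ⊔ Sum.elim v (w + u) = Sum.elim (v + u) (w + u) := by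
    ext (j | j)
    · simpa using hu j
    · simpa using add_nonneg (hw j) (hu j)
  have e2 : Sum.elim (v + u) 0 ⊓ Sum.elim v (w + u) = Sum.elim v 0 := by
    ext (j | j)
    · simpa using hu j
    · simpa using add_nonneg (hw j) (hu j)
  have e3 : Sum.elim v u ⊔ Sum.elim v w = Sum.elim v (w + u) := by
    ext (j | j)
    · simp
    · rcases hwu j with h | h
      · simpa [h] using hu j
      · simpa [h] using hw j
  have e4 : Sum.elim v u ⊓ Sum.elim v w = Sum.elim v 0 := by
    ext (j | j)
    · simp
    · rcases hwu j with h | h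
      · simpa [h] using hu j
      · simpa [h] using hw j
  rw [e1, e2] at h1
  rw [e3, e4] at h2
  have h3 := hD.optCost_add_le hP hc (add_nonneg hv hu) (le_refl (0 : ι → ℝ)) fun j => Or.inr rfl
  have h4 := hD.optCost_add_le hP hc hv hu hvu
  have h5 := hD.optCost_elim_zero_le hc hP hv
  rw [add_zero] at h3
  linarith

end IsDoubleRegion

/-! ## Integrating differential inequalities -/

/-- One-sided derivatives suffice: an absolutely continuous function is differentiable almost
everywhere, and there its derivative equals the given right derivative. -/
lemma sub_le_integral_of_deriv_le {φ w : ℝ → ℝ} {a b : ℝ} (hab : a ≤ b)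
    (hφ : AbsolutelyContinuousOnInterval φ a b) (hw : IntervalIntegrable w volume a b)
    (h : ∀ᵐ t, t ∈ Ioo a b → ∃ r ≤ w t, HasDerivWithinAt φ r (Ici t) t) :
    φ b - φ a ≤ ∫ t in a..b, w t := by
  rw [← hφ.integral_deriv_eq_sub]
  refine intervalIntegral.integral_mono_ae_restrict hab hφ.intervalIntegrable_deriv hw ?_
  have hb : ∀ᵐ t, t ≠ b := by simp [ae_iff, measure_singleton]
  have ha : ∀ᵐ t, t ≠ a := by simp [ae_iff, measure_singleton]
  refine (ae_restrict_iff' measurableSet_Icc).2 ?_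
  filter_upwards [h, hφ.ae_differentiableAt, ha, hb] with t ht hd hta htb hmem
  rw [uIcc_of_le hab] at hd
  obtain ⟨r, h2, h1⟩ := ht ⟨lt_of_le_of_ne hmem.1 hta.symm, lt_of_le_of_ne hmem.2 htb⟩
  rw [(uniqueDiffOn_Ici t t (mem_Ici.2 le_rfl)).eq_deriv _ (hd hmem).hasDerivAt.hasDerivWithinAt h1]
  exact h2

lemma LocallyLipschitz.absolutelyContinuous_comp {ι : Type*} [Fintype ι] {F : (ι → ℝ) → ℝ}
    (hF : LocallyLipschitz F) {A : ℝ → ι → ℝ} {a b : ℝ} {K : NNReal}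
    (hA : LipschitzOnWith K A (uIcc a b)) :
    AbsolutelyContinuousOnInterval (fun t => F (A t)) a b := by
  obtain ⟨K', hK'⟩ := (hF.locallyLipschitzOn (s := A '' uIcc a b)).exists_lipschitzOnWith_of_compact
    (isCompact_uIcc.image_of_continuousOn hA.continuousOn)
  exact (hK'.comp hA (mapsTo_image A _)).absolutelyContinuousOnInterval

/-! ## Schedules -/

namespace SchedInstance

variable {n D : ℕ} {I : SchedInstance n D} {s : ℝ} {z : ℝ → Fin n → ℝ}

/-- The cost of a unit of remaining size per unit of time. -/
noncomputable def cost (I : SchedInstance n D) (j : Fin n) : ℝ := I.weight j / I.size j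

lemma cost_pos (I : SchedInstance n D) (j : Fin n) : 0 < I.cost j :=
  div_pos (I.weight_pos j) (I.size_pos j)

lemma isRateRegion (I : SchedInstance n D) : IsRateRegion I.rates :=
  isRateRegion_rateSet I.util I.util_zero I.util_one

lemma isDoubleRegion (I : SchedInstance n D) :
    IsDoubleRegion I.rates (rateSet (Sum.elim I.util I.util)) :=
  isDoubleRegion_rateSet I.util I.util_zero I.util_one

/-- The weight of the remaining sizes `x`. -/
noncomputable def load (I : SchedInstance n D) (x : Fin n → ℝ) : ℝ := ∑ j, I.cost j * x j

lemma load_nonneg {x : Fin n → ℝ} (hx : 0 ≤ x) : 0 ≤ I.load x :=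
  Finset.sum_nonneg fun j _ => mul_nonneg (I.cost_pos j).le (hx j)

/-- The gradient descent directions are those which decrease the residual optimum at a rate equal to
the total weight. -/
lemma isGDDirection_iff {x y : Fin n → ℝ} (hx : 0 ≤ x) : I.IsGDDirection x y ↔
    y ∈ I.rates ∧ (∀ j, x j = 0 → y j = 0) ∧
      HasDerivWithinAt (fun δ : ℝ => extCost I.rates I.cost (x - δ • y)) (-I.load x) (Ici 0) 0 := by
  have hP := I.isRateRegion
  have hc := I.cost_pos
  have key : ∀ {v : Fin n → ℝ} {r}, (∀ j, x j = 0 → v j = 0) → (I.HasResidualRate x v r ↔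
      HasDerivWithinAt (fun δ : ℝ => extCost I.rates I.cost (x - δ • v)) r (Ici 0) 0) :=
    fun hv => hasDerivWithinAt_optCost_iff hx hv
  constructor
  · rintro ⟨⟨hy, hy0⟩, r, hr, hmin⟩
    obtain ⟨v, hv, hv0, hvd⟩ := exists_steepest hP hc hx
    obtain ⟨r', hr', hle⟩ := hmin v ⟨hv, hv0⟩
    rw [key hy0] at hr
    rw [key hv0] at hr'
    have h1 := (uniqueDiffOn_Ici (0 : ℝ) 0 (mem_Ici.2 le_rfl)).eq_deriv _ hr' hvd
    have h2 := neg_weight_le_of_hasDerivWithinAt hP hc hx hy hy0 hr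
    rw [le_antisymm (hle.trans h1.le) h2] at hr
    exact ⟨hy, hy0, hr⟩
  · rintro ⟨hy, hy0, hd⟩
    refine ⟨⟨hy, hy0⟩, _, (key hy0).2 hd, fun v hv => ?_⟩
    obtain ⟨r', hr'⟩ := (extCost_convexOn hP hc).exists_hasDerivWithinAt_ray x v
    exact ⟨r', (key hv.2).2 hr', neg_weight_le_of_hasDerivWithinAt hP hc hx hv.1 hv.2 hr'⟩

lemma exists_norm_le_of_rates (I : SchedInstance n D) (hr : ∀ t, ∃ y ∈ I.rates, z t = s • y) :
    ∃ M : NNReal, ∀ t j, ‖z t j‖ ≤ M := by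
  obtain ⟨M, hM⟩ := I.isRateRegion.exists_bound
  refine ⟨‖s‖₊ * M, fun t j => ?_⟩
  obtain ⟨y, hy, h⟩ := hr t
  rw [h, Pi.smul_apply, norm_smul, NNReal.coe_mul, coe_nnnorm,
    Real.norm_of_nonneg (I.isRateRegion.nonneg y hy j)]
  exact mul_le_mul_of_nonneg_left (hM y hy j) (norm_nonneg s)

lemma intervalIntegrable_of_rates (hm : ∀ j, Measurable fun t => z t j)
    (hr : ∀ t, ∃ y ∈ I.rates, z t = s • y) (j : Fin n) (a b : ℝ) :
    IntervalIntegrable (fun t => z t j) volume a b := by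
  obtain ⟨M, hM⟩ := I.exists_norm_le_of_rates hr
  exact (intervalIntegrable_const (c := (M : ℝ))).mono_fun (hm j).aestronglyMeasurable
    (Filter.Eventually.of_forall fun t => by simpa using hM t j)

lemma remaining_eq_size {j : Fin n} (hz : ∀ t, t < I.arrival j → z t j = 0) {t : ℝ}
    (ht : t ≤ I.arrival j) : I.remaining z j t = I.size j := by
  rw [remaining, intervalIntegral.integral_zero_ae, sub_zero]
  have hne : ∀ᵐ τ, τ ≠ I.arrival j := by simp [ae_iff, measure_singleton]
  filter_upwards [hne] with τ hτ hmem
  exact hz τ (lt_of_le_of_ne (hmem.2.trans (max_le (I.arrival_nonneg j) ht)) hτ)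

namespace IsSchedule

lemma nonneg (hz : I.IsSchedule s z) (hs : 0 < s) (t : ℝ) (j : Fin n) : 0 ≤ z t j := by
  obtain ⟨y, hy, h⟩ := hz.2.1 t
  rw [h]
  exact mul_nonneg hs.le (I.isRateRegion.nonneg y hy j)

lemma intervalIntegrable (hz : I.IsSchedule s z) (j : Fin n) (a b : ℝ) :
    IntervalIntegrable (fun t => z t j) volume a b :=
  intervalIntegrable_of_rates hz.1 hz.2.1 j a b

lemma remaining_sub (hz : I.IsSchedule s z) (j : Fin n) (a b : ℝ) :
    I.remaining z j a - I.remaining z j b = ∫ τ in a..b, z τ j := by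
  rw [remaining, remaining, sub_sub_sub_cancel_left, intervalIntegral.integral_interval_sub_left
    (hz.intervalIntegrable j _ _) (hz.intervalIntegrable j _ _)]

lemma remaining_antitone (hz : I.IsSchedule s z) (hs : 0 < s) (j : Fin n) :
    Antitone (I.remaining z j) := by
  intro a b hab
  rw [← sub_nonneg, hz.remaining_sub]
  exact intervalIntegral.integral_nonneg hab fun t _ => hz.nonneg hs t j

lemma exists_remaining_lipschitz (hz : I.IsSchedule s z) :
    ∃ M, ∀ j, LipschitzWith M (I.remaining z j) := by
  obtain ⟨M, hM⟩ := I.exists_norm_le_of_rates hz.2.1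
  refine ⟨M, fun j => LipschitzWith.of_dist_le_mul fun a b => ?_⟩
  rw [Real.dist_eq, hz.remaining_sub, dist_comm, Real.dist_eq, ← Real.norm_eq_abs]
  exact intervalIntegral.norm_integral_le_of_norm_le_const fun t _ => hM t j

lemma continuous_remaining (hz : I.IsSchedule s z) (j : Fin n) :
    Continuous (I.remaining z j) := by
  obtain ⟨M, hM⟩ := hz.exists_remaining_lipschitz
  exact (hM j).continuous

lemma remaining_of_le_arrival (hz : I.IsSchedule s z) {j : Fin n} {t : ℝ}
    (ht : t ≤ I.arrival j) : I.remaining z j t = I.size j :=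
  remaining_eq_size (hz.2.2.1 j) ht

lemma remaining_le_size (hz : I.IsSchedule s z) (hs : 0 < s) (j : Fin n) (t : ℝ) :
    I.remaining z j t ≤ I.size j := by
  rcases le_total t (I.arrival j) with h | h
  · exact (hz.remaining_of_le_arrival h).le
  · exact (hz.remaining_antitone hs j h).trans (hz.remaining_of_le_arrival le_rfl).le

lemma ae_hasDerivAt_remaining (hz : I.IsSchedule s z) (j : Fin n) :
    ∀ᵐ t, HasDerivAt (I.remaining z j) (-z t j) t := by
  have hloc : LocallyIntegrable (fun t => z t j) := by
    obtain ⟨M, hM⟩ := I.exists_norm_le_of_rates hz.2.1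
    exact (locallyIntegrable_const (M : ℝ)).mono (hz.1 j).aestronglyMeasurable
      (Filter.Eventually.of_forall fun t => by simpa using hM t j)
  filter_upwards [LocallyIntegrable.ae_hasDerivAt_integral hloc] with t ht
  exact (ht 0).const_sub _

/-- A finished job is not processed. -/
lemma ae_rate_eq_zero (hz : I.IsSchedule s z) (j : Fin n) :
    ∀ᵐ t, I.remaining z j t = 0 → z t j = 0 := by
  filter_upwards [hz.ae_hasDerivAt_remaining j] with t ht h0
  have hmin : IsLocalMin (I.remaining z j) t :=
    Filter.Eventually.of_forall fun τ => h0.trans_le (hz.2.2.2 j τ)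
  exact neg_eq_zero.1 (hmin.hasDerivAt_eq_zero ht)

end IsSchedule

/-- Remaining sizes at time `t` of the jobs that have arrived by time `a`. -/
noncomputable def stateOf (I : SchedInstance n D) (z : ℝ → Fin n → ℝ) (a t : ℝ) : Fin n → ℝ :=
  fun j => if I.arrival j ≤ a then I.remaining z j t else 0

lemma stateOf_self (t : ℝ) : I.stateOf z t t = I.state z t := rfl

/-- The sizes of the jobs that arrive in the interval `(a, b]`. -/
noncomputable def newSizes (I : SchedInstance n D) (a b : ℝ) : Fin n → ℝ :=
  fun j => if a < I.arrival j ∧ I.arrival j ≤ b then I.size j else 0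

lemma newSizes_nonneg (a b : ℝ) : 0 ≤ I.newSizes a b := by
  intro j
  unfold newSizes
  split_ifs
  · exact (I.size_pos j).le
  · exact le_rfl

/-- Freezing the set of arrived jobs at time a makes the state continuous up to and including the
next arrival b; the jump at b is accounted for separately by `newSizes`. -/
lemma stateOf_eq_state {a b t : ℝ} (hab : ∀ j, I.arrival j ≤ a ∨ b ≤ I.arrival j) (hat : a ≤ t)
    (htb : t < b) : I.stateOf z a t = I.state z t := by
  ext j
  unfold stateOf state
  rcases hab j with h | h
  · rw [if_pos h, if_pos (h.trans hat)]
  · rw [if_neg (by linarith), if_neg (by linarith)]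

lemma stateOf_eq_zero_or (a b t : ℝ) (j : Fin n) :
    I.stateOf z a t j = 0 ∨ I.newSizes a b j = 0 := by
  unfold stateOf newSizes
  by_cases h : I.arrival j ≤ a
  · right; rw [if_neg fun h' => not_lt.2 h h'.1]
  · left; rw [if_neg h]

namespace IsSchedule

lemma stateOf_nonneg (hz : I.IsSchedule s z) (a t : ℝ) : 0 ≤ I.stateOf z a t := by
  intro j
  unfold stateOf
  split_ifs
  · exact hz.2.2.2 j t
  · exact le_rfl

lemma state_nonneg (hz : I.IsSchedule s z) (t : ℝ) : 0 ≤ I.state z t := hz.stateOf_nonneg t t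

lemma state_eq_add (hz : I.IsSchedule s z) {a b : ℝ} (hle : a ≤ b)
    (hab : ∀ j, I.arrival j ≤ a ∨ b ≤ I.arrival j) :
    I.state z b = I.stateOf z a b + I.newSizes a b := by
  ext j
  simp only [state, stateOf, newSizes, Pi.add_apply]
  by_cases h : I.arrival j ≤ a
  · rw [if_pos (h.trans hle), if_pos h, if_neg fun h' => not_lt.2 h h'.1, add_zero]
  · rw [if_neg h, zero_add]
    by_cases hb : I.arrival j ≤ b
    · rw [if_pos hb, if_pos ⟨not_le.1 h, hb⟩,
        hz.remaining_of_le_arrival ((hab j).resolve_left h)]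
    · rw [if_neg hb, if_neg fun h' => hb h'.2]

lemma exists_stateOf_lipschitz (hz : I.IsSchedule s z) (a : ℝ) :
    ∃ M, LipschitzWith M (I.stateOf z a) := by
  obtain ⟨M, hM⟩ := hz.exists_remaining_lipschitz
  refine ⟨M, LipschitzWith.of_dist_le_mul fun t τ => (dist_pi_le_iff (by positivity)).2 fun j => ?_⟩
  unfold stateOf
  split_ifs
  · exact (hM j).dist_le_mul t τ
  · rw [dist_self]; positivity

lemma ae_hasDerivAt_stateOf (hz : I.IsSchedule s z) {a b : ℝ}
    (hab : ∀ j, I.arrival j ≤ a ∨ b ≤ I.arrival j) :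
    ∀ᵐ t, t < b → HasDerivAt (I.stateOf z a) (-z t) t ∧
      ∀ j, I.stateOf z a t j = 0 → z t j = 0 := by
  filter_upwards [ae_all_iff.2 fun j => hz.ae_hasDerivAt_remaining j,
    ae_all_iff.2 fun j => hz.ae_rate_eq_zero j] with t h1 h2 htb
  refine ⟨hasDerivAt_pi.2 fun j => ?_, fun j hj => ?_⟩
  · unfold stateOf
    by_cases h : I.arrival j ≤ a
    · simp only [h, if_true]; exact h1 j
    · simp only [h, if_false]
      rw [Pi.neg_apply, hz.2.2.1 j t (htb.trans_le ((hab j).resolve_left h)), neg_zero]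
      exact hasDerivAt_const t 0
  · unfold stateOf at hj
    by_cases h : I.arrival j ≤ a
    · rw [if_pos h] at hj; exact h2 j hj
    · exact hz.2.2.1 j t (htb.trans_le ((hab j).resolve_left h))

lemma measurable_load_state (hz : I.IsSchedule s z) :
    Measurable fun t => I.load (I.state z t) := by
  unfold load state
  refine Finset.measurable_fun_sum _ fun j _ => Measurable.const_mul ?_ _
  exact Measurable.ite measurableSet_Ici (hz.continuous_remaining j).measurable measurable_const

lemma load_state_le (hz : I.IsSchedule s z) (hs : 0 < s) (t : ℝ) :
    I.load (I.state z t) ≤ I.load I.size := by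
  refine Finset.sum_le_sum fun j _ => mul_le_mul_of_nonneg_left ?_ (I.cost_pos j).le
  unfold state
  split_ifs
  · exact hz.remaining_le_size hs j t
  · exact (I.size_pos j).le

lemma intervalIntegrable_load_state (hz : I.IsSchedule s z) (hs : 0 < s) (a b : ℝ) :
    IntervalIntegrable (fun t => I.load (I.state z t)) volume a b := by
  refine (intervalIntegrable_const (c := I.load I.size)).mono_fun
    (hz.measurable_load_state).aestronglyMeasurable (Filter.Eventually.of_forall fun t => ?_)
  dsimp only
  rw [Real.norm_of_nonneg (load_nonneg (hz.state_nonneg t))]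
  exact (hz.load_state_le hs t).trans (le_abs_self _)

lemma fracFlow_eq (hz : I.IsSchedule s z) :
    I.fracFlow z = ∫⁻ t in Ioi (0 : ℝ), ENNReal.ofReal (I.load (I.state z t)) := by
  have h : ∀ j, ∫⁻ t in Ici (I.arrival j), ENNReal.ofReal (I.cost j * I.remaining z j t) =
      ∫⁻ t in Ioi (0 : ℝ), ENNReal.ofReal (I.cost j * I.state z t j) := by
    intro j
    have hind : ∀ t, ENNReal.ofReal (I.cost j * I.state z t j) =
        (Ici (I.arrival j)).indicator (fun t => ENNReal.ofReal (I.cost j * I.remaining z j t)) t := by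
      intro t
      unfold state
      by_cases h : I.arrival j ≤ t
      · rw [if_pos h, indicator_of_mem (mem_Ici.2 h)]
      · rw [if_neg h, indicator_of_notMem (fun h' => h (mem_Ici.1 h'))]; simp
    simp only [hind]
    rw [setLIntegral_congr Ioi_ae_eq_Ici, lintegral_indicator measurableSet_Ici,
      Measure.restrict_restrict measurableSet_Ici,
      inter_eq_left.2 (Ici_subset_Ici.2 (I.arrival_nonneg j))]
  have hm : ∀ j, Measurable fun t => ENNReal.ofReal (I.cost j * I.state z t j) := fun j =>
    (Measurable.const_mul (Measurable.ite measurableSet_Ici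
      (hz.continuous_remaining j).measurable measurable_const) _).ennreal_ofReal
  rw [fracFlow]
  refine (Finset.sum_congr rfl fun j _ => h j).trans ?_
  rw [← lintegral_finsetSum _ fun j _ => hm j]
  refine lintegral_congr fun t => ?_
  rw [load, ENNReal.ofReal_sum_of_nonneg fun j _ => mul_nonneg (I.cost_pos j).le
    (hz.state_nonneg t j)]

end IsSchedule

end SchedInstance

/-! ## Gradient descent against an arbitrary schedule -/

lemma HasDerivWithinAt.comp_ray {F : ℝ → ℝ} {r : ℝ} (h : HasDerivWithinAt F r (Ici 0) 0) {s : ℝ}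
    (hs : 0 ≤ s) : HasDerivWithinAt (fun δ => F (δ * s)) (s * r) (Ici 0) 0 := by
  have h1 : HasDerivWithinAt (fun δ : ℝ => δ * s) s (Ici 0) 0 := by
    simpa using (hasDerivAt_mul_const s).hasDerivWithinAt (s := Ici 0) (x := (0 : ℝ))
  have h2 : HasDerivWithinAt F r (Ici 0) ((fun δ : ℝ => δ * s) 0) := by simpa using h
  have := h2.comp 0 h1 fun δ hδ => mul_nonneg (mem_Ici.1 hδ) hs
  rwa [mul_comm] at this

lemma HasDerivAt.sumElim {ι κ : Type*} [Fintype ι] [Fintype κ] {f : ℝ → ι → ℝ} {g : ℝ → κ → ℝ}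
    {f' : ι → ℝ} {g' : κ → ℝ} {t : ℝ} (hf : HasDerivAt f f' t) (hg : HasDerivAt g g' t) :
    HasDerivAt (fun t => Sum.elim (f t) (g t)) (Sum.elim f' g') t := by
  refine hasDerivAt_pi.2 ?_
  rintro (j | j)
  · exact hasDerivAt_pi.1 hf j
  · exact hasDerivAt_pi.1 hg j

namespace SchedInstance

variable {n D : ℕ} {I : SchedInstance n D} {s : ℝ} {z y : ℝ → Fin n → ℝ}

/-- The least cost of two copies of the jobs, with remaining sizes `v` and `w`. -/
noncomputable def pairCost (I : SchedInstance n D) (v w : Fin n → ℝ) : ℝ :=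
  extCost (rateSet (Sum.elim I.util I.util)) (Sum.elim I.cost I.cost) (Sum.elim v w)

/-- The potential function. -/
noncomputable def potential (I : SchedInstance n D) (v w : Fin n → ℝ) : ℝ :=
  extCost I.rates I.cost v - 1 / 2 * I.pairCost v w

lemma potential_eq {v w : Fin n → ℝ} (hv : 0 ≤ v) (hw : 0 ≤ w) : I.potential v w =
    optCost I.rates I.cost v -
      optCost (rateSet (Sum.elim I.util I.util)) (Sum.elim I.cost I.cost) (Sum.elim v w) / 2 := by
  rw [potential, pairCost, extCost_of_nonneg hv, extCost_of_nonneg (Sum.elim_nonneg hv hw)]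
  ring

lemma potential_add_newSizes_le {v w u : Fin n → ℝ} (hv : 0 ≤ v) (hw : 0 ≤ w) (hu : 0 ≤ u)
    (hvu : ∀ j, v j = 0 ∨ u j = 0) (hwu : ∀ j, w j = 0 ∨ u j = 0) :
    I.potential (v + u) (w + u) ≤ I.potential v w := by
  rw [potential_eq hv hw, potential_eq (add_nonneg hv hu) (add_nonneg hw hu)]
  exact I.isDoubleRegion.potential_add_le I.isRateRegion I.cost_pos hv hw hu hvu hwu

lemma potential_zero_le : I.potential 0 0 ≤ 0 := by
  have hP := I.isRateRegion
  have hX : IsCumulative I.rates (0 : Fin n → ℝ) 0 :=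
    ⟨rfl, fun _ _ _ _ => ⟨0, hP.zero_mem, by simp⟩, fun _ _ => le_rfl⟩
  have h := hX.optCost_le hP I.cost_pos
  have h0 : cumCost I.cost (0 : Fin n → ℝ) 0 = 0 := by simp [cumCost]
  rw [h0, nonpos_iff_eq_zero, ENNReal.ofReal_eq_zero] at h
  have h2 := optCost_nonneg (x := Sum.elim (0 : Fin n → ℝ) (0 : Fin n → ℝ))
    I.isDoubleRegion.region (Sum.elim_pos I.cost_pos I.cost_pos)
  rw [potential_eq le_rfl le_rfl]
  linarith

/-- Between arrivals the derivative of the potential is bounded by the weights. -/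
lemma potential_deriv_le (hz : I.IsGDSchedule s z) (hs : 0 < s) (hy : I.IsSchedule 1 y) {a b : ℝ}
    (ha : 0 ≤ a) (hab : ∀ j, I.arrival j ≤ a ∨ b ≤ I.arrival j) :
    ∀ᵐ t, t ∈ Ioo a b → ∃ r ≤ (1 - s) / 2 * I.load (I.state z t) +
        (1 + s) / 2 * I.load (I.state y t),
      HasDerivWithinAt (fun t => I.potential (I.stateOf z a t) (I.stateOf y a t)) r (Ici t) t := by
  have hP := I.isRateRegion
  have hc := I.cost_pos
  have hP₂ := I.isDoubleRegion.region
  have hc₂ := Sum.elim_pos hc hc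
  filter_upwards [(ae_restrict_iff' measurableSet_Ici).1 hz.2, hz.1.ae_hasDerivAt_stateOf hab,
    hy.ae_hasDerivAt_stateOf hab] with t hgd hzt hyt ht
  obtain ⟨p, hzp, hp⟩ := hgd (ha.trans ht.1.le)
  obtain ⟨hdz, hz0⟩ := hzt ht.2
  obtain ⟨hdy, hy0⟩ := hyt ht.2
  rw [isGDDirection_iff (hz.1.state_nonneg t)] at hp
  obtain ⟨hpP, -, hd⟩ := hp
  have hez : I.stateOf z a t = I.state z t := stateOf_eq_state hab ht.1.le ht.2
  have hey : I.stateOf y a t = I.state y t := stateOf_eq_state hab ht.1.le ht.2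
  have h1 : HasDerivWithinAt (fun t => extCost I.rates I.cost (I.stateOf z a t))
      (s * -I.load (I.state z t)) (Ici t) t := by
    refine hasDerivWithinAt_extCost_comp hP hc hdz.hasDerivWithinAt ?_
    rw [hez, hzp]
    simpa only [smul_smul] using hd.comp_ray hs.le
  have hs1 : (0 : ℝ) < s + 1 := by linarith
  obtain ⟨q, hq, hyq⟩ := hy.2.1 t
  rw [one_smul] at hyq
  -- Both schedules together move in the doubled instance at speed s + 1 along a convex combination
  -- of feasible rates.
  set m : Fin n ⊕ Fin n → ℝ := Sum.elim ((s / (s + 1)) • p) ((1 / (s + 1)) • q) with hm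
  have hmem : m ∈ rateSet (Sum.elim I.util I.util) := I.isDoubleRegion.convex_comb_mem hpP hq
    (by positivity) (by positivity) (by field_simp)
  have hmz : (s + 1) • m = Sum.elim (z t) (y t) := by
    ext (j | j)
    · simp only [hm, hzp, Pi.smul_apply, smul_eq_mul, Sum.elim_inl]; field_simp
    · simp only [hm, hyq, Pi.smul_apply, smul_eq_mul, Sum.elim_inr]; field_simp
  have hm0 : ∀ i, Sum.elim (I.stateOf z a t) (I.stateOf y a t) i = 0 → m i = 0 := by
    have hne : s + 1 ≠ 0 := hs1.ne'
    intro i hi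
    have h := congrFun hmz i
    rw [Pi.smul_apply, smul_eq_mul] at h
    have h' : Sum.elim (z t) (y t) i = 0 := by
      rcases i with j | j
      · exact hz0 j hi
      · exact hy0 j hi
    rw [h', mul_eq_zero] at h
    exact h.resolve_left hne
  obtain ⟨r, hr⟩ := (extCost_convexOn hP₂ hc₂).exists_hasDerivWithinAt_ray
    (Sum.elim (I.stateOf z a t) (I.stateOf y a t)) m
  have hge := neg_weight_le_of_hasDerivWithinAt hP₂ hc₂
    (Sum.elim_nonneg (hz.1.stateOf_nonneg a t) (hy.stateOf_nonneg a t)) hmem hm0 hr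
  have h2 : HasDerivWithinAt (fun t => I.pairCost (I.stateOf z a t) (I.stateOf y a t))
      ((s + 1) * r) (Ici t) t := by
    refine hasDerivWithinAt_extCost_comp (z := (s + 1) • m) hP₂ hc₂
      (A := fun t => Sum.elim (I.stateOf z a t) (I.stateOf y a t)) ?_ ?_
    · have he : -((s + 1) • m) = Sum.elim (-z t) (-y t) := by
        rw [hmz]
        ext (j | j) <;> rfl
      rw [he]
      exact (hdz.sumElim hdy).hasDerivWithinAt
    · simpa only [smul_smul] using hr.comp_ray hs1.le
  -- The derivative is -s W(v) - (s+1) r / 2 with r ≥ -(W(v) + W(w)), where W denotes `I.load`.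
  refine ⟨_, ?_, h1.sub (h2.const_mul (1 / 2))⟩
  rw [Fintype.sum_sum_type] at hge
  simp only [Sum.elim_inl, Sum.elim_inr] at hge
  change -(I.load _ + I.load _) ≤ r at hge
  rw [hez, hey] at hge
  nlinarith

lemma potential_absolutelyContinuous (hz : I.IsSchedule s z) (hy : I.IsSchedule 1 y)
    (a b : ℝ) : AbsolutelyContinuousOnInterval
      (fun t => I.potential (I.stateOf z a t) (I.stateOf y a t)) a b := by
  obtain ⟨M, hM⟩ := hz.exists_stateOf_lipschitz a
  obtain ⟨M', hM'⟩ := hy.exists_stateOf_lipschitz a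
  have hpair : LipschitzWith (max M M')
      fun t => Sum.elim (I.stateOf z a t) (I.stateOf y a t) := by
    refine LipschitzWith.of_dist_le_mul fun t τ => (dist_pi_le_iff (by positivity)).2 ?_
    rintro (j | j)
    · exact (dist_le_pi_dist _ _ j).trans ((hM.dist_le_mul t τ).trans
        (mul_le_mul_of_nonneg_right (by simp) dist_nonneg))
    · exact (dist_le_pi_dist _ _ j).trans ((hM'.dist_le_mul t τ).trans
        (mul_le_mul_of_nonneg_right (by simp) dist_nonneg))
  exact ((extCost_locallyLipschitz I.isRateRegion I.cost_pos).absolutelyContinuous_comp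
    hM.lipschitzOnWith).sub (((extCost_locallyLipschitz I.isDoubleRegion.region
      (Sum.elim_pos I.cost_pos I.cost_pos)).absolutelyContinuous_comp
        hpair.lipschitzOnWith).const_mul (1 / 2))

lemma potential_step (hz : I.IsGDSchedule s z) (hs : 0 < s) (hy : I.IsSchedule 1 y) {a b : ℝ}
    (ha : 0 ≤ a) (hle : a ≤ b) (hab : ∀ j, I.arrival j ≤ a ∨ b ≤ I.arrival j) :
    I.potential (I.state z b) (I.state y b) ≤ I.potential (I.state z a) (I.state y a) +
      ∫ t in a..b, ((1 - s) / 2 * I.load (I.state z t) + (1 + s) / 2 * I.load (I.state y t)) := by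
  have h := sub_le_integral_of_deriv_le hle (potential_absolutelyContinuous hz.1 hy a b)
    (((hz.1.intervalIntegrable_load_state hs a b).const_mul _).add
      ((hy.intervalIntegrable_load_state one_pos a b).const_mul _))
    (potential_deriv_le hz hs hy ha hab)
  rw [stateOf_self, stateOf_self] at h
  rw [hz.1.state_eq_add hle hab, hy.state_eq_add hle hab]
  have h2 := potential_add_newSizes_le (I := I) (hz.1.stateOf_nonneg a b) (hy.stateOf_nonneg a b)
    (newSizes_nonneg a b) (stateOf_eq_zero_or a b b) (stateOf_eq_zero_or a b b)
  linarith

/-- Before every positive time there is a last arrival. -/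
lemma exists_last_arrival (I : SchedInstance n D) {T : ℝ} (hT : 0 < T) :
    ∃ a, 0 ≤ a ∧ a < T ∧ (∀ j, I.arrival j ≤ a ∨ T ≤ I.arrival j) ∧
      (a = 0 ∨ ∃ j, I.arrival j = a) := by
  obtain ⟨a, ha, hmax⟩ := Finset.exists_max_image
    (insert 0 ((Finset.univ.filter fun j => I.arrival j < T).image I.arrival)) id
    (Finset.insert_nonempty _ _)
  simp only [Finset.mem_insert, Finset.mem_image, Finset.mem_filter, Finset.mem_univ, true_and,
    id_eq] at ha hmax
  refine ⟨a, hmax 0 (Or.inl rfl), ?_, fun j => ?_, ha.imp_right fun ⟨j, _, h⟩ => ⟨j, h⟩⟩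
  · rcases ha with rfl | ⟨j, h1, rfl⟩
    · exact hT
    · exact h1
  · by_contra! h
    exact not_lt.2 (hmax _ (Or.inr ⟨j, h.2, rfl⟩)) h.1

lemma potential_le (hz : I.IsGDSchedule s z) (hs : 0 < s) (hy : I.IsSchedule 1 y) {T : ℝ}
    (hT : 0 ≤ T) : I.potential (I.state z T) (I.state y T) ≤
      ∫ t in (0 : ℝ)..T,
        ((1 - s) / 2 * I.load (I.state z t) + (1 + s) / 2 * I.load (I.state y t)) := by
  have hint : ∀ a b, IntervalIntegrable (fun t => (1 - s) / 2 * I.load (I.state z t) +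
      (1 + s) / 2 * I.load (I.state y t)) volume a b := fun a b =>
    ((hz.1.intervalIntegrable_load_state hs a b).const_mul _).add
      ((hy.intervalIntegrable_load_state one_pos a b).const_mul _)
  -- Jobs arriving at time 0 are treated as new jobs joining an empty state at time -1.
  have hbase : I.potential (I.state z 0) (I.state y 0) ≤ 0 := by
    have hu : 0 ≤ I.newSizes (-1) 0 := newSizes_nonneg _ _
    have hsta : ∀ {s : ℝ} {z : ℝ → Fin n → ℝ}, I.IsSchedule s z →
        I.state z 0 = 0 + I.newSizes (-1) 0 := fun {s z} hz => by
      rw [hz.state_eq_add (a := -1) (by norm_num) fun j => Or.inr (I.arrival_nonneg j)]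
      congr 1
      ext j
      exact if_neg (by linarith [I.arrival_nonneg j])
    rw [hsta hz.1, hsta hy]
    exact (potential_add_newSizes_le le_rfl le_rfl hu (fun _ => Or.inl rfl)
      fun _ => Or.inl rfl).trans potential_zero_le
  -- Induction on the number of arrivals before T, stepping back to the last one.
  induction hN : (Finset.univ.filter fun j => I.arrival j < T).card using Nat.strong_induction_on
    generalizing T with
  | _ N ih =>
    rcases eq_or_lt_of_le hT with rfl | hT
    · simpa using hbase
    obtain ⟨a, ha, haT, hgap, hor⟩ := I.exists_last_arrival hT
    have hstep := potential_step hz hs hy ha haT.le hgap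
    rw [← intervalIntegral.integral_add_adjacent_intervals (hint 0 a) (hint a T)]
    suffices h : I.potential (I.state z a) (I.state y a) ≤ ∫ t in (0 : ℝ)..a,
        ((1 - s) / 2 * I.load (I.state z t) + (1 + s) / 2 * I.load (I.state y t)) by linarith
    rcases hor with rfl | ⟨j, hj⟩
    · simpa using hbase
    · refine ih _ ?_ ha rfl
      rw [← hN]
      refine Finset.card_lt_card (Finset.ssubset_iff_of_subset (fun i hi => ?_) |>.2
        ⟨j, by simpa [hj] using haT, by simp [hj]⟩)
      simp only [Finset.mem_filter, Finset.mem_univ, true_and] at hi ⊢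
      exact hi.trans haT

/-- The residual optimum bounds the future cost of a schedule from below. -/
lemma ofReal_optCost_state_le (hy : I.IsSchedule 1 y) (T : ℝ) :
    ENNReal.ofReal (optCost I.rates I.cost (I.state y T)) ≤
      ∫⁻ t in Ioi T, ENNReal.ofReal (I.load (I.state y t)) := by
  have hP := I.isRateRegion
  have hyP : ∀ t, y t ∈ I.rates := fun t => by
    obtain ⟨q, hq, h⟩ := hy.2.1 t
    rwa [h, one_smul]
  set v : ℝ → Fin n → ℝ := fun t j => if I.arrival j ≤ T then y (T + t) j else 0 with hv
  have hvm : ∀ j, Measurable fun t => v t j := fun j => by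
    by_cases h : I.arrival j ≤ T
    · simp only [hv, h, if_true]
      exact (hy.1 j).comp (measurable_const_add T)
    · simp only [hv, h, if_false]
      exact measurable_const
  have hvP : ∀ t, v t ∈ I.rates := fun t => by
    refine hP.lower _ (hyP (T + t)) _ (fun j => ?_) fun j => ?_
    · simp only [hv]; split_ifs
      · exact hP.nonneg _ (hyP _) j
      · exact le_rfl
    · simp only [hv]; split_ifs
      · exact le_rfl
      · exact hP.nonneg _ (hyP _) j
  have hvi : ∀ t j, ∫ τ in (0 : ℝ)..t, v τ j = if I.arrival j ≤ T then
      I.remaining y j T - I.remaining y j (T + t) else 0 := fun t j => by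
    by_cases h : I.arrival j ≤ T
    · simp only [hv, h, if_true]
      rw [hy.remaining_sub, intervalIntegral.integral_comp_add_left (fun τ => y τ j) T,
        add_zero]
    · simp [hv, h]
  have hX := hP.isCumulative_integral (x := I.state y T) hvm hvP fun t ht j => by
    rw [hvi]
    unfold state
    split_ifs
    · linarith [hy.2.2.2 j (T + t)]
    · exact le_rfl
  refine (hX.optCost_le hP I.cost_pos).trans ?_
  rw [cumCost, ← IsCumulative.setLIntegral_Ioi_add _ T]
  refine setLIntegral_mono' measurableSet_Ioi fun t ht => ENNReal.ofReal_le_ofReal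
    (Finset.sum_le_sum fun j _ => mul_le_mul_of_nonneg_left ?_ (I.cost_pos j).le)
  have ht0 : 0 < t := ht
  rw [hvi]
  by_cases h : I.arrival j ≤ T
  · simp [state, h, h.trans (by linarith : T ≤ T + t)]
  · simpa [state, h] using hy.state_nonneg (T + t) j

lemma IsSchedule.lintegral_load_state (hz : I.IsSchedule s z) (hs : 0 < s) {T : ℝ} (hT : 0 ≤ T) :
    ∫⁻ t in Ioc 0 T, ENNReal.ofReal (I.load (I.state z t)) =
      ENNReal.ofReal (∫ t in (0 : ℝ)..T, I.load (I.state z t)) := by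
  rw [intervalIntegral.integral_of_le hT, ofReal_integral_eq_lintegral_ofReal]
  · exact (intervalIntegrable_iff_integrableOn_Ioc_of_le hT).1
      (hz.intervalIntegrable_load_state hs 0 T)
  · exact Filter.Eventually.of_forall fun t => load_nonneg (hz.state_nonneg t)

/-- The final potential may be negative, but time sharing bounds it below by minus the residual
optimum of y. That optimum is at most the cost y still has to pay after T, so only the total cost of
y appears; here (1 + s) / 2 ≥ 1 is used. -/
lemma lintegral_load_le (hz : I.IsGDSchedule s z) (hs : 1 < s) (hy : I.IsSchedule 1 y) {T : ℝ}
    (hT : 0 ≤ T) :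
    ENNReal.ofReal ((s - 1) / 2) * ∫⁻ t in Ioc 0 T, ENNReal.ofReal (I.load (I.state z t)) ≤
      ENNReal.ofReal ((1 + s) / 2) * I.fracFlow y := by
  have hs0 : 0 < s := one_pos.trans hs
  have hiz := hz.1.intervalIntegrable_load_state hs0 0 T
  have hiy := hy.intervalIntegrable_load_state one_pos 0 T
  have h := potential_le hz hs0 hy hT
  rw [intervalIntegral.integral_add (hiz.const_mul _) (hiy.const_mul _),
    intervalIntegral.integral_const_mul, intervalIntegral.integral_const_mul,
    potential_eq (hz.1.state_nonneg T) (hy.state_nonneg T)] at h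
  have h2 := I.isDoubleRegion.optCost_elim_le I.isRateRegion I.cost_pos (hz.1.state_nonneg T)
    (hy.state_nonneg T)
  have hy0 : 0 ≤ ∫ t in (0 : ℝ)..T, I.load (I.state y t) :=
    intervalIntegral.integral_nonneg hT fun t _ => load_nonneg (hy.state_nonneg t)
  have h3 : (s - 1) / 2 * ∫ t in (0 : ℝ)..T, I.load (I.state z t) ≤
      (1 + s) / 2 * ((∫ t in (0 : ℝ)..T, I.load (I.state y t)) +
        optCost I.rates I.cost (I.state y T)) := by
    have h4 := optCost_nonneg (x := I.state y T) I.isRateRegion I.cost_pos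
    nlinarith
  rw [hz.1.lintegral_load_state hs0 hT, ← ENNReal.ofReal_mul (by linarith)]
  refine (ENNReal.ofReal_le_ofReal h3).trans ?_
  rw [ENNReal.ofReal_mul (by linarith), ENNReal.ofReal_add hy0
    (optCost_nonneg I.isRateRegion I.cost_pos), hy.fracFlow_eq, ← Ioc_union_Ioi_eq_Ioi hT,
    lintegral_union measurableSet_Ioi (disjoint_left.2 fun t h1 h2 => not_lt.2 h1.2 h2),
    hy.lintegral_load_state one_pos hT]
  gcongr
  exact ofReal_optCost_state_le hy T

/-- Gradient descent with extra speed is competitive for the fractional weighted flow time. -/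
theorem fracFlow_le (hz : I.IsGDSchedule s z) (hs : 1 < s) (hy : I.IsSchedule 1 y) :
    I.fracFlow z ≤ ENNReal.ofReal ((s + 1) / (s - 1)) * I.fracFlow y := by
  have hs0 : 0 < s := one_pos.trans hs
  have hcov : AECover (volume.restrict (Ioi (0 : ℝ))) Filter.atTop fun N : ℕ => Iic (N : ℝ) :=
    aecover_Iic tendsto_natCast_atTop_atTop
  have hlim := hcov.lintegral_tendsto_of_countably_generated
    (hz.1.measurable_load_state).ennreal_ofReal.aemeasurable
  rw [hz.1.fracFlow_eq]
  refine le_of_tendsto hlim (Filter.Eventually.of_forall fun N => ?_)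
  rw [Measure.restrict_restrict measurableSet_Iic, Iic_inter_Ioi]
  have h := lintegral_load_le hz hs hy N.cast_nonneg
  have hpos : 0 < (s - 1) / 2 := by linarith
  have he : (s + 1) / (s - 1) = ((s - 1) / 2)⁻¹ * ((1 + s) / 2) := by
    field_simp; ring
  rw [he, ENNReal.ofReal_mul (by positivity), ENNReal.ofReal_inv_of_pos hpos, mul_assoc]
  exact (ENNReal.mul_le_iff_le_inv (ENNReal.ofReal_pos.2 hpos).ne' ENNReal.ofReal_ne_top).1 h

end SchedInstance

/-! ## Gradient descent is online -/

namespace SchedInstance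

variable {n D : ℕ} {I I' : SchedInstance n D} {s T : ℝ} {x : Fin n → ℝ}

/-- An idle job constrains nothing, because every utility is nonnegative on nonnegative allocations.
-/
lemma mem_rates_of_util_eq {z : Fin n → ℝ} (hz : z ∈ I.rates)
    (h : ∀ j, z j ≠ 0 → I.util j = I'.util j) : z ∈ I'.rates := by
  obtain ⟨r, hr0, hr1, hrz⟩ := hz
  refine ⟨r, hr0, hr1, fun j => ⟨(hrz j).1, ?_⟩⟩
  by_cases hj : z j = 0
  · rw [hj]
    exact (I'.util_zero j).trans ((I'.util j).eval_mono le_rfl (hr0 j))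
  · rw [← h j hj]
    exact (hrz j).2

/-- A job with nothing left has rate zero almost everywhere; making it zero everywhere changes no
integral and removes its utility, size and weight from the problem. -/
lemma residualCosts_subset (h : ∀ j, x j ≠ 0 → I.size j = I'.size j ∧ I.weight j = I'.weight j ∧
    I.util j = I'.util j) {w : Fin n → ℝ} (hw : ∀ j, x j = 0 → w j = 0) :
    I.residualCosts w ⊆ I'.residualCosts w := by
  rintro c ⟨z, hzm, hzP, hi, hi2, hzw, rfl⟩
  have hz0 : ∀ j, x j = 0 → (fun t => z t j) =ᵐ[volume.restrict (Ioi 0)] 0 := fun j hj => by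
    refine (setIntegral_eq_zero_iff_of_nonneg_ae (Filter.Eventually.of_forall fun t => ?_)
      (hi j)).1 ((hzw j).trans (hw j hj))
    exact I.isRateRegion.nonneg _ (hzP t) j
  refine ⟨fun t j => if x j = 0 then 0 else z t j, fun j => ?_, fun t => ?_, fun j => ?_,
    fun j => ?_, fun j => ?_, Finset.sum_congr rfl fun j _ => ?_⟩
  · dsimp only; split_ifs
    · exact measurable_const
    · exact hzm j
  · refine mem_rates_of_util_eq (I.isRateRegion.lower _ (hzP t) _ (fun j => ?_) fun j => ?_)
      fun j hj => (h j fun h0 => hj (if_pos h0)).2.2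
    · dsimp only; split_ifs
      · exact le_rfl
      · exact I.isRateRegion.nonneg _ (hzP t) j
    · dsimp only; split_ifs
      · exact I.isRateRegion.nonneg _ (hzP t) j
      · exact le_rfl
  · dsimp only; split_ifs
    · exact integrableOn_zero
    · exact hi j
  · dsimp only; split_ifs
    · simp
    · exact hi2 j
  · dsimp only; split_ifs with hj
    · simp [hw j hj]
    · exact hzw j
  · dsimp only; split_ifs with hj
    · have : ∫ t in Ioi (0 : ℝ), t * z t j = 0 := by
        refine integral_eq_zero_of_ae ?_
        filter_upwards [hz0 j hj] with t ht
        simp only [Pi.zero_apply] at ht ⊢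
        rw [ht, mul_zero]
      simp [this]
    · rw [(h j hj).1, (h j hj).2.1]

lemma IsGDDirection.of_eq (h : ∀ j, x j ≠ 0 → I.size j = I'.size j ∧ I.weight j = I'.weight j ∧
    I.util j = I'.util j) {z : Fin n → ℝ} (hz : I.IsGDDirection x z) : I'.IsGDDirection x z := by
  have h' : ∀ j, x j ≠ 0 → I'.size j = I.size j ∧ I'.weight j = I.weight j ∧
      I'.util j = I.util j := fun j hj =>
    ⟨(h j hj).1.symm, (h j hj).2.1.symm, (h j hj).2.2.symm⟩
  have hres : ∀ {v : Fin n → ℝ}, (∀ j, x j = 0 → v j = 0) → ∀ {r},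
      (I.HasResidualRate x v r ↔ I'.HasResidualRate x v r) := fun {v} hv r => by
    have : ∀ δ : ℝ, I.residualOpt (x - δ • v) = I'.residualOpt (x - δ • v) := fun δ => by
      have hw : ∀ j, x j = 0 → (x - δ • v) j = 0 := fun j hj => by simp [hj, hv j hj]
      rw [residualOpt, residualOpt,
        (residualCosts_subset h hw).antisymm (residualCosts_subset h' hw)]
    simp only [HasResidualRate, this]
  obtain ⟨⟨hzP, hz0⟩, r, hr, hmin⟩ := hz
  refine ⟨⟨mem_rates_of_util_eq hzP fun j hj => (h j fun h0 => hj (hz0 j h0)).2.2, hz0⟩, r,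
    (hres hz0).1 hr, fun v hv => ?_⟩
  obtain ⟨r', hr', hle⟩ := hmin v ⟨mem_rates_of_util_eq hv.1 fun j hj =>
    (h' j fun h0 => hj (hv.2 j h0)).2.2, hv.2⟩
  exact ⟨r', (hres hv.2).1 hr', hle⟩

end SchedInstance

/-! ## Existence of gradient descent schedules -/

lemma IsCumulative.historyRate_eq_zero {ι : Type*} [Fintype ι] {P : Set (ι → ℝ)} {x : ι → ℝ}
    {X : ℝ → ι → ℝ} (hP : IsRateRegion P) (hX : IsCumulative P x X) {j : ι} (hj : x j = 0)
    (t : ℝ) : historyRate X t j = 0 := by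
  unfold historyRate
  split_ifs with ht
  · by_cases hd : DifferentiableAt ℝ X t
    · have h1 := hasDerivAt_pi.1 hd.hasDerivAt j
      have h2 : (fun t => X t j) =ᶠ[nhds t] fun _ => 0 := by
        filter_upwards [lt_mem_nhds ht] with τ hτ
        exact le_antisymm (hj ▸ hX.le τ hτ.le j) (hX.nonneg hP hτ.le j)
      exact (h1.congr_of_eventuallyEq h2.symm).unique (hasDerivAt_const t 0)
    · rw [deriv_zero_of_not_differentiableAt hd]; rfl
  · rfl

lemma ae_comp_mul_sub {p : ℝ → Prop} (hp : ∀ᵐ t, p t) {s : ℝ} (hs : s ≠ 0) (d : ℝ) :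
    ∀ᵐ t, p (s * t - d) := by
  rw [ae_iff] at hp ⊢
  have h := Real.volume_preimage_mul_left hs ((fun u => u + -d) ⁻¹' {t | ¬p t})
  rw [measure_preimage_add_right, hp, mul_zero] at h
  simp only [sub_eq_add_neg]
  exact h

namespace SchedInstance

variable {n D : ℕ} {I : SchedInstance n D} {s T : ℝ} {z : ℝ → Fin n → ℝ}

/-- Follow the schedule `z` until time `T`, then the history `X` at speed `s`. -/
noncomputable def follow (s T : ℝ) (z X : ℝ → Fin n → ℝ) (t : ℝ) : Fin n → ℝ :=
  if t < T then z t else s • historyRate X (s * t - s * T)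

section Follow

variable {X : ℝ → Fin n → ℝ}

lemma measurable_follow (hz : ∀ j, Measurable fun t => z t j) (j : Fin n) :
    Measurable fun t => follow s T z X t j := by
  have h : (fun t => follow s T z X t j) =
      fun t => if t < T then z t j else s * historyRate X (s * t - s * T) j := by
    ext t
    unfold follow
    split_ifs <;> rfl
  rw [h]
  exact Measurable.ite measurableSet_Iio (hz j)
    (((measurable_pi_iff.1 (historyRate_measurable X) j).comp (by fun_prop)).const_mul s)

lemma follow_mem (hz : I.IsSchedule s z) (hX : IsCumulative I.rates (I.state z T) X) (t : ℝ) :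
    ∃ y ∈ I.rates, follow s T z X t = s • y := by
  unfold follow
  split_ifs
  · exact hz.2.1 t
  · exact ⟨_, hX.historyRate_mem I.isRateRegion _, rfl⟩

lemma integral_follow_of_le (hT : 0 ≤ T) {t : ℝ} (ht : t ≤ T) (j : Fin n) :
    ∫ τ in (0 : ℝ)..t, follow s T z X τ j = ∫ τ in (0 : ℝ)..t, z τ j := by
  refine intervalIntegral.integral_congr_ae ?_
  have hne : ∀ᵐ τ, τ ≠ T := by simp [ae_iff, measure_singleton]
  filter_upwards [hne] with τ hτ hmem
  rw [follow, if_pos (lt_of_le_of_ne (hmem.2.trans (max_le hT ht)) hτ)]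

lemma remaining_follow_of_le (hT : 0 ≤ T) {t : ℝ} (ht : t ≤ T) (j : Fin n) :
    I.remaining (follow s T z X) j t = I.remaining z j t := by
  rw [remaining, remaining, integral_follow_of_le hT ht]

lemma remaining_follow (hz : I.IsSchedule s z) (hs : 0 < s) (hT : 0 ≤ T)
    (hX : IsCumulative I.rates (I.state z T) X) {t : ℝ} (ht : T ≤ t) (j : Fin n) :
    I.remaining (follow s T z X) j t = I.remaining z j T - X (s * t - s * T) j := by
  have h1 : ∫ τ in T..t, follow s T z X τ j = X (s * t - s * T) j := by
    have hcongr : ∫ τ in T..t, follow s T z X τ j =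
        ∫ τ in T..t, s * historyRate X (s * τ - s * T) j := by
      refine intervalIntegral.integral_congr fun τ hτ => ?_
      rw [uIcc_of_le ht] at hτ
      simp only [follow, if_neg (not_lt.2 hτ.1), Pi.smul_apply, smul_eq_mul]
    have hcomp := intervalIntegral.smul_integral_comp_mul_sub (a := T) (b := t)
      (fun τ => historyRate X τ j) s (s * T)
    rw [hcongr, intervalIntegral.integral_const_mul, ← smul_eq_mul, hcomp, sub_self,
      hX.integral_historyRate I.isRateRegion j (sub_nonneg.2 (by gcongr))]
  have hi := fun a b => intervalIntegrable_of_rates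
    (measurable_follow (s := s) (T := T) (X := X) hz.1) (follow_mem hz hX) j a b
  rw [remaining, remaining, ← intervalIntegral.integral_add_adjacent_intervals (hi 0 T) (hi T t), h1,
    integral_follow_of_le hT le_rfl]
  ring

lemma follow_isSchedule (hz : I.IsSchedule s z) (hs : 0 < s) (hT : 0 ≤ T)
    (hX : IsCumulative I.rates (I.state z T) X) : I.IsSchedule s (follow s T z X) := by
  have hP := I.isRateRegion
  refine ⟨measurable_follow hz.1, follow_mem hz hX, fun j t ht => ?_, fun j t => ?_⟩
  · unfold follow
    split_ifs with htT
    · exact hz.2.2.1 j t ht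
    · have h0 : I.state z T j = 0 := if_neg (by linarith)
      rw [Pi.smul_apply, hX.historyRate_eq_zero hP h0, smul_zero]
  · rcases le_total t T with ht | ht
    · rw [remaining_follow_of_le hT ht]
      exact hz.2.2.2 j t
    · rw [remaining_follow hz hs hT hX ht, sub_nonneg]
      refine (hX.le _ (sub_nonneg.2 (by gcongr)) j).trans ?_
      unfold state
      split_ifs
      · exact le_rfl
      · exact hz.2.2.2 j T

lemma state_follow (hz : I.IsSchedule s z) (hs : 0 < s) (hT : 0 ≤ T)
    (hX : IsCumulative I.rates (I.state z T) X) {t : ℝ} (ht : T ≤ t)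
    (hgap : ∀ j, I.arrival j ≤ T ∨ t < I.arrival j) :
    I.state (follow s T z X) t = I.state z T - X (s * t - s * T) := by
  have hτ : 0 ≤ s * t - s * T := sub_nonneg.2 (by gcongr)
  ext j
  rcases hgap j with h | h
  · simp only [state, h, h.trans ht, if_true, Pi.sub_apply]
    exact remaining_follow hz hs hT hX ht j
  · have h0 : I.state z T j = 0 := if_neg (by linarith)
    have h1 := hX.le _ hτ j
    have h2 := hX.nonneg I.isRateRegion hτ j
    rw [h0] at h1
    rw [Pi.sub_apply, h0, le_antisymm h1 h2, state, if_neg (by linarith)]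
    simp

end Follow

/-- At time `t` the schedule `z` of speed `s` follows the gradient descent rule. -/
def FollowsGD (I : SchedInstance n D) (s : ℝ) (z : ℝ → Fin n → ℝ) (t : ℝ) : Prop :=
  ∃ y, z t = s • y ∧ I.IsGDDirection (I.state z t) y

/-- Gradient descent until time `T` can be continued until the next arrival. -/
lemma exists_extension (hz : I.IsSchedule s z) (hs : 0 < s) (hT : 0 ≤ T)
    (hgd : ∀ᵐ t, 0 ≤ t → t < T → I.FollowsGD s z t) :
    ∃ z', I.IsSchedule s z' ∧
      ∀ᵐ t, 0 ≤ t → (∀ j, I.arrival j ≤ T ∨ t < I.arrival j) → I.FollowsGD s z' t := by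
  -- An optimal residual history moves in steepest directions at almost every time, so running it s
  -- times as fast obeys the rule until the next arrival.
  obtain ⟨X, hX, hopt⟩ := exists_optimal I.isRateRegion I.cost_pos (hz.state_nonneg T)
  refine ⟨follow s T z X, follow_isSchedule hz hs hT hX, ?_⟩
  have hne : ∀ᵐ τ, τ ≠ T := by simp [ae_iff, measure_singleton]
  filter_upwards [hgd, hne, ae_comp_mul_sub (hX.ae_steepest I.isRateRegion I.cost_pos hopt) hs.ne'
    (s * T)] with t h1 h2 h3 ht hgap
  rcases lt_or_gt_of_ne h2 with htT | htT
  · obtain ⟨y, hy, hd⟩ := h1 ht htT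
    refine ⟨y, by rw [follow, if_pos htT, hy], ?_⟩
    convert hd using 1
    ext j
    simp only [state, remaining_follow_of_le hT htT.le]
  · obtain ⟨h4, h5⟩ := h3 (sub_pos.2 (by gcongr))
    refine ⟨historyRate X (s * t - s * T), if_neg (by linarith), ?_⟩
    rw [state_follow hz hs hT hX htT.le hgap,
      isGDDirection_iff (hX.sub_nonneg' (sub_nonneg.2 (by gcongr)))]
    exact ⟨hX.historyRate_mem I.isRateRegion _, h4, h5⟩

/-- Induction on the number of arrivals after T, recomputing an optimal residual history at each
arrival. -/
lemma exists_isGDSchedule_of_extension (hs : 0 < s) (hz : I.IsSchedule s z) (hT : 0 ≤ T)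
    (hgd : ∀ᵐ t, 0 ≤ t → t < T → I.FollowsGD s z t) : ∃ z', I.IsGDSchedule s z' := by
  induction hN : (Finset.univ.filter fun j => T < I.arrival j).card using Nat.strong_induction_on
    generalizing T z with
  | _ N ih =>
    obtain ⟨z', hz', hgd'⟩ := exists_extension hz hs hT hgd
    rcases (Finset.univ.filter fun j => T < I.arrival j).eq_empty_or_nonempty with hemp | hne
    · refine ⟨z', hz', (ae_restrict_iff' measurableSet_Ici).2 ?_⟩
      filter_upwards [hgd'] with t ht h0
      refine ht h0 fun j => Or.inl (not_lt.1 fun hj => ?_)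
      have : j ∈ Finset.univ.filter fun j => T < I.arrival j := by simpa using hj
      rw [hemp] at this
      exact Finset.notMem_empty j this
    · obtain ⟨i, hi, hmin⟩ := Finset.exists_min_image _ I.arrival hne
      simp only [Finset.mem_filter, Finset.mem_univ, true_and] at hi hmin
      refine ih _ ?_ hz' (hT.trans hi.le) ?_ rfl
      · rw [← hN]
        refine Finset.card_lt_card (Finset.ssubset_iff_of_subset (fun k hk => ?_) |>.2
          ⟨i, by simpa using hi, by simp⟩)
        simp only [Finset.mem_filter, Finset.mem_univ, true_and] at hk ⊢
        exact hi.trans hk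
      · filter_upwards [hgd'] with t ht h0 hti
        refine ht h0 fun j => ?_
        by_cases hj : T < I.arrival j
        · exact Or.inr (hti.trans_le (hmin j hj))
        · exact Or.inl (not_lt.1 hj)

/-- Gradient descent can be followed at every speed. -/
theorem exists_isGDSchedule (I : SchedInstance n D) (hs : 0 < s) : ∃ z, I.IsGDSchedule s z := by
  refine exists_isGDSchedule_of_extension hs (z := 0) (T := 0) ?_ le_rfl
    (Filter.Eventually.of_forall fun t h h' => absurd h' (not_lt.2 h))
  refine ⟨fun _ => measurable_const, fun _ => ⟨0, I.isRateRegion.zero_mem, by simp⟩,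
    fun _ _ _ => rfl, fun j t => ?_⟩
  simpa [remaining] using (I.size_pos j).le

end SchedInstance

/-! ## From fractional to integral flow time -/

/-- Writes a flow time, possibly infinite, as the measure of a set of times, for comparison with the
integrals in `fracFlow`. The strict version gives times when the job is surely unfinished; the
non-strict one excludes only times when it is surely finished. -/
lemma volume_setOf_ofReal_lt {r : ℝ} (hr : 0 ≤ r) (C : ENNReal) :
    volume {t : ℝ | r ≤ t ∧ ENNReal.ofReal t < C} = C - ENNReal.ofReal r := by
  induction C with
  | top =>
    have : {t : ℝ | r ≤ t ∧ ENNReal.ofReal t < ⊤} = Ici r := by ext t; simp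
    rw [this, Real.volume_Ici, ENNReal.top_sub ENNReal.ofReal_ne_top]
  | coe C =>
    have : {t : ℝ | r ≤ t ∧ ENNReal.ofReal t < C} = Ico r C := by
      ext t
      refine and_congr_right fun ht => ?_
      rw [← ENNReal.ofReal_coe_nnreal, ENNReal.ofReal_lt_ofReal_iff_of_nonneg (hr.trans ht)]
    rw [this, Real.volume_Ico, ENNReal.ofReal_sub _ hr, ENNReal.ofReal_coe_nnreal]

lemma volume_setOf_ofReal_le {r : ℝ} (hr : 0 ≤ r) (C : ENNReal) :
    volume {t : ℝ | r ≤ t ∧ ENNReal.ofReal t ≤ C} = C - ENNReal.ofReal r := by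
  induction C with
  | top =>
    have : {t : ℝ | r ≤ t ∧ ENNReal.ofReal t ≤ ⊤} = Ici r := by ext t; simp
    rw [this, Real.volume_Ici, ENNReal.top_sub ENNReal.ofReal_ne_top]
  | coe C =>
    have : {t : ℝ | r ≤ t ∧ ENNReal.ofReal t ≤ C} = Icc r C := by
      ext t
      refine and_congr_right fun ht => ?_
      rw [← ENNReal.ofReal_coe_nnreal, ENNReal.ofReal_le_ofReal_iff C.coe_nonneg]
    rw [this, Real.volume_Icc, ENNReal.ofReal_sub _ hr, ENNReal.ofReal_coe_nnreal]

lemma measurableSet_ofReal_le (r : ℝ) (C : ENNReal) :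
    MeasurableSet {t : ℝ | r ≤ t ∧ ENNReal.ofReal t ≤ C} :=
  measurableSet_Ici.inter (ENNReal.measurable_ofReal measurableSet_Iic)

lemma measurableSet_ofReal_lt (r : ℝ) (C : ENNReal) :
    MeasurableSet {t : ℝ | r ≤ t ∧ ENNReal.ofReal t < C} :=
  measurableSet_Ici.inter (ENNReal.measurable_ofReal measurableSet_Iio)

namespace SchedInstance

variable {n D : ℕ} {I : SchedInstance n D} {s c : ℝ} {z y : ℝ → Fin n → ℝ}

/-- The unfinished fraction of a job is at most 1 until its completion and 0 afterwards. -/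
lemma fracFlow_le_flow (hy : I.IsSchedule s y) (hs : 0 < s) : I.fracFlow y ≤ I.flow y := by
  refine Finset.sum_le_sum fun j _ => ?_
  rw [← volume_setOf_ofReal_le (I.arrival_nonneg j), ← setLIntegral_const]
  rw [← lintegral_indicator (measurableSet_ofReal_le _ _)]
  refine (setLIntegral_mono_ae' measurableSet_Ici (Filter.Eventually.of_forall fun t ht => ?_)).trans
    (setLIntegral_le_lintegral _ _)
  by_cases hC : ENNReal.ofReal t ≤ I.completion y j
  · rw [indicator_of_mem (by exact ⟨ht, hC⟩)]
    refine ENNReal.ofReal_le_ofReal ?_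
    calc I.weight j / I.size j * I.remaining y j t ≤ I.weight j / I.size j * I.size j :=
          mul_le_mul_of_nonneg_left (hy.remaining_le_size hs j t) (I.cost_pos j).le
      _ = I.weight j := div_mul_cancel₀ _ (I.size_pos j).ne'
  · rw [not_le, completion, iInf_lt_iff] at hC
    obtain ⟨t0, ht0⟩ := hC
    rw [iInf_lt_iff] at ht0
    obtain ⟨⟨-, h1⟩, h2⟩ := ht0
    have h3 := hy.remaining_antitone hs j ((ENNReal.ofReal_lt_ofReal_iff'.1 h2).1).le
    rw [ENNReal.ofReal_of_nonpos]
    · exact zero_le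
    · exact mul_nonpos_of_nonneg_of_nonpos (I.cost_pos j).le (h3.trans h1)

/-- The simulation processes `c` times as much as `z`, as long as the job is not finished. -/
lemma integral_speedUp (hz : I.IsSchedule s z) (hs : 0 < s) (hc : 0 < c) (j : Fin n) {t : ℝ}
    (ht : 0 ≤ t) : ∫ τ in (0 : ℝ)..t, I.speedUp c z τ j =
      min (c * ∫ τ in (0 : ℝ)..t, z τ j) (I.size j) := by
  set Z : ℝ → ℝ := fun t => ∫ τ in (0 : ℝ)..t, z τ j with hZ
  have hZr : ∀ t, Z t = I.size j - I.remaining z j t := fun t => by simp [hZ, remaining]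
  have hcont : Continuous fun t => c * Z t := by
    simp only [hZr]
    exact continuous_const.mul (continuous_const.sub (hz.continuous_remaining j))
  have hmono : ∀ {a b}, a ≤ b → c * Z a ≤ c * Z b := fun {a b} hab => by
    rw [hZr, hZr]
    have := hz.remaining_antitone hs j hab
    gcongr
  have hbefore : ∀ {T}, 0 ≤ T → (∀ τ, 0 ≤ τ → τ < T → c * Z τ < I.size j) →
      ∫ τ in (0 : ℝ)..T, I.speedUp c z τ j = c * Z T := fun {T} hT h => by
    rw [hZ, ← intervalIntegral.integral_const_mul]
    refine intervalIntegral.integral_congr_ae ?_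
    have hne : ∀ᵐ τ, τ ≠ T := by simp [ae_iff, measure_singleton]
    filter_upwards [hne] with τ hτ hmem
    rw [uIoc_of_le hT] at hmem
    exact if_pos (h τ hmem.1.le (lt_of_le_of_ne hmem.2 hτ))
  rcases lt_or_ge (c * Z t) (I.size j) with hlt | hge
  · rw [min_eq_left hlt.le]
    exact hbefore ht fun τ _ hτ => (hmono hτ.le).trans_lt hlt
  rw [min_eq_right hge]
  have hcomp : IsCompact (Icc 0 t ∩ {τ | I.size j ≤ c * Z τ}) :=
    isCompact_Icc.inter_right (isClosed_le continuous_const hcont)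
  -- First time at which the simulation has completed the job; by the intermediate value theorem the
  -- size is then met exactly.
  obtain ⟨T, ⟨⟨hT0, hTt⟩, hTs⟩, hmin⟩ := hcomp.exists_isLeast ⟨t, ⟨ht, le_rfl⟩, hge⟩
  have hlt : ∀ τ, 0 ≤ τ → τ < T → c * Z τ < I.size j := fun τ h0 hτ => by
    by_contra! h
    exact not_le.2 hτ (hmin ⟨⟨h0, hτ.le.trans hTt⟩, h⟩)
  have hZ0 : c * Z 0 = 0 := by simp [hZ]
  have hTeq : c * Z T = I.size j := by
    obtain ⟨τ, hτ, hτs⟩ := intermediate_value_Icc hT0 hcont.continuousOn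
      (show I.size j ∈ Icc (c * Z 0) (c * Z T) from ⟨hZ0.trans_le (I.size_pos j).le, hTs⟩)
    have hTτ := hmin ⟨⟨hτ.1, hτ.2.trans hTt⟩, hτs.ge⟩
    rwa [le_antisymm hTτ hτ.2]
  have hafter : ∀ τ ∈ uIcc T t, I.speedUp c z τ j = 0 := fun τ hτ => by
    rw [uIcc_of_le hTt] at hτ
    exact if_neg (not_lt.2 (hTeq.ge.trans (hmono hτ.1)))
  have hi1 : IntervalIntegrable (fun τ => I.speedUp c z τ j) volume 0 T := by
    refine ((hz.intervalIntegrable j 0 T).const_mul c).congr_ae ?_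
    refine (ae_restrict_iff' measurableSet_uIoc).2 ?_
    have hne : ∀ᵐ τ, τ ≠ T := by simp [ae_iff, measure_singleton]
    filter_upwards [hne] with τ hτ hmem
    rw [uIoc_of_le hT0] at hmem
    exact (if_pos (hlt τ hmem.1.le (lt_of_le_of_ne hmem.2 hτ))).symm
  have hi2 : IntervalIntegrable (fun τ => I.speedUp c z τ j) volume T t :=
    (intervalIntegrable_const (c := (0 : ℝ))).congr fun τ hτ =>
      (hafter τ (uIoc_subset_uIcc hτ)).symm
  rw [← intervalIntegral.integral_add_adjacent_intervals hi1 hi2, hbefore hT0 hlt,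
    intervalIntegral.integral_congr hafter, hTeq]
  simp

lemma remaining_speedUp (hz : I.IsSchedule s z) (hs : 0 < s) (hc : 0 < c) (j : Fin n) {t : ℝ}
    (ht : 0 ≤ t) : I.remaining (I.speedUp c z) j t =
      max (I.size j - c * ∫ τ in (0 : ℝ)..t, z τ j) 0 := by
  rw [remaining, integral_speedUp hz hs hc j ht]
  rcases le_total (c * ∫ τ in (0 : ℝ)..t, z τ j) (I.size j) with h | h
  · rw [min_eq_left h, max_eq_left (sub_nonneg.2 h)]
  · rw [min_eq_right h, max_eq_right (sub_nonpos.2 h), sub_self]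

lemma speedUp_isSchedule (hz : I.IsSchedule s z) (hs : 0 < s) (hc : 0 < c) :
    I.IsSchedule (c * s) (I.speedUp c z) := by
  have hZm : ∀ j, Measurable fun t => ∫ τ in (0 : ℝ)..t, z τ j := fun j => by
    have h : (fun t => ∫ τ in (0 : ℝ)..t, z τ j) = fun t => I.size j - I.remaining z j t := by
      ext t; simp [remaining]
    rw [h]
    exact measurable_const.sub (hz.continuous_remaining j).measurable
  have harr : ∀ j t, t < I.arrival j → I.speedUp c z t j = 0 := fun j t ht => by
    unfold speedUp
    split_ifs
    · rw [hz.2.2.1 j t ht, mul_zero]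
    · rfl
  refine ⟨fun j => ?_, fun t => ?_, harr, fun j t => ?_⟩
  · exact Measurable.ite (measurableSet_lt ((hZm j).const_mul c) measurable_const)
      ((hz.1 j).const_mul c) measurable_const
  · obtain ⟨y, hy, hzy⟩ := hz.2.1 t
    refine ⟨fun j => if c * (∫ τ in (0 : ℝ)..t, z τ j) < I.size j then y j else 0,
      I.isRateRegion.lower y hy _ (fun j => ?_) fun j => ?_, ?_⟩
    · dsimp only; split_ifs
      · exact I.isRateRegion.nonneg y hy j
      · exact le_rfl
    · dsimp only; split_ifs
      · exact le_rfl
      · exact I.isRateRegion.nonneg y hy j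
    · ext j
      simp only [speedUp, hzy, Pi.smul_apply, smul_eq_mul]
      split_ifs <;> ring
  · rcases le_total 0 t with ht | ht
    · rw [remaining_speedUp hz hs hc j ht]
      exact le_max_right _ _
    · rw [remaining_eq_size (harr j) (ht.trans (I.arrival_nonneg j))]
      exact (I.size_pos j).le

/-- The integral flow time of the simulation is bounded by the fractional flow time. -/
lemma flow_speedUp_le (hz : I.IsSchedule s z) (hs : 0 < s) (hc : 1 < c) :
    ENNReal.ofReal (1 - c⁻¹) * I.flow (I.speedUp c z) ≤ I.fracFlow z := by
  have hc0 : 0 < c := one_pos.trans hc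
  have hc1 : 0 < 1 - c⁻¹ := sub_pos.2 (inv_lt_one_of_one_lt₀ hc)
  rw [flow, Finset.mul_sum]
  refine Finset.sum_le_sum fun j _ => ?_
  rw [← mul_assoc, ← ENNReal.ofReal_mul hc1.le, ← volume_setOf_ofReal_lt (I.arrival_nonneg j),
    ← setLIntegral_const]
  refine (setLIntegral_mono_ae' (measurableSet_ofReal_lt _ _)
    (g := fun t => ENNReal.ofReal (I.weight j / I.size j * I.remaining z j t))
    (Filter.Eventually.of_forall fun t ht => ?_)).trans
    (lintegral_mono_set fun t ht => ht.1)
  refine ENNReal.ofReal_le_ofReal ?_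
  have h1 : 0 < I.remaining (I.speedUp c z) j t := by
    by_contra! h
    exact not_le.2 ht.2 (iInf₂_le t ⟨ht.1, h⟩)
  rw [remaining_speedUp hz hs hc0 j ((I.arrival_nonneg j).trans ht.1), lt_max_iff] at h1
  have h2 := sub_pos.1 (h1.resolve_right (lt_irrefl 0))
  -- Unfinished in the simulation means that z has processed less than a fraction 1/c of the job.
  have h3 : (1 - c⁻¹) * I.size j ≤ I.remaining z j t := by
    have h4 : (∫ τ in (0 : ℝ)..t, z τ j) ≤ c⁻¹ * I.size j := by
      rw [le_inv_mul_iff₀ hc0]; exact h2.le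
    rw [remaining]; linarith
  calc (1 - c⁻¹) * I.weight j = I.weight j / I.size j * ((1 - c⁻¹) * I.size j) := by
        field_simp [(I.size_pos j).ne']
    _ ≤ I.weight j / I.size j * I.remaining z j t :=
        mul_le_mul_of_nonneg_left h3 (I.cost_pos j).le

/-- Gradient descent, followed by the conversion, is competitive for the weighted flow time. -/
theorem flow_le (hz : I.IsGDSchedule c z) (hc : 1 < c) (hy : I.IsSchedule 1 y) :
    I.flow (I.speedUp c z) ≤
      ENNReal.ofReal ((1 - c⁻¹)⁻¹ * ((c + 1) / (c - 1))) * I.flow y := by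
  have hc0 : 0 < c := one_pos.trans hc
  have hc1 : 0 < 1 - c⁻¹ := sub_pos.2 (inv_lt_one_of_one_lt₀ hc)
  have h := (flow_speedUp_le hz.1 hc0 hc).trans ((fracFlow_le hz hc hy).trans
    (mul_le_mul_right (fracFlow_le_flow hy one_pos) _))
  rw [ENNReal.ofReal_mul (by positivity), ENNReal.ofReal_inv_of_pos hc1, mul_assoc]
  exact (ENNReal.mul_le_iff_le_inv (ENNReal.ofReal_pos.2 hc1).ne' ENNReal.ofReal_ne_top).1 h

end SchedInstance

theorem mainTheorem8 :
    -- the greedy procedure computes a demanded bundle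
    (∀ (D : ℕ) (u : SpeedUpUtility D) (q : Fin D → ℝ), 0 ≤ q →
      ∀ L : List (Fin D), IsGreedyOrder u.a q L → u.greedy q L ∈ demand u.eval q) ∧
    -- the utility is linear-substitute and has the two further properties
    (∀ (D : ℕ) (u : SpeedUpUtility D), LinearSubstitute u.eval) ∧
    (∀ (D : ℕ) (u : SpeedUpUtility D), ScalingShrinksDemand u.eval) ∧
    (∀ (D : ℕ) (u : SpeedUpUtility D), RaisingLowersUtility u.eval) ∧
    -- the gradient descent rule is online: it depends on the unfinished jobs only
    (∀ (n D : ℕ) (I I' : SchedInstance n D) (x : Fin n → ℝ), 0 ≤ x →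
      (∀ j, x j ≠ 0 → I.size j = I'.size j ∧ I.weight j = I'.weight j ∧ I.util j = I'.util j) →
      ∀ z, I.IsGDDirection x z ↔ I'.IsGDDirection x z) ∧
    -- gradient descent can be followed at any speed
    (∀ (n D : ℕ) (I : SchedInstance n D) (s : ℝ), 0 < s → ∃ z, I.IsGDSchedule s z) ∧
    -- gradient descent is scalable for total fractional weighted flow time
    (∀ ε : ℝ, 0 < ε → ∃ C : NNReal, ∀ (n D : ℕ) (I : SchedInstance n D) (z : ℝ → Fin n → ℝ),
      I.IsGDSchedule (1 + ε) z →
      ∀ y, I.IsSchedule 1 y → I.fracFlow z ≤ C * I.fracFlow y) ∧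
    -- and, through the standard conversion, for total weighted flow time
    (∀ ε : ℝ, 0 < ε → ∃ C : NNReal, ∀ (n D : ℕ) (I : SchedInstance n D) (z : ℝ → Fin n → ℝ),
      I.IsGDSchedule (Real.sqrt (1 + ε)) z →
      I.IsSchedule (1 + ε) (I.speedUp (Real.sqrt (1 + ε)) z) ∧
      ∀ y, I.IsSchedule 1 y → I.flow (I.speedUp (Real.sqrt (1 + ε)) z) ≤ C * I.flow y) := by
  refine ⟨fun D u q hq L hL => u.greedy_mem_demand hq hL, fun D u => u.linearSubstitute,
    fun D u => u.scalingShrinksDemand, fun D u => u.raisingLowersUtility,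
    fun n D I I' x _ h z => ⟨fun hz => hz.of_eq h, fun hz => hz.of_eq fun j hj =>
      ⟨(h j hj).1.symm, (h j hj).2.1.symm, (h j hj).2.2.symm⟩⟩,
    fun n D I s hs => I.exists_isGDSchedule hs, fun ε hε => ?_, fun ε hε => ?_⟩
  · exact ⟨((1 + ε + 1) / (1 + ε - 1)).toNNReal, fun n D I z hz y hy =>
      SchedInstance.fracFlow_le hz (by linarith) hy⟩
  · have hc : 1 < Real.sqrt (1 + ε) := by
      rw [Real.lt_sqrt one_pos.le]; linarith
    -- The constant is read off from `flow_le`, as `ENNReal.ofReal` is the coercion of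
    -- `Real.toNNReal`. Gradient descent and the simulation each contribute a factor √(1+ε) to the
    -- speed.
    refine ⟨_, fun n D I z hz => ⟨?_, fun y hy => SchedInstance.flow_le hz hc hy⟩⟩
    have h := SchedInstance.speedUp_isSchedule hz.1 (one_pos.trans hc) (one_pos.trans hc)
    rwa [Real.mul_self_sqrt (by linarith)] at h
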